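/- Work over $\mathbb{C}$. For $n\ge 0$ let $\mathbb{P}_n=\mathbb{P}(\mathcal{O}\oplus\mathcal{O}(n))\to\mathbb{P}^1$. Let $\sigma\in H^0(\mathbb{P}^1,\mathcal{O}(8))$ be a section with $8$ distinct zeros. For a section $s$ of $\mathcal{O}(8)$ let $E_s\subset\mathbb{P}_8$ be the image of the section of $\mathbb{P}_8\to\mathbb{P}^1$ that corresponds to the cokernel of $(\mathrm{id},s):\mathcal{O}\to\mathcal{O}\oplus\mathcal{O}(8)$; so on $\{x\neq\infty\}\subset\mathbb{P}^1$, with affine coordinate $x$ and a suitable affine fibre coordinate $t$ on each $\mathbb{P}_n$, $E_s$ is given by $t+s(x)=0$. Let $\mu:\mathbb{P}_2\to\mathbb{P}_8$ be the Kummer covering of degree $4$ over $\mathbb{P}^1$ that is given by the fourth powers of the homogeneous fibre coordinates, i.e. $(x,t)\mapsto(x,t^4)$. Let $$f=\frac{t^4+\sigma(x)}{t^4}\in\mathbb{C}(\mathbb{P}_2)^{\times},$$ and let $\mathcal{Y}\to\mathbb{P}_2$ be the double covering given by $\sqrt{f}$, i.e. the normalization of $\mathbb{P}_2$ in $\mathbb{C}(\mathbb{P}_2)[w]/(w^2-f)$.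 Let $C$ be the cyclic covering of degree $4$ of $\mathbb{P}^1$ given by $y^4=\sigma(x)$ (branched at the $8$ zeros of $\sigma$), and let $\mathbb{E}$ be the elliptic curve given by $y^4=x(x-1)^2$; both are taken as the normalizations of $\mathbb{P}^1$ in the corresponding extensions of its function field. Let $\xi$ be a primitive fourth root of unity, let $\gamma_1$ and $\gamma_2$ be the automorphisms $(x,y)\mapsto(x,\xi y)$ of $C$ and $\mathbb{E}$, and let $C\times\mathbb{E}/\langle(1,1)\rangle$ be the quotient of $C\times\mathbb{E}$ by the group generated by $(\gamma_1,\gamma_2)$. Then $\operatorname{div}(f)=\mu^*E_\sigma-\mu^*E_0$, where $\mu^*E_0$ is four times the curve $\{t=0\}$ (so that $\mathcal{Y}$ is the double covering of $\mathbb{P}_2$ ramified along $\mu^*E_\sigma$), and $\mathcal{Y}$ is birationally equivalent over $\mathbb{C}$ to $C\times\mathbb{E}/\langle(1,1)\rangle$. -/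

import Mathlib

noncomputable section
namespace KummerK3
open CategoryTheory CategoryTheory.Limits AlgebraicGeometry

theorem isIntegral_of_cover {X U V : Scheme.{0}} (i : U ⟶ X) (j : V ⟶ X) [IsOpenImmersion i]
    [IsOpenImmersion j] [IsIntegral U] [IsIntegral V]
    (hc : ∀ x, (∃ y, i y = x) ∨ ∃ y, j y = x) (hm : ∃ a b, i a = j b) : IsIntegral X := by
  have hi : IsIrreducible (Set.range i) := by
    rw [← Set.image_univ]
    exact (IrreducibleSpace.isIrreducible_univ U).image _ i.continuous.continuousOn
  have hj : IsIrreducible (Set.range j) := by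
    rw [← Set.image_univ]
    exact (IrreducibleSpace.isIrreducible_univ V).image _ j.continuous.continuousOn
  have : IrreducibleSpace X := by
    rw [irreducibleSpace_def]
    convert! hi.closure
    refine (Set.eq_univ_of_forall fun x ↦ ?_).symm
    obtain (hx | hx) := hc x
    · exact subset_closure hx
    · obtain ⟨a, b, hab⟩ := hm
      exact closure_mono Set.inter_subset_right
        (subset_closure_inter_of_isPreirreducible_of_isOpen hj.2
          i.isOpenEmbedding.isOpen_range ⟨_, ⟨b, rfl⟩, ⟨a, hab⟩⟩ hx)
  have : IsReduced X := by
    have h (x : X) : _root_.IsReduced (X.presheaf.stalk x) := by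
      obtain (⟨y, rfl⟩ | ⟨y, rfl⟩) := hc x
      · exact isReduced_of_injective (i.stalkMap y).hom
          (asIso (i.stalkMap y)).commRingCatIsoToRingEquiv.injective
      · exact isReduced_of_injective (j.stalkMap y).hom
          (asIso (j.stalkMap y)).commRingCatIsoToRingEquiv.injective
    exact isReduced_of_isReduced_stalk X
  exact isIntegral_of_irreducibleSpace_of_isReduced X

section P1
open Polynomial LaurentPolynomial
variable (R : Type) [CommRing R]

/-- The unit `t ^ n` of `R[t, t⁻¹]`. -/
def tUnit (n : ℤ) : R[T;T⁻¹]ˣ where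
  val := T n
  inv := T (-n)
  val_inv := by rw [← T_add]; simp
  inv_val := by rw [← T_add]; simp

/-- The open immersion `Spec R[t, t⁻¹] ⟶ Spec R[t]`. -/
def gm₀ : Spec (.of R[T;T⁻¹]) ⟶ Spec (.of R[X]) :=
  Spec.map (CommRingCat.ofHom (toLaurent : R[X] →+* R[T;T⁻¹]))

/-- The open immersion `Spec R[t, t⁻¹] ⟶ Spec R[s]`, `s = t⁻¹`. -/
def gm₁ : Spec (.of R[T;T⁻¹]) ⟶ Spec (.of R[X]) :=
  Spec.map (CommRingCat.ofHom (eval₂RingHom LaurentPolynomial.C (T (-1))))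

instance : IsOpenImmersion (gm₀ R) :=
  IsOpenImmersion.of_isLocalization (R := R[X]) (S := R[T;T⁻¹]) (X : R[X])

theorem range_gm₀ : Set.range (gm₀ R) =
    {p : Spec (.of R[X]) | (X : R[X]) ∉ p.asIdeal} :=
  PrimeSpectrum.localization_away_comap_range R[T;T⁻¹] (X : R[X])

instance : IsOpenImmersion (gm₁ R) := by
  let e : CommRingCat.of R[T;T⁻¹] ≅ CommRingCat.of R[T;T⁻¹] :=
    (invert (R := R)).toRingEquiv.toCommRingCatIso
  have : gm₁ R = Spec.map e.hom ≫ gm₀ R := by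
    simp only [gm₁, gm₀, ← Spec.map_comp]
    congr 1
    ext x
    · simp [e]
    · simp [e]
  rw [this]
  infer_instance

/-- The projective line over `R`, glued from `Spec R[t]` and `Spec R[s]` along `s = t⁻¹`. -/
def P1 : Scheme.{0} := pushout (gm₀ R) (gm₁ R)

namespace P1

/-- The chart `Spec R[t]`. -/
def ι₀ : Spec (.of R[X]) ⟶ P1 R := pushout.inl _ _

/-- The chart `Spec R[s]`, `s = t⁻¹`. -/
def ι₁ : Spec (.of R[X]) ⟶ P1 R := pushout.inr _ _

instance : IsOpenImmersion (ι₀ R) :=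
  inferInstanceAs (IsOpenImmersion (colimit.ι (span (gm₀ R) (gm₁ R)) WalkingSpan.left))

instance : IsOpenImmersion (ι₁ R) :=
  inferInstanceAs (IsOpenImmersion (colimit.ι (span (gm₀ R) (gm₁ R)) WalkingSpan.right))

theorem glue : gm₀ R ≫ ι₀ R = gm₁ R ≫ ι₁ R := pushout.condition

/-- The structure morphism of the projective line. -/
def str : P1 R ⟶ Spec (.of R) :=
  pushout.desc (Spec.map (CommRingCat.ofHom Polynomial.C)) (Spec.map (CommRingCat.ofHom Polynomial.C)) (by
    simp only [gm₀, gm₁, ← Spec.map_comp, ← CommRingCat.ofHom_comp]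
    congr 2
    ext x
    simp)

theorem ι₀_str : ι₀ R ≫ str R = Spec.map (CommRingCat.ofHom Polynomial.C) :=
  pushout.inl_desc _ _ _

theorem ι₁_str : ι₁ R ≫ str R = Spec.map (CommRingCat.ofHom Polynomial.C) :=
  pushout.inr_desc _ _ _

variable {R} {S : Type} [CommRing S]

/-- The ring homomorphism `R[t] ⟶ S[t]` given by `φ` on coefficients and by `t ↦ u * t ^ k`. -/
def coordMap (φ : R →+* S) (u : Sˣ) (k : ℕ) : R[X] →+* S[X] :=
  eval₂RingHom (Polynomial.C.comp φ) (Polynomial.C (u : S) * X ^ k)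

/-- The morphism `P1 S ⟶ P1 R` given by `φ` on the base and by `t ↦ u * t ^ k` on the fibres
(so by `s ↦ u⁻¹ * s ^ k` in the coordinate `s = t⁻¹`). -/
def map (φ : R →+* S) (u : Sˣ) (k : ℕ) : P1 S ⟶ P1 R :=
  pushout.map _ _ _ _ (Spec.map (CommRingCat.ofHom (coordMap φ u k)))
    (Spec.map (CommRingCat.ofHom (coordMap φ u⁻¹ k)))
    (Spec.map (CommRingCat.ofHom (LaurentPolynomial.eval₂ (LaurentPolynomial.C.comp φ)
      (Units.map (LaurentPolynomial.C : S →+* S[T;T⁻¹]).toMonoidHom u * tUnit S 1 ^ k))))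
    (by
      simp only [gm₀, ← Spec.map_comp, ← CommRingCat.ofHom_comp]
      congr 2
      ext x
      · simp [coordMap]
      · simp [coordMap, tUnit])
    (by
      simp only [gm₁, ← Spec.map_comp, ← CommRingCat.ofHom_comp]
      congr 2
      ext x
      · simp [coordMap]
      · simp [coordMap, tUnit, T_pow])


theorem exists_chart (x : P1 R) : (∃ y, ι₀ R y = x) ∨ ∃ y, ι₁ R y = x := by
  obtain ⟨i, y, hy⟩ := Scheme.IsLocallyDirected.ι_jointly_surjective (span (gm₀ R) (gm₁ R)) x
  obtain (_ | _ | _) := i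
  · refine .inl ⟨gm₀ R y, ?_⟩
    have h := colimit.w (span (gm₀ R) (gm₁ R)) WalkingSpan.Hom.fst
    exact (congr($h y)).trans hy
  · exact .inl ⟨y, hy⟩
  · exact .inr ⟨y, hy⟩

theorem ι₀_eq_ι₁ {a b : Spec (.of R[X])} (h : ι₀ R a = ι₁ R b) :
    ∃ c, gm₀ R c = a ∧ gm₁ R c = b := by
  obtain ⟨k, fi, fj, x, h₁, h₂⟩ := (Scheme.IsLocallyDirected.ι_eq_ι_iff (span (gm₀ R) (gm₁ R))
    (i := WalkingSpan.left) (j := WalkingSpan.right)).mp h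
  obtain (_ | _ | _) := k
  · obtain rfl : fi = WalkingSpan.Hom.fst := Subsingleton.elim _ _
    obtain rfl : fj = WalkingSpan.Hom.snd := Subsingleton.elim _ _
    exact ⟨x, h₁, h₂⟩
  · exact nomatch fj
  · exact nomatch fi

theorem ι₀_map (φ : R →+* S) (u : Sˣ) (k : ℕ) :
    ι₀ S ≫ map φ u k = Spec.map (CommRingCat.ofHom (coordMap φ u k)) ≫ ι₀ R :=
  pushout.inl_desc _ _ _

theorem ι₁_map (φ : R →+* S) (u : Sˣ) (k : ℕ) :
    ι₁ S ≫ map φ u k = Spec.map (CommRingCat.ofHom (coordMap φ u⁻¹ k)) ≫ ι₁ R :=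
  pushout.inr_desc _ _ _

theorem hom_ext {Y : Scheme.{0}} {f g : P1 R ⟶ Y} (h₀ : ι₀ R ≫ f = ι₀ R ≫ g)
    (h₁ : ι₁ R ≫ f = ι₁ R ≫ g) : f = g :=
  pushout.hom_ext h₀ h₁

theorem isOpenImmersion_coordMap (φ : R →+* S) [IsOpenImmersion (Spec.map (CommRingCat.ofHom φ))]
    (u : Sˣ) : IsOpenImmersion (Spec.map (CommRingCat.ofHom (coordMap φ u 1))) := by
  let := φ.toAlgebra
  let := Polynomial.algebra R S
  have h := isPullback_SpecMap_of_isPushout _ _ _ _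
    (CommRingCat.isPushout_of_isPushout R S R[X] S[X])
  have h1 : IsOpenImmersion (Spec.map (CommRingCat.ofHom (algebraMap R[X] S[X]))) :=
    MorphismProperty.of_isPullback (P := @IsOpenImmersion) h ‹_›
  let e : S[X] ≃+* S[X] := RingEquiv.ofRingHom (coordMap (RingHom.id S) u 1)
    (coordMap (RingHom.id S) u⁻¹ 1) (by ext x <;> simp [coordMap, ← mul_assoc, ← map_mul])
    (by ext x <;> simp [coordMap, ← mul_assoc, ← map_mul])
  have : Spec.map (CommRingCat.ofHom (coordMap φ u 1)) = Spec.map e.toCommRingCatIso.hom ≫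
      Spec.map (CommRingCat.ofHom (algebraMap R[X] S[X])) := by
    rw [← Spec.map_comp]
    congr 1
    ext x <;> simp [coordMap, e] <;> rfl
  rw [this]
  infer_instance

theorem isOpenImmersion_map (φ : R →+* S) [IsOpenImmersion (Spec.map (CommRingCat.ofHom φ))]
    (u : Sˣ) : IsOpenImmersion (map φ u 1) := by
  have h₀ : IsOpenImmersion (ι₀ S ≫ map φ u 1) := by
    have := isOpenImmersion_coordMap φ u
    rw [ι₀_map]; infer_instance
  have h₁ : IsOpenImmersion (ι₁ S ≫ map φ u 1) := by
    have := isOpenImmersion_coordMap φ u⁻¹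
    rw [ι₁_map]; infer_instance
  have key (a b : Spec (.of S[X])) (h : map φ u 1 (ι₀ S a) = map φ u 1 (ι₁ S b)) :
      ι₀ S a = ι₁ S b := by
    have h' := h
    simp only [← Scheme.Hom.comp_apply] at h'
    rw [ι₀_map, ι₁_map] at h'
    simp only [Scheme.Hom.comp_apply] at h'
    obtain ⟨c, hc, -⟩ := ι₀_eq_ι₁ h'
    have ha : a ∈ Set.range (gm₀ S) := by
      rw [range_gm₀]
      have : (X : R[X]) ∉ (Spec.map (CommRingCat.ofHom (coordMap φ u 1)) a).asIdeal := by
        rw [← hc]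
        exact (range_gm₀ R).le ⟨c, rfl⟩
      intro hX
      refine this ?_
      change coordMap φ u 1 X ∈ a.asIdeal
      simpa [coordMap] using hX
    obtain ⟨a, rfl⟩ := ha
    have hg : ι₀ S (gm₀ S a) = ι₁ S (gm₁ S a) := congr($(glue S) a)
    rw [hg] at h ⊢
    exact congr(ι₁ S $((ι₁ S ≫ map φ u 1).isOpenEmbedding.injective (by simpa using h)))
  refine IsOpenImmersion.of_forall_source_exists _ ?_ ?_
  · intro x y h
    obtain (⟨a, rfl⟩ | ⟨a, rfl⟩) := exists_chart x <;>
    obtain (⟨b, rfl⟩ | ⟨b, rfl⟩) := exists_chart y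
    · exact congr(ι₀ S $((ι₀ S ≫ map φ u 1).isOpenEmbedding.injective (by simpa using h)))
    · exact key _ _ h
    · exact (key _ _ h.symm).symm
    · exact congr(ι₁ S $((ι₁ S ≫ map φ u 1).isOpenEmbedding.injective (by simpa using h)))
  · intro x
    obtain (⟨a, rfl⟩ | ⟨a, rfl⟩) := exists_chart x
    · exact ⟨_, ι₀ S, inferInstance, ⟨a, rfl⟩, h₀⟩
    · exact ⟨_, ι₁ S, inferInstance, ⟨a, rfl⟩, h₁⟩

theorem map_comp {A : Type} [CommRing A] (φ : R →+* S) (u : Sˣ) (k : ℕ) (ψ : S →+* A) (v : Aˣ)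
    (l : ℕ) : map ψ v l ≫ map φ u k =
      map (ψ.comp φ) (Units.map ψ.toMonoidHom u * v ^ k) (k * l) := by
  refine hom_ext ?_ ?_
  · rw [reassoc_of% (ι₀_map), ι₀_map, ι₀_map, ← Spec.map_comp_assoc, ← CommRingCat.ofHom_comp]
    congr 3
    ext x
    · simp [coordMap]
    · simp [coordMap, mul_pow, ← pow_mul, mul_comm l k, mul_assoc]
  · rw [reassoc_of% (ι₁_map), ι₁_map, ι₁_map, ← Spec.map_comp_assoc, ← CommRingCat.ofHom_comp]
    congr 3
    refine Polynomial.ringHom_ext (fun x ↦ by simp [coordMap]) ?_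
    simp [coordMap, mul_pow, ← pow_mul, mul_comm l k]
    ring

theorem map_str (φ : R →+* S) (u : Sˣ) (k : ℕ) :
    map φ u k ≫ str R = str S ≫ Spec.map (CommRingCat.ofHom φ) := by
  refine hom_ext ?_ ?_
  · rw [reassoc_of% (ι₀_map), ι₀_str, reassoc_of% (ι₀_str), ← Spec.map_comp, ← Spec.map_comp]
    congr 1
    ext x
    simp [coordMap]
  · rw [reassoc_of% (ι₁_map), ι₁_str, reassoc_of% (ι₁_str), ← Spec.map_comp, ← Spec.map_comp]
    congr 1
    ext x
    simp [coordMap]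

instance [IsDomain R] : IsIntegral (P1 R) :=
  isIntegral_of_cover (ι₀ R) (ι₁ R) exists_chart
    (by
      obtain ⟨x⟩ : Nonempty (Spec (.of R[T;T⁻¹])) := inferInstance
      exact ⟨_, _, congr($(glue R) x)⟩)

end P1
end P1

section Hirzebruch
open Polynomial LaurentPolynomial

/-- The ring homomorphism `ℂ[x'] ⟶ ℂ[x, x⁻¹]`, `x' ↦ x⁻¹`. -/
def invX : ℂ[X] →+* ℂ[T;T⁻¹] := eval₂RingHom LaurentPolynomial.C (T (-1))

/-- The part of `ℙ(𝒪 ⊕ 𝒪(n))` over `ℂ[x, x⁻¹]`, embedded in the part over `ℂ[x]`. -/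
def hirzGlue₀ : P1 ℂ[T;T⁻¹] ⟶ P1 ℂ[X] := P1.map toLaurent 1 1

/-- The part of `ℙ(𝒪 ⊕ 𝒪(n))` over `ℂ[x, x⁻¹]`, embedded in the part over `ℂ[x']`, `x' = x⁻¹`;
the fibre coordinates satisfy `t' = x ^ (-n) * t`. -/
def hirzGlue₁ (n : ℕ) : P1 ℂ[T;T⁻¹] ⟶ P1 ℂ[X] := P1.map invX (tUnit ℂ (-n)) 1

instance : IsOpenImmersion hirzGlue₀ :=
  have : IsOpenImmersion (Spec.map (CommRingCat.ofHom (toLaurent : ℂ[X] →+* ℂ[T;T⁻¹]))) :=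
    inferInstanceAs (IsOpenImmersion (gm₀ ℂ))
  P1.isOpenImmersion_map _ _

instance (n : ℕ) : IsOpenImmersion (hirzGlue₁ n) :=
  have : IsOpenImmersion (Spec.map (CommRingCat.ofHom invX)) :=
    inferInstanceAs (IsOpenImmersion (gm₁ ℂ))
  P1.isOpenImmersion_map _ _

/-- The ruled surface `ℙ(𝒪 ⊕ 𝒪(n)) = Proj Sym (𝒪 ⊕ 𝒪(n))` over the complex projective line with
homogeneous coordinates `x₀, x₁`. With `x = x₁ / x₀`, the sheaf `𝒪(n)` is generated by `x₀ ^ n` over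
`Spec ℂ[x]` and by `x₁ ^ n = x ^ n * x₀ ^ n` over `Spec ℂ[x⁻¹]`. If `y₁, y₂` denote the homogeneous
fibre coordinates given by `1 ∈ 𝒪` and by the generator of `𝒪(n)`, then the affine fibre coordinate
`t = y₁ / y₂` changes by `t' = x ^ (-n) * t`. -/
def Hirz (n : ℕ) : Scheme.{0} := pushout hirzGlue₀ (hirzGlue₁ n)

namespace Hirz

/-- The part over `Spec ℂ[x]`. -/
def j₀ (n : ℕ) : P1 ℂ[X] ⟶ Hirz n := pushout.inl _ _

/-- The part over `Spec ℂ[x⁻¹]`. -/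
def j₁ (n : ℕ) : P1 ℂ[X] ⟶ Hirz n := pushout.inr _ _

instance (n : ℕ) : IsOpenImmersion (j₀ n) :=
  inferInstanceAs (IsOpenImmersion (colimit.ι (span hirzGlue₀ (hirzGlue₁ n)) WalkingSpan.left))

instance (n : ℕ) : IsOpenImmersion (j₁ n) :=
  inferInstanceAs (IsOpenImmersion (colimit.ι (span hirzGlue₀ (hirzGlue₁ n)) WalkingSpan.right))

theorem glue (n : ℕ) : hirzGlue₀ ≫ j₀ n = hirzGlue₁ n ≫ j₁ n := pushout.condition

theorem exists_chart {n : ℕ} (x : Hirz n) : (∃ y, j₀ n y = x) ∨ ∃ y, j₁ n y = x := by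
  obtain ⟨i, y, hy⟩ :=
    Scheme.IsLocallyDirected.ι_jointly_surjective (span hirzGlue₀ (hirzGlue₁ n)) x
  obtain (_ | _ | _) := i
  · refine .inl ⟨hirzGlue₀ y, ?_⟩
    have h := colimit.w (span hirzGlue₀ (hirzGlue₁ n)) WalkingSpan.Hom.fst
    exact (congr($h y)).trans hy
  · exact .inl ⟨y, hy⟩
  · exact .inr ⟨y, hy⟩

instance (n : ℕ) : IsIntegral (Hirz n) :=
  isIntegral_of_cover (j₀ n) (j₁ n) exists_chart
    (by
      obtain ⟨x⟩ : Nonempty (P1 ℂ[T;T⁻¹]) := inferInstance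
      exact ⟨_, _, congr($(glue n) x)⟩)

/-- The projection of `ℙ(𝒪 ⊕ 𝒪(n))` onto the projective line. -/
def proj (n : ℕ) : Hirz n ⟶ P1 ℂ :=
  pushout.desc (P1.str ℂ[X] ≫ P1.ι₀ ℂ) (P1.str ℂ[X] ≫ P1.ι₁ ℂ) (by
    simp only [hirzGlue₀, hirzGlue₁, reassoc_of% (P1.map_str)]
    exact congr(P1.str _ ≫ $(P1.glue ℂ)))

/-- The morphism `ℙ(𝒪 ⊕ 𝒪(n)) ⟶ ℙ(𝒪 ⊕ 𝒪(k * n))` over the projective line which is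
`(y₁ : y₂) ↦ (y₁ ^ k : y₂ ^ k)` on the fibres. -/
def mu (n k : ℕ) : Hirz n ⟶ Hirz (k * n) :=
  pushout.map _ _ _ _ (P1.map (RingHom.id _) 1 k) (P1.map (RingHom.id _) 1 k)
    (P1.map (RingHom.id _) 1 k)
    (by
      simp only [hirzGlue₀, P1.map_comp]
      simp)
    (by
      simp only [hirzGlue₁, P1.map_comp]
      congr 1
      · ext <;> simp [tUnit, T_pow]
      · simp)

/-- The dehomogenization `σ(1, x)` of a form `σ(x₀, x₁)`. -/
def dehom₀ (σ : MvPolynomial (Fin 2) ℂ) : ℂ[X] := MvPolynomial.aeval ![1, X] σ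

/-- The dehomogenization `σ(x', 1)` of a form `σ(x₀, x₁)`. -/
def dehom₁ (σ : MvPolynomial (Fin 2) ℂ) : ℂ[X] := MvPolynomial.aeval ![X, 1] σ

theorem invX_dehom₁ {n : ℕ} {σ : MvPolynomial (Fin 2) ℂ} (hσ : σ.IsHomogeneous n) :
    invX (dehom₁ σ) = T (-n) * toLaurent (dehom₀ σ) := by
  have h₁ : invX (dehom₁ σ) =
      MvPolynomial.eval₂ (LaurentPolynomial.C : ℂ →+* ℂ[T;T⁻¹]) ![T (-1), 1] σ := by
    rw [dehom₁, MvPolynomial.aeval_def, MvPolynomial.hom_eval₂]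
    congr 1
    · ext x; simp [invX]
    · funext i; fin_cases i <;> simp [invX]
  have h₀ : toLaurent (dehom₀ σ) =
      MvPolynomial.eval₂ (LaurentPolynomial.C : ℂ →+* ℂ[T;T⁻¹]) ![1, T 1] σ := by
    rw [dehom₀, MvPolynomial.aeval_def, MvPolynomial.hom_eval₂]
    congr 1
    · ext x; simp
    · funext i; fin_cases i <;> simp
  rw [h₁, h₀, MvPolynomial.eval₂_eq', MvPolynomial.eval₂_eq', Finset.mul_sum]
  refine Finset.sum_congr rfl fun d hd ↦ ?_
  have hn : d 0 + d 1 = n := by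
    have := hσ (MvPolynomial.mem_support_iff.mp hd)
    rwa [Finsupp.weight_apply, Finsupp.sum_fintype _ _ (by simp), Fin.sum_univ_two,
      Pi.one_apply, Pi.one_apply, smul_eq_mul, smul_eq_mul, mul_one, mul_one] at this
  simp only [Fin.prod_univ_two, Matrix.cons_val_zero, Matrix.cons_val_one, one_pow, mul_one,
    one_mul, T_pow]
  rw [mul_left_comm, ← T_add]
  congr 2
  lia

/-- The section `E_σ` of `ℙ(𝒪 ⊕ 𝒪(n))` given by `id ⊕ σ : 𝒪 ⟶ 𝒪 ⊕ 𝒪(n)`, that is, by the quotient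
`𝒪 ⊕ 𝒪(n) ⟶ 𝒪(n)`, `(a, b) ↦ b - σ * a`, onto its cokernel. It maps `1 ∈ 𝒪` to `-σ`, so that it is
`t = y₁ / y₂ = -σ(1, x)` over `Spec ℂ[x]`. The section `E_0` is the case `σ = 0`. -/
def sectionE {n : ℕ} (σ : MvPolynomial (Fin 2) ℂ) (hσ : σ.IsHomogeneous n) : P1 ℂ ⟶ Hirz n :=
  pushout.desc
    (Spec.map (CommRingCat.ofHom (evalRingHom (-dehom₀ σ))) ≫ P1.ι₀ ℂ[X] ≫ j₀ n)
    (Spec.map (CommRingCat.ofHom (evalRingHom (-dehom₁ σ))) ≫ P1.ι₀ ℂ[X] ≫ j₁ n) (by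
    have h₀ : gm₀ ℂ ≫ Spec.map (CommRingCat.ofHom (evalRingHom (-dehom₀ σ))) =
        Spec.map (CommRingCat.ofHom (evalRingHom (-toLaurent (dehom₀ σ)))) ≫
          Spec.map (CommRingCat.ofHom (P1.coordMap toLaurent 1 1)) := by
      simp only [gm₀, ← Spec.map_comp, ← CommRingCat.ofHom_comp]
      congr 2
      ext x <;> simp [P1.coordMap]
    have h₁ : gm₁ ℂ ≫ Spec.map (CommRingCat.ofHom (evalRingHom (-dehom₁ σ))) =
        Spec.map (CommRingCat.ofHom (evalRingHom (-toLaurent (dehom₀ σ)))) ≫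
          Spec.map (CommRingCat.ofHom (P1.coordMap invX (tUnit ℂ (-n)) 1)) := by
      simp only [gm₁, ← Spec.map_comp, ← CommRingCat.ofHom_comp]
      congr 2
      refine Polynomial.ringHom_ext (fun x ↦ by simp [P1.coordMap, invX]) ?_
      simpa [P1.coordMap, tUnit, invX] using invX_dehom₁ hσ
    rw [reassoc_of% h₀, reassoc_of% h₁, ← reassoc_of% (P1.ι₀_map), ← reassoc_of% (P1.ι₀_map)]
    exact congr(_ ≫ _ ≫ $(glue n)))

end Hirz
end Hirzebruch

section Kummer
open Polynomial

/-- An affine open chart of an integral scheme embeds its coordinate ring in the function field. -/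
def chartToFunctionField {Y : Scheme.{0}} [IsIntegral Y] {R : CommRingCat.{0}} [Nonempty (Spec R)]
    (i : Spec R ⟶ Y) [IsOpenImmersion i] : R →+* Y.functionField :=
  haveI : Nonempty (i ''ᵁ ⊤ : Y.Opens) :=
    let ⟨x⟩ : Nonempty (Spec R) := inferInstance
    ⟨⟨i x, x, trivial, rfl⟩⟩
  ((Scheme.ΓSpecIso R).inv ≫ (i.appIso ⊤).inv ≫ Y.germToFunctionField (i ''ᵁ ⊤)).hom

variable {Y : Scheme.{0}} [IsIntegral Y] (n : ℕ) (f : Y.functionField)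

/-- `K(Y)[w] / (w ^ n - f)`. -/
abbrev KummerAlgebra : Type := AdjoinRoot (X ^ n - C f : Y.functionField[X])

/-- The morphism `Spec K(Y)[w] / (w ^ n - f) ⟶ Spec K(Y) ⟶ Y` onto the generic point. -/
def kummerGeneric : Spec (.of (KummerAlgebra n f)) ⟶ Y :=
  Spec.map (CommRingCat.ofHom (AdjoinRoot.of (X ^ n - C f : Y.functionField[X]))) ≫
    Y.fromSpecStalk (genericPoint Y)

instance : QuasiCompact (kummerGeneric n f) := by unfold kummerGeneric; infer_instance
instance : QuasiSeparated (kummerGeneric n f) := by unfold kummerGeneric; infer_instance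

/-- The Kummer covering of `Y` given by the `n`-th root of the rational function `f`: the
normalization of `Y` in `K(Y)[w] / (w ^ n - f)`. -/
abbrev kummerCover : Scheme.{0} := (kummerGeneric n f).normalization

/-- The covering map. -/
abbrev kummerCover.π : kummerCover n f ⟶ Y := (kummerGeneric n f).fromNormalization

instance : IsIntegralHom (kummerCover.π n f) :=
  inferInstanceAs (IsIntegralHom (kummerGeneric n f).fromNormalization)

/-- The endomorphism `w ↦ ζ * w` of `K(Y)[w] / (w ^ n - f)`. -/
def kummerAlgebraRot (ζ : Y.functionField) (hζ : ζ ^ n = 1) :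
    KummerAlgebra n f →+* KummerAlgebra n f :=
  AdjoinRoot.lift (AdjoinRoot.of _) (AdjoinRoot.of _ ζ * AdjoinRoot.root _) (by
    have h := AdjoinRoot.eval₂_root (X ^ n - C f : Y.functionField[X])
    simp only [eval₂_sub, eval₂_X_pow, eval₂_C, mul_pow, ← map_pow, hζ, map_one, one_mul] at h ⊢
    exact h)

/-- The automorphism `w ↦ ζ * w` of the Kummer covering. -/
def kummerCover.rot (ζ : Y.functionField) (hζ : ζ ^ n = 1) : kummerCover n f ⟶ kummerCover n f :=
  (kummerGeneric n f).normalizationDesc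
    (Spec.map (CommRingCat.ofHom (kummerAlgebraRot n f ζ hζ)) ≫
      (kummerGeneric n f).toNormalization)
    (kummerGeneric n f).fromNormalization (by
      rw [Category.assoc, Scheme.Hom.toNormalization_fromNormalization, kummerGeneric,
        ← Spec.map_comp_assoc, ← CommRingCat.ofHom_comp]
      congr 3
      ext x
      simp [kummerAlgebraRot])

theorem kummerCover.rot_π (ζ : Y.functionField) (hζ : ζ ^ n = 1) :
    kummerCover.rot n f ζ hζ ≫ kummerCover.π n f = kummerCover.π n f :=
  Scheme.Hom.normalizationDesc_comp ..

/-- The Cartier divisor of the rational function `f` is the difference of the divisors cut out by the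
ideal sheaves `I` and `J`: locally `f * J = I`. -/
def HasDivisor (f : Y.functionField) (I J : Y.IdealSheafData) : Prop :=
  ∀ y : Y, ∃ (U : Y.affineOpens) (hy : y ∈ U.1),
    haveI : Nonempty U.1 := ⟨⟨y, hy⟩⟩
    (fun a ↦ f * (Y.germToFunctionField U.1).hom a) '' (J.ideal U : Set Γ(Y, U.1)) =
      (Y.germToFunctionField U.1).hom '' (I.ideal U : Set Γ(Y, U.1))

end Kummer

section Quotient

theorem isLocalization_eqLocus {A A' : Type} [CommRing A] [CommRing A'] [Algebra A A'] (a : A)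
    [IsLocalization.Away a A'] (s : A →+* A) (s' : A' →+* A')
    (hs : ∀ x, s' (algebraMap A A' x) = algebraMap A A' (s x)) (ha : s a = a)
    (ρ : s.eqLocus (RingHom.id A) →+* s'.eqLocus (RingHom.id A'))
    (hρ : ∀ x, (ρ x : A') = algebraMap A A' x) :
    letI := ρ.toAlgebra
    IsLocalization.Away (⟨a, ha⟩ : s.eqLocus (RingHom.id A)) (s'.eqLocus (RingHom.id A')) := by
  let := ρ.toAlgebra
  have hu : IsUnit (algebraMap A A' a) := IsLocalization.Away.algebraMap_isUnit a
  have hn (n : ℕ) : s (a ^ n) = a ^ n := by rw [map_pow, ha]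
  refine IsLocalization.Away.mk _ ?_ ?_ ?_
  · obtain ⟨v, hv⟩ := hu.exists_left_inv
    refine .of_mul_eq_one ⟨v, ?_⟩ (Subtype.ext ?_)
    · change s' v = v
      refine hu.mul_right_cancel ?_
      conv_lhs => rw [← ha, ← hs, ← map_mul, hv, map_one]
      exact hv.symm
    · change (ρ ⟨a, ha⟩ : A') * v = 1
      rw [hρ, mul_comm]
      exact hv
  · rintro ⟨z, hz⟩
    change s' z = z at hz
    obtain ⟨n, b, hb⟩ := IsLocalization.Away.surj a z
    have h : algebraMap A A' (s b) = algebraMap A A' b := by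
      rw [← hs, ← hb, map_mul, map_pow, hs, ha, hz]
    obtain ⟨m, hm⟩ := IsLocalization.Away.exists_of_eq a h
    refine ⟨m + n, ⟨a ^ m * b, ?_⟩, Subtype.ext ?_⟩
    · change s (a ^ m * b) = a ^ m * b
      rw [map_mul, hn, hm]
    · change z * (ρ ⟨a, ha⟩ : A') ^ (m + n) = ρ _
      rw [hρ, hρ, map_mul, ← hb, map_pow]
      ring
  · intro x y hxy
    have h : algebraMap A A' x = algebraMap A A' y := by
      rw [← hρ, ← hρ]
      exact congrArg Subtype.val hxy
    obtain ⟨m, hm⟩ := IsLocalization.Away.exists_of_eq a h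
    exact ⟨m, Subtype.ext hm⟩

variable {Z B : Scheme.{0}} (p : Z ⟶ B) (g : Z ⟶ Z) (hg : g ≫ p = p)

/-- The action of `g` on the functions on the preimage of `U`. -/
def invariantAction (U : B.Opens) : Γ(Z, p ⁻¹ᵁ U) →+* Γ(Z, p ⁻¹ᵁ U) :=
  (g.appLE (p ⁻¹ᵁ U) (p ⁻¹ᵁ U) (by rw [← Scheme.Hom.comp_preimage, hg])).hom

/-- The functions on the preimage of `U` which are invariant under `g`. -/
abbrev invariantSections (U : B.Opens) : Subring Γ(Z, p ⁻¹ᵁ U) :=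
  (invariantAction p g hg U).eqLocus (RingHom.id _)

theorem invariantAction_res {U V : B.Opens} (h : V ≤ U) (x : Γ(Z, p ⁻¹ᵁ U)) :
    invariantAction p g hg V (Z.presheaf.map (homOfLE (p.preimage_mono h)).op x) =
      Z.presheaf.map (homOfLE (p.preimage_mono h)).op (invariantAction p g hg U x) := by
  have h₁ := g.map_appLE (U' := p ⁻¹ᵁ U) (U := p ⁻¹ᵁ V) (V := p ⁻¹ᵁ V)
    (by rw [← Scheme.Hom.comp_preimage, hg]) (homOfLE (p.preimage_mono h)).op
  have h₂ := g.appLE_map (U := p ⁻¹ᵁ U) (V := p ⁻¹ᵁ U) (V' := p ⁻¹ᵁ V)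
    (by rw [← Scheme.Hom.comp_preimage, hg]) (homOfLE (p.preimage_mono h)).op
  exact congr(($(h₁.trans h₂.symm)).hom x)

theorem invariant_app (U : B.Opens) (x : Γ(B, U)) :
    (p.app U).hom x ∈ invariantSections p g hg U := by
  have h₁ := Scheme.Hom.comp_appLE g p U (p ⁻¹ᵁ U) (by rw [hg])
  have h₂ : (g ≫ p).appLE U (p ⁻¹ᵁ U) (by rw [hg]) = p.app U := by
    rw [p.app_eq_appLE]
    congr 1
  exact congr(($(h₁.symm.trans h₂)).hom x)

/-- The sheaf `U ↦ Γ(Z, p⁻¹ U) ^ g` on `B`. -/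
def invariantDiagram : B.Opensᵒᵖ ⥤ CommRingCat.{0} where
  obj U := .of (invariantSections p g hg U.unop)
  map {U V} i := CommRingCat.ofHom
    ((Z.presheaf.map (homOfLE (p.preimage_mono i.unop.le)).op).hom.restrict _ _ fun x hx ↦ by
      exact (invariantAction_res p g hg i.unop.le x).trans congr(Z.presheaf.map _ $hx))
  map_id U := by
    ext x
    exact (DFunLike.congr_fun (congrArg CommRingCat.Hom.hom (Z.presheaf.map_id _)) x.1)
  map_comp i j := by
    ext x
    exact (DFunLike.congr_fun (congrArg CommRingCat.Hom.hom
      (Z.presheaf.map_comp (homOfLE (p.preimage_mono i.unop.le)).op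
        (homOfLE (p.preimage_mono j.unop.le)).op)) x.1)

/-- The structure morphism from the structure sheaf of `B` to the invariants. -/
def invariantDiagramMap : B.presheaf ⟶ invariantDiagram p g hg where
  app U := CommRingCat.ofHom ((p.app U.unop).hom.codRestrict _ (invariant_app p g hg U.unop))
  naturality {U V} i := by
    ext x
    exact Subtype.ext congr(($(p.naturality i)).hom x)

open Scheme.AffineZariskiSite

theorem coequifibered_invariantDiagramMap [IsAffineHom p] :
    ((toOpensFunctor B).op.whiskerLeft (invariantDiagramMap p g hg)).Coequifibered := by
  refine coequifibered_iff_forall_isLocalizationAway.mpr fun U r ↦ ?_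
  let : Algebra Γ(Z, p ⁻¹ᵁ U.1) Γ(Z, p ⁻¹ᵁ (U.basicOpen r).1) :=
    (Z.presheaf.map (homOfLE (p.preimage_mono (B.basicOpen_le r))).op).hom.toAlgebra
  have h : IsLocalization.Away ((p.app U.1).hom r) Γ(Z, p ⁻¹ᵁ (U.basicOpen r).1) :=
    (U.2.preimage p).isLocalization_of_eq_basicOpen _ _ (p.preimage_basicOpen r)
  exact isLocalization_eqLocus (A := Γ(Z, p ⁻¹ᵁ U.1)) (A' := Γ(Z, p ⁻¹ᵁ (U.basicOpen r).1))
    ((p.app U.1).hom r) (invariantAction p g hg U.1) (invariantAction p g hg (U.basicOpen r).1)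
    (invariantAction_res p g hg (B.basicOpen_le r)) (invariant_app p g hg U.1 r)
    ((invariantDiagram p g hg).map (homOfLE (B.basicOpen_le r)).op).hom fun _ ↦ rfl

/-- The data that glue the spectra of the rings of invariants. -/
def quotientData [IsAffineHom p] :=
  relativeGluingData (coequifibered_invariantDiagramMap p g hg)

/-- The quotient of `Z` by the group generated by `g`, where `g` acts on `Z` over `B` and `Z` is affine
over `B`: it is glued from the spectra of `Γ(Z, p⁻¹ U) ^ g` for the affine open subsets `U` of `B`. -/
def cyclicQuotient [IsAffineHom p] : Scheme.{0} := (quotientData p g hg).glued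

/-- The morphism from the quotient to the base. -/
def cyclicQuotient.toBase [IsAffineHom p] : cyclicQuotient p g hg ⟶ B :=
  (quotientData p g hg).toBase

end Quotient

section Product

variable {S Y₁ Y₂ B₁ B₂ : Scheme.{0}} (p₁ : Y₁ ⟶ B₁) (p₂ : Y₂ ⟶ B₂) (s₁ : B₁ ⟶ S) (s₂ : B₂ ⟶ S)

/-- The morphism `Y₁ ×[S] Y₂ ⟶ B₁ ×[S] B₂` induced by `p₁` and `p₂`. -/
def prodMap : pullback (p₁ ≫ s₁) (p₂ ≫ s₂) ⟶ pullback s₁ s₂ :=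
  pullback.map _ _ _ _ p₁ p₂ (𝟙 S) (by simp) (by simp)

instance [IsAffineHom p₁] [IsAffineHom p₂] : IsAffineHom (prodMap p₁ p₂ s₁ s₂) := by
  have : MorphismProperty.IsStableUnderComposition @IsAffineHom := ⟨fun f g _ _ ↦ inferInstance⟩
  exact MorphismProperty.pullbackMap (P := @IsAffineHom) ‹_› ‹_› rfl rfl

/-- The morphism `(g₁, g₂)` of `Y₁ ×[S] Y₂` for `g₁` over `B₁` and `g₂` over `B₂`. -/
def prodRot (g₁ : Y₁ ⟶ Y₁) (g₂ : Y₂ ⟶ Y₂) (h₁ : g₁ ≫ p₁ = p₁) (h₂ : g₂ ≫ p₂ = p₂) :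
    pullback (p₁ ≫ s₁) (p₂ ≫ s₂) ⟶ pullback (p₁ ≫ s₁) (p₂ ≫ s₂) :=
  pullback.map _ _ _ _ g₁ g₂ (𝟙 S) (by rw [reassoc_of% h₁, Category.comp_id])
    (by rw [reassoc_of% h₂, Category.comp_id])

theorem prodRot_prodMap (g₁ : Y₁ ⟶ Y₁) (g₂ : Y₂ ⟶ Y₂) (h₁ : g₁ ≫ p₁ = p₁) (h₂ : g₂ ≫ p₂ = p₂) :
    prodRot p₁ p₂ s₁ s₂ g₁ g₂ h₁ h₂ ≫ prodMap p₁ p₂ s₁ s₂ = prodMap p₁ p₂ s₁ s₂ := by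
  refine pullback.hom_ext ?_ ?_
  · have e₁ : prodMap p₁ p₂ s₁ s₂ ≫ pullback.fst _ _ = pullback.fst _ _ ≫ p₁ :=
      pullback.lift_fst _ _ _
    have e₂ : prodRot p₁ p₂ s₁ s₂ g₁ g₂ h₁ h₂ ≫ pullback.fst _ _ = pullback.fst _ _ ≫ g₁ :=
      pullback.lift_fst _ _ _
    rw [Category.assoc, e₁, reassoc_of% e₂, h₁]
  · have e₁ : prodMap p₁ p₂ s₁ s₂ ≫ pullback.snd _ _ = pullback.snd _ _ ≫ p₂ :=
      pullback.lift_snd _ _ _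
    have e₂ : prodRot p₁ p₂ s₁ s₂ g₁ g₂ h₁ h₂ ≫ pullback.snd _ _ = pullback.snd _ _ ≫ g₂ :=
      pullback.lift_snd _ _ _
    rw [Category.assoc, e₁, reassoc_of% e₂, h₂]

end Product

section Main
open Polynomial

/-- A polynomial in `x` as a rational function on the projective line. -/
def lineFunction : ℂ[X] →+* (P1 ℂ).functionField :=
  chartToFunctionField (R := .of ℂ[X]) (P1.ι₀ ℂ)

/-- A polynomial in the base coordinate `x` (inner variable) and the fibre coordinate `t` (outer
variable) as a rational function on `ℙ(𝒪 ⊕ 𝒪(n))`. -/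
def ruledFunction (n : ℕ) : ℂ[X][X] →+* (Hirz n).functionField :=
  chartToFunctionField (R := .of ℂ[X][X]) (P1.ι₀ ℂ[X] ≫ Hirz.j₀ n)

/-- The structure morphism of `ℙ(𝒪 ⊕ 𝒪(n))`. -/
def Hirz.str (n : ℕ) : Hirz n ⟶ Spec (.of ℂ) := Hirz.proj n ≫ P1.str ℂ

/-- The morphism `μ : ℙ(𝒪 ⊕ 𝒪(2)) ⟶ ℙ(𝒪 ⊕ 𝒪(8))` of degree 4. -/
def mu₄ : Hirz 2 ⟶ Hirz 8 := Hirz.mu 2 4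

/-- The ideal sheaf of the pull-back `μ^* E_σ`. -/
def muPullbackE (σ : MvPolynomial (Fin 2) ℂ) (hσ : σ.IsHomogeneous 8) : (Hirz 2).IdealSheafData :=
  (Hirz.sectionE σ hσ).ker.comap mu₄

/-- The rational function `(t ^ 4 + σ(1, x)) / t ^ 4` on `ℙ(𝒪 ⊕ 𝒪(2))`, with divisor
`μ^* E_σ - μ^* E_0`. -/
def branchFunction (σ : MvPolynomial (Fin 2) ℂ) : (Hirz 2).functionField :=
  ruledFunction 2 (X ^ 4 + C (Hirz.dehom₀ σ)) / ruledFunction 2 (X ^ 4)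

/-- The double covering `𝒴` of `ℙ(𝒪 ⊕ 𝒪(2))` ramified along `μ^* E_σ`. -/
abbrev surfaceY (σ : MvPolynomial (Fin 2) ℂ) : Scheme.{0} := kummerCover 2 (branchFunction σ)

/-- The structure morphism of `𝒴`. -/
def surfaceY.str (σ : MvPolynomial (Fin 2) ℂ) : surfaceY σ ⟶ Spec (.of ℂ) :=
  kummerCover.π 2 (branchFunction σ) ≫ Hirz.str 2

/-- The cyclic covering `C` of degree 4 of the projective line, given by `y ^ 4 = σ`. -/
abbrev curveC (σ : MvPolynomial (Fin 2) ℂ) : Scheme.{0} :=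
  kummerCover 4 (lineFunction (Hirz.dehom₀ σ))

/-- The elliptic curve `𝔼` given by `y ^ 4 = x * (x - 1) ^ 2`. -/
abbrev curveE : Scheme.{0} := kummerCover 4 (lineFunction (X * (X - 1) ^ 2))

theorem lineFunction_root {ζ : ℂ} (hζ : ζ ^ 4 = 1) : lineFunction (C ζ) ^ 4 = 1 := by
  rw [← map_pow, ← C_pow, hζ, C_1, map_one]

/-- The quotient `C × 𝔼 / ⟨(1, 1)⟩` by the group generated by `(γ₁, γ₂)`, where `γ₁` and `γ₂` are both
given by `(x, y) ↦ (x, ζ * y)`. -/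
def quotientCE (σ : MvPolynomial (Fin 2) ℂ) (ζ : ℂ) (hζ : ζ ^ 4 = 1) : Scheme.{0} :=
  cyclicQuotient _ _ (prodRot_prodMap (kummerCover.π 4 (lineFunction (Hirz.dehom₀ σ)))
    (kummerCover.π 4 (lineFunction (X * (X - 1) ^ 2))) (P1.str ℂ) (P1.str ℂ)
    (kummerCover.rot _ _ (lineFunction (C ζ)) (lineFunction_root hζ))
    (kummerCover.rot _ _ (lineFunction (C ζ)) (lineFunction_root hζ))
    (kummerCover.rot_π ..) (kummerCover.rot_π ..))

/-- The structure morphism of `C × 𝔼 / ⟨(1, 1)⟩`. -/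
def quotientCE.str (σ : MvPolynomial (Fin 2) ℂ) (ζ : ℂ) (hζ : ζ ^ 4 = 1) :
    quotientCE σ ζ hζ ⟶ Spec (.of ℂ) :=
  cyclicQuotient.toBase _ _ _ ≫ pullback.fst (P1.str ℂ) (P1.str ℂ) ≫ P1.str ℂ

end Main

end KummerK3

end

/-!
A function on `(C × 𝔼) / ⟨(1, 1)⟩` is an invariant function of `x`, `y`, `u`, `v`, where
`y ^ 4 = σ(x)` and `v ^ 4 = u * (u - 1) ^ 2`. Since `y` and `v` are multiplied by the same fourth
root of unity, the invariants are generated over `ℂ(x, u)` by `r = y / v`, whose fourth power is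
`σ(x) / (u * (u - 1) ^ 2)`. The substitution `u = (w - 1) / (w + 1)`, `r = t * (w + 1) / √2` turns
this equation into `w ^ 2 = (t ^ 4 + σ(x)) / t ^ 4`, that of `𝒴`. All of this holds on affine open
subschemes, which avoids comparing the function fields of the normalizations.

The divisor of `(t ^ 4 + σ(x)) / t ^ 4` is read off over each of the two affine charts of `ℙ¹`:
where `t` is finite, the pullbacks of the two sections are `t ^ 4 + σ = 0` and `t ^ 4 = 0`, while
both sections avoid `t = ∞`.
-/

noncomputable section
namespace KummerK3
open CategoryTheory CategoryTheory.Limits AlgebraicGeometry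

universe u

section Normalization

theorem isIso_normalizationDesc {X Y T : Scheme.{u}} [IsAffine Y] [IsAffine T] (f : X ⟶ Y)
    [QuasiCompact f] [QuasiSeparated f] (p : X ⟶ T) (q : T ⟶ Y) [IsIntegralHom q] (hf : f = p ≫ q)
    (hp : Function.Injective p.appTop)
    (hint : ∀ z, f.appTop.hom.IsIntegralElem z → z ∈ p.appTop.hom.range) :
    IsIso (f.normalizationDesc p q hf) := by
  set d := f.normalizationDesc p q hf with d_def
  have : IsAffine f.normalization := isAffine_of_isAffineHom f.fromNormalization
  have : IsSchemeTheoreticallyDominant f.toNormalization := ⟨f.ker_toNormalization⟩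
  have hinj : Function.Injective f.toNormalization.appTop := Scheme.Hom.app_injective _ _
  have hd : d.appTop ≫ f.toNormalization.appTop = p.appTop := by
    rw [← Scheme.Hom.comp_appTop, d_def, Scheme.Hom.toNormalization_normalizationDesc]
  suffices IsIso d.appTop from (MorphismProperty.arrow_mk_iso_iff (.isomorphisms Scheme.{u})
    (arrowIsoSpecΓOfIsAffine d)).mpr (inferInstanceAs (IsIso (Spec.map d.appTop)))
  refine (ConcreteCategory.isIso_iff_bijective _).mpr ⟨.of_comp (f := f.toNormalization.appTop) ?_,
    fun z ↦ ?_⟩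
  · rwa [← hd] at hp
  · have hz : f.appTop.hom.IsIntegralElem (f.toNormalization.appTop z) := by
      have h : f.appTop = f.fromNormalization.appTop ≫ f.toNormalization.appTop := by
        rw [← Scheme.Hom.comp_appTop, f.toNormalization_fromNormalization]
      rw [h]
      exact (IsIntegralHom.isIntegral_app f.fromNormalization ⊤ (isAffineOpen_top _) z).map _
    obtain ⟨t, ht⟩ := hint _ hz
    exact ⟨t, hinj ((congr($hd t)).trans ht)⟩

theorem exists_isPullback_normalization {Y : Scheme.{u}} {A T L : CommRingCat.{u}}
    (i : Spec A ⟶ Y) [IsOpenImmersion i] (ψ : A ⟶ T) (χ : T ⟶ L) (hψ : ψ.hom.IsIntegral)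
    (hχ : Function.Injective χ) (hint : ∀ z, (ψ ≫ χ).hom.IsIntegralElem z → z ∈ χ.hom.range)
    (g : Spec L ⟶ Y) [QuasiCompact g] [QuasiSeparated g]
    (hg : g = Spec.map χ ≫ Spec.map ψ ≫ i) :
    ∃ h : Spec T ⟶ g.normalization, IsPullback h (Spec.map ψ) g.fromNormalization i ∧
      Spec.map χ ≫ h = g.toNormalization := by
  have : IsIntegralHom (Spec.map ψ) := IsIntegralHom.SpecMap_iff.mpr hψ
  have sq : IsPullback (𝟙 (Spec L)) (Spec.map χ ≫ Spec.map ψ) g i :=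
    .of_horiz_isIso_mono ⟨by simp [hg]⟩
  let e := sq.isoPullback
  have he : pullback.snd g i = (e.inv ≫ Spec.map χ) ≫ Spec.map ψ := by simp [e]
  let d := (pullback.snd g i).normalizationDesc (e.inv ≫ Spec.map χ) (Spec.map ψ) he
  have : IsIso d := by
    let ε : Γ(pullback g i, ⊤) ≅ L := (Scheme.Γ.mapIso e.op).trans (Scheme.ΓSpecIso L)
    have hε : Function.Injective ε.hom := ε.commRingCatIsoToRingEquiv.injective
    have appTop_ε {R : CommRingCat.{u}} (k : pullback g i ⟶ Spec R) (φ : R ⟶ L)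
        (hk : e.hom ≫ k = Spec.map φ) : k.appTop ≫ ε.hom = (Scheme.ΓSpecIso R).hom ≫ φ := by
      rw [← Scheme.ΓSpecIso_naturality, ← hk, Scheme.Hom.comp_appTop, Category.assoc]
      rfl
    have hχε := appTop_ε (e.inv ≫ Spec.map χ) χ (by simp)
    have hψε := appTop_ε (pullback.snd g i) (ψ ≫ χ) (by simp [e])
    refine isIso_normalizationDesc _ _ _ _ (.of_comp (f := ε.hom) ?_) fun z hz ↦ ?_
    · rw [← ConcreteCategory.coe_comp, hχε]
      exact hχ.comp (Scheme.ΓSpecIso T).commRingCatIsoToRingEquiv.injective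
    · have hεz : (ψ ≫ χ).hom.IsIntegralElem (ε.hom z) := by
        have := hz.map ε.hom.hom
        rw [← CommRingCat.hom_comp, hψε] at this
        exact this.of_comp
      obtain ⟨t, ht⟩ := hint _ hεz
      exact ⟨(Scheme.ΓSpecIso T).inv t, hε ((congr($hχε _)).trans (by simpa using ht))⟩
  refine ⟨inv d ≫ g.normalizationPullback i ≫ pullback.fst _ _, ?_, ?_⟩
  · refine (IsPullback.of_hasPullback g.fromNormalization i).of_iso
      ((asIso (g.normalizationPullback i)).symm.trans (asIso d)) (Iso.refl _) (Iso.refl _)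
      (Iso.refl _) ?_ ?_ ?_ ?_ <;>
      simp [d, ← Scheme.Hom.normalizationPullback_snd]
  · have hd : Spec.map χ ≫ inv d = e.hom ≫ (pullback.snd g i).toNormalization := by
      rw [IsIso.comp_inv_eq]
      simp [d]
    simp [reassoc_of% hd, e]

end Normalization

section KummerRing

open Polynomial

variable {A : Type*} [CommRing A] {n : ℕ} {a : A}

/-- The ring `A[w] / (w ^ n - a)`, an integral model of the Kummer extensions. -/
abbrev KummerRing (n : ℕ) (a : A) : Type _ := AdjoinRoot (X ^ n - C a)

theorem KummerRing.root_pow : (AdjoinRoot.root _ : KummerRing n a) ^ n = AdjoinRoot.of _ a := by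
  have h := AdjoinRoot.eval₂_root (X ^ n - C a)
  simpa [sub_eq_zero] using h

theorem KummerRing.isIntegral_of (hn : n ≠ 0) : (AdjoinRoot.of (X ^ n - C a)).IsIntegral := by
  have := (monic_X_pow_sub_C a hn).finite_adjoinRoot
  exact (Algebra.IsIntegral.of_finite A (KummerRing n a)).isIntegral

/-- The basis `1, w, …, w ^ (n - 1)` of `A[w] / (w ^ n - a)`. -/
def kummerBasis [Nontrivial A] (hn : n ≠ 0) (a : A) : Module.Basis (Fin n) A (KummerRing n a) :=
  (AdjoinRoot.powerBasis' (monic_X_pow_sub_C a hn)).basis.reindex (finCongr natDegree_X_pow_sub_C)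

theorem kummerBasis_apply [Nontrivial A] (hn : n ≠ 0) (j : Fin n) :
    kummerBasis hn a j = AdjoinRoot.root _ ^ (j : ℕ) := by
  rw [kummerBasis, Module.Basis.reindex_apply, PowerBasis.basis_eq_pow]
  rfl

theorem KummerRing.of_injective (hn : n ≠ 0) :
    Function.Injective (AdjoinRoot.of (X ^ n - C a)) := by
  nontriviality A
  have : Nonempty (Fin n) := ⟨0, Nat.pos_of_ne_zero hn⟩
  have := Module.Free.of_basis (kummerBasis hn a)
  have := (kummerBasis hn a).repr.toEquiv.nontrivial
  exact FaithfulSMul.algebraMap_injective A (KummerRing n a)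

/-- The endomorphism `w ↦ ζ * w` of `A[w] / (w ^ n - a)`. -/
def kummerRot (n : ℕ) (a ζ : A) (hζ : ζ ^ n = 1) : KummerRing n a →ₐ[A] KummerRing n a :=
  AdjoinRoot.liftAlgHom _ (Algebra.ofId _ _) (ζ • AdjoinRoot.root _) (by
    have h : (ζ • AdjoinRoot.root (X ^ n - C a)) ^ n = algebraMap A (KummerRing n a) a := by
      rw [_root_.smul_pow, hζ, one_smul, KummerRing.root_pow]
      rfl
    simp [Algebra.toRingHom_ofId, h])

@[simp]
theorem kummerRot_root {ζ : A} (hζ : ζ ^ n = 1) :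
    kummerRot n a ζ hζ (AdjoinRoot.root _) = ζ • AdjoinRoot.root _ := by
  simp [kummerRot]

theorem kummerBasis_repr_kummerRot [Nontrivial A] (hn : n ≠ 0) {ζ : A} (hζ : ζ ^ n = 1)
    (z : KummerRing n a) (j : Fin n) :
    (kummerBasis hn a).repr (kummerRot n a ζ hζ z) j =
      ζ ^ (j : ℕ) * (kummerBasis hn a).repr z j := by
  have h : (kummerBasis hn a).coord j ∘ₗ (kummerRot n a ζ hζ).toLinearMap =
      ζ ^ (j : ℕ) • (kummerBasis hn a).coord j := by
    refine (kummerBasis hn a).ext fun i ↦ ?_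
    have hi : kummerRot n a ζ hζ (kummerBasis hn a i) = ζ ^ (i : ℕ) • kummerBasis hn a i := by
      rw [kummerBasis_apply, map_pow, kummerRot_root, _root_.smul_pow]
    obtain rfl | hij := eq_or_ne i j <;> simp [*]
  exact congr($h z)

theorem kummerRot_eq_self_iff (hn : n ≠ 0) {ζ : A} (hζ : ζ ^ n = 1)
    (hu : ∀ j < n, j ≠ 0 → IsUnit (ζ ^ j - 1)) (z : KummerRing n a) :
    kummerRot n a ζ hζ z = z ↔ z ∈ (AdjoinRoot.of (X ^ n - C a)).range := by
  refine ⟨fun hz ↦ ?_, fun ⟨x, hx⟩ ↦ hx ▸ (kummerRot n a ζ hζ).commutes x⟩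
  obtain _ | _ := subsingleton_or_nontrivial A
  · have := Module.subsingleton A (KummerRing n a)
    exact ⟨0, Subsingleton.elim _ _⟩
  have repr_eq_zero (j : Fin n) (hj : (j : ℕ) ≠ 0) : (kummerBasis hn a).repr z j = 0 := by
    have h := kummerBasis_repr_kummerRot hn hζ z j
    rwa [hz, eq_comm, ← sub_eq_zero, ← sub_one_mul, (hu j j.2 hj).mul_right_eq_zero] at h
  refine ⟨(kummerBasis hn a).repr z ⟨0, Nat.pos_of_ne_zero hn⟩, ?_⟩
  conv_rhs => rw [← (kummerBasis hn a).sum_repr z]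
  rw [Finset.sum_eq_single ⟨0, Nat.pos_of_ne_zero hn⟩]
  · simp [Algebra.smul_def, kummerBasis_apply]
  · intro j _ hj
    rw [repr_eq_zero j (by simpa [Fin.ext_iff] using hj), zero_smul]
  · simp

theorem sum_range_pow_mul_pow_sub [IsDomain A] {ζ : A} (hζ : IsPrimitiveRoot ζ n) (i j : Fin n) :
    ∑ k ∈ Finset.range n, (ζ ^ (n - (j : ℕ)) * ζ ^ (i : ℕ)) ^ k = if i = j then (n : A) else 0 := by
  have hj : ζ ^ (n - (j : ℕ)) * ζ ^ (j : ℕ) = 1 := by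
    rw [← pow_add, Nat.sub_add_cancel j.2.le, hζ.pow_eq_one]
  obtain rfl | hij := eq_or_ne i j
  · simp [hj]
  have hne : ζ ^ (n - (j : ℕ)) * ζ ^ (i : ℕ) ≠ 1 := by
    rw [← hj]
    intro h
    exact hij (Fin.ext (hζ.pow_inj i.2 j.2
      (mul_left_cancel₀ (left_ne_zero_of_mul_eq_one hj) h)))
  have h := mul_geom_sum (ζ ^ (n - (j : ℕ)) * ζ ^ (i : ℕ)) n
  rw [mul_pow, pow_right_comm, pow_right_comm ζ i, hζ.pow_eq_one, one_pow, one_pow, one_mul,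
    sub_self] at h
  rw [if_neg hij]
  exact (mul_eq_zero.mp h).resolve_left (sub_ne_zero.mpr hne)

/-- Discrete Fourier inversion for the diagonal endomorphism `kummerRot`. -/
theorem sum_range_smul_kummerRot [IsDomain A] (hn : n ≠ 0) {ζ : A} (hζ : IsPrimitiveRoot ζ n)
    (z : KummerRing n a) (j : Fin n) :
    ∑ k ∈ Finset.range n, (ζ ^ (n - (j : ℕ))) ^ k • kummerRot n a (ζ ^ k)
        (by rw [pow_right_comm, hζ.pow_eq_one, one_pow]) z =
      (n * (kummerBasis hn a).repr z j) • kummerBasis hn a j := by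
  refine (kummerBasis hn a).ext_elem fun i ↦ ?_
  have h := sum_range_pow_mul_pow_sub hζ i j
  simp only [mul_pow, pow_right_comm ζ i] at h
  simp only [map_sum, map_smul, Finsupp.finsetSum_apply, Finsupp.smul_apply,
    kummerBasis_repr_kummerRot, smul_eq_mul, Module.Basis.repr_self, ← mul_assoc,
    ← Finset.sum_mul, h]
  obtain rfl | hij := eq_or_ne i j <;> simp [*]

variable {B : Type*} [CommRing B] (φ : A →+* B)

/-- The homomorphism `A[w] / (w ^ n - a) → B[w] / (w ^ n - φ a)` induced by `φ`. -/
def kummerMap (n : ℕ) (a : A) : KummerRing n a →+* KummerRing n (φ a) :=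
  AdjoinRoot.map φ _ _ (by simp)

@[simp]
theorem kummerMap_of (x : A) : kummerMap φ n a (AdjoinRoot.of _ x) = AdjoinRoot.of _ (φ x) := by
  simp [kummerMap]

@[simp]
theorem kummerMap_root : kummerMap φ n a (AdjoinRoot.root _) = AdjoinRoot.root _ := by
  simp [kummerMap]

theorem kummerBasis_repr_kummerMap [Nontrivial A] [Nontrivial B] (hn : n ≠ 0) (z : KummerRing n a)
    (j : Fin n) :
    (kummerBasis hn (φ a)).repr (kummerMap φ n a z) j = φ ((kummerBasis hn a).repr z j) := by
  have h : kummerMap φ n a z =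
      ∑ i, φ ((kummerBasis hn a).repr z i) • kummerBasis hn (φ a) i := by
    conv_lhs => rw [← (kummerBasis hn a).sum_repr z]
    simp [kummerBasis_apply, Algebra.smul_def]
  rw [h, Module.Basis.repr_sum_self]

theorem kummerMap_injective [Nontrivial B] (hn : n ≠ 0) (hφ : Function.Injective φ) :
    Function.Injective (kummerMap φ n a) := by
  have := φ.domain_nontrivial
  intro z z' h
  refine (kummerBasis hn a).ext_elem fun j ↦ hφ ?_
  rw [← kummerBasis_repr_kummerMap, h, kummerBasis_repr_kummerMap]

theorem mem_range_kummerMap_iff [Nontrivial A] [Nontrivial B] (hn : n ≠ 0)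
    (z : KummerRing n (φ a)) :
    z ∈ (kummerMap φ n a).range ↔ ∀ j, (kummerBasis hn (φ a)).repr z j ∈ φ.range := by
  refine ⟨fun ⟨y, hy⟩ j ↦ ⟨_, hy ▸ (kummerBasis_repr_kummerMap φ hn y j).symm⟩, fun hz ↦ ?_⟩
  choose c hc using hz
  refine ⟨∑ j, c j • kummerBasis hn a j, (kummerBasis hn (φ a)).ext_elem fun j ↦ ?_⟩
  rw [kummerBasis_repr_kummerMap, Module.Basis.repr_sum_self, hc]

theorem isIntegral_mul_kummerBasis_repr [Algebra A B] [IsDomain B] (hn : n ≠ 0) {ζ : A}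
    (hζ : IsPrimitiveRoot (algebraMap A B ζ) n) {z : KummerRing n (algebraMap A B a)}
    (hz : IsIntegral A z) (j : Fin n) :
    IsIntegral A (algebraMap A B (n * a) * (kummerBasis hn (algebraMap A B a)).repr z j) := by
  have hroot : IsIntegral A (AdjoinRoot.root _ : KummerRing n (algebraMap A B a)) := by
    refine .of_pow (Nat.pos_of_ne_zero hn) ?_
    rw [KummerRing.root_pow, ← AdjoinRoot.algebraMap_eq, ← IsScalarTower.algebraMap_apply]
    exact isIntegral_algebraMap
  have hfourier := sum_range_smul_kummerRot hn hζ z j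
  have hsum : IsIntegral A ((n * (kummerBasis hn (algebraMap A B a)).repr z j) •
      kummerBasis hn (algebraMap A B a) j) := by
    rw [← hfourier]
    refine .sum _ fun k _ ↦ ?_
    have hk : (algebraMap A B ζ ^ k) ^ n = 1 := by rw [pow_right_comm, hζ.pow_eq_one, one_pow]
    rw [← map_pow, ← map_pow, algebraMap_smul]
    exact (hz.map ((kummerRot n _ _ hk).restrictScalars A)).smul _
  rw [← isIntegral_algHom_iff (IsScalarTower.toAlgHom A B (KummerRing n (algebraMap A B a)))
    (KummerRing.of_injective hn)]
  convert hsum.mul (hroot.pow (n - j)) using 1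
  rw [kummerBasis_apply, smul_mul_assoc, ← pow_add, Nat.add_sub_cancel' j.2.le, KummerRing.root_pow,
    Algebra.smul_def]
  simp only [map_mul, map_natCast, IsScalarTower.coe_toAlgHom', AdjoinRoot.algebraMap_eq]
  ring

theorem mem_range_kummerMap_of_isIntegralElem [IsDomain B] (hφ : Function.Injective φ)
    (hint : ∀ x, φ.IsIntegralElem x → x ∈ φ.range) (hn : IsUnit (n : A)) (hn₀ : n ≠ 0)
    (ha : IsUnit a) {ζ : A} (hζ : IsPrimitiveRoot ζ n) {z : KummerRing n (φ a)}
    (hz : ((AdjoinRoot.of (X ^ n - C (φ a))).comp φ).IsIntegralElem z) :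
    z ∈ (kummerMap φ n a).range := by
  have := φ.domain_nontrivial
  refine (mem_range_kummerMap_iff φ hn₀ z).mpr fun j ↦ ?_
  let := φ.toAlgebra
  obtain ⟨b, hb : φ b = φ (n * a) * _⟩ := hint _
    (isIntegral_mul_kummerBasis_repr hn₀ (hζ.map_of_injective hφ) hz j)
  obtain ⟨v, hv⟩ := (hn.mul ha).exists_left_inv
  refine ⟨v * b, ?_⟩
  rw [map_mul, hb, ← mul_assoc, ← map_mul, hv, map_one, one_mul]
  rfl

end KummerRing

section Chart

variable {Y : Scheme.{0}} [IsIntegral Y]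

theorem SpecMap_chartToFunctionField {R : CommRingCat.{0}} [Nonempty (Spec R)] (i : Spec R ⟶ Y)
    [IsOpenImmersion i] : Spec.map (CommRingCat.ofHom (chartToFunctionField i)) ≫ i =
      Y.fromSpecStalk (genericPoint Y) := by
  have hU : IsAffineOpen (i ''ᵁ ⊤) := (isAffineOpen_top _).image_of_isOpenImmersion i
  obtain ⟨y⟩ := ‹Nonempty (Spec R)›
  have hx : genericPoint Y ∈ i ''ᵁ ⊤ :=
    ((genericPoint_spec Y).mem_open_set_iff (i ''ᵁ ⊤).isOpen).mpr ⟨i y, trivial, y, trivial, rfl⟩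
  have h : hU.fromSpec = Spec.map ((Scheme.ΓSpecIso R).inv ≫ (i.appIso ⊤).inv) ≫ i := by
    have h₁ := hU.SpecMap_appLE_fromSpec i (isAffineOpen_top (Spec R)) (i.preimage_image_eq ⊤).ge
    rw [← Scheme.Hom.appIso_hom', IsAffineOpen.fromSpec_top, Scheme.isoSpec_Spec_inv] at h₁
    rw [Spec.map_comp, Category.assoc, ← h₁, ← Spec.map_comp_assoc]
    simp
  rw [← hU.fromSpecStalk_eq_fromSpecStalk hx, IsAffineOpen.fromSpecStalk, h,
    ← Spec.map_comp_assoc]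
  rfl

theorem chartToFunctionField_eq {R : CommRingCat.{0}} [Nonempty (Spec R)] (i : Spec R ⟶ Y)
    [IsOpenImmersion i] {φ : R →+* Y.functionField}
    (h : Spec.map (CommRingCat.ofHom φ) ≫ i = Y.fromSpecStalk (genericPoint Y)) :
    chartToFunctionField i = φ := by
  rw [← SpecMap_chartToFunctionField i, cancel_mono] at h
  exact (congrArg CommRingCat.Hom.hom (Spec.map_injective h)).symm

theorem chartToFunctionField_SpecMap_comp {R S : CommRingCat.{0}} [Nonempty (Spec R)]
    [Nonempty (Spec S)] (i : Spec R ⟶ Y) [IsOpenImmersion i] (ψ : R ⟶ S)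
    [IsOpenImmersion (Spec.map ψ)] :
    (chartToFunctionField (Spec.map ψ ≫ i)).comp ψ.hom = chartToFunctionField i := by
  refine (chartToFunctionField_eq i ?_).symm
  rw [← SpecMap_chartToFunctionField (Spec.map ψ ≫ i), ← Spec.map_comp_assoc]
  rfl

theorem isFractionRing_chartToFunctionField {R : CommRingCat.{0}} [Nonempty (Spec R)]
    (i : Spec R ⟶ Y) [IsOpenImmersion i] :
    letI := (chartToFunctionField i).toAlgebra
    IsFractionRing R Y.functionField := by
  have hU : IsAffineOpen (i ''ᵁ ⊤) := (isAffineOpen_top _).image_of_isOpenImmersion i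
  have : Nonempty (i ''ᵁ ⊤ : Y.Opens) := ‹Nonempty (Spec R)›.map fun y ↦ ⟨i y, y, trivial, rfl⟩
  have := functionField_isFractionRing_of_isAffineOpen Y (i ''ᵁ ⊤) hU
  let e : R ≃+* Γ(Y, i ''ᵁ ⊤) :=
    ((Scheme.ΓSpecIso R).symm ≪≫ (i.appIso ⊤).symm).commRingCatIsoToRingEquiv
  let := (chartToFunctionField i).toAlgebra
  exact IsFractionRing.of_ringEquiv_left e fun _ ↦ rfl

theorem chartToFunctionField_injective {R : CommRingCat.{0}} [Nonempty (Spec R)]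
    (i : Spec R ⟶ Y) [IsOpenImmersion i] : Function.Injective (chartToFunctionField i) :=
  letI := (chartToFunctionField i).toAlgebra
  haveI := isFractionRing_chartToFunctionField i
  IsFractionRing.injective R Y.functionField

theorem mem_range_chartToFunctionField_of_isIntegralElem {R : CommRingCat.{0}} [IsDomain R]
    [IsIntegrallyClosed R] (i : Spec R ⟶ Y) [IsOpenImmersion i] {x : Y.functionField}
    (hx : (chartToFunctionField i).IsIntegralElem x) : x ∈ (chartToFunctionField i).range := by
  let := (chartToFunctionField i).toAlgebra
  have := isFractionRing_chartToFunctionField i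
  exact (IsIntegrallyClosed.isIntegral_iff (R := R)).mp hx

end Chart

section KummerCover

open Polynomial

variable {Y : Scheme.{0}} [IsIntegral Y]

theorem dense_preimage_kummerCover (n : ℕ) (f : Y.functionField) {U : Y.Opens}
    (hU : (U : Set Y).Nonempty) :
    Dense ((kummerCover.π n f ⁻¹ᵁ U : (kummerCover n f).Opens) : Set (kummerCover n f)) := by
  refine (kummerGeneric n f).toNormalization.denseRange.mono ?_
  rintro _ ⟨x, rfl⟩
  change kummerCover.π n f ((kummerGeneric n f).toNormalization x) ∈ U
  rw [← Scheme.Hom.comp_apply, Scheme.Hom.toNormalization_fromNormalization, kummerGeneric,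
    Scheme.Hom.comp_apply]
  have hη : genericPoint Y ∈ U := ((genericPoint_spec Y).mem_open_set_iff U.isOpen).mpr
    (by simpa using hU)
  exact ((Y.range_fromSpecStalk (x := genericPoint Y)).le (Set.mem_range_self _) :
    _ ⤳ genericPoint Y).mem_open U.isOpen hη

theorem kummerMap_kummerRot {A : Type} [CommRing A] (φ : A →+* Y.functionField) {n : ℕ} {a ξ : A}
    (hξ : ξ ^ n = 1) (hη : φ ξ ^ n = 1) (z : KummerRing n a) :
    kummerMap φ n a (kummerRot n a ξ hξ z) =
      kummerAlgebraRot n (φ a) (φ ξ) hη (kummerMap φ n a z) := by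
  have h : (kummerMap φ n a).comp (kummerRot n a ξ hξ).toRingHom =
      (kummerAlgebraRot n (φ a) (φ ξ) hη).comp (kummerMap φ n a) := by
    ext x
    · simp [kummerAlgebraRot, kummerRot]
    · simp [kummerAlgebraRot, Algebra.smul_def]
  exact congr($h z)

variable {A : Type} [CommRing A] [IsDomain A] (i : Spec (.of A) ⟶ Y) [IsOpenImmersion i]
  {n : ℕ} {a : A}

theorem exists_isPullback_kummerCover [IsIntegrallyClosed A] (hn : IsUnit (n : A)) (hn₀ : n ≠ 0)
    (ha : IsUnit a) {ζ : A} (hζ : IsPrimitiveRoot ζ n) :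
    ∃ h : Spec (.of (KummerRing n a)) ⟶ kummerCover n (chartToFunctionField i a),
      IsPullback h (Spec.map (CommRingCat.ofHom (algebraMap A (KummerRing n a))))
        (kummerCover.π n (chartToFunctionField i a)) i ∧
      Spec.map (CommRingCat.ofHom (kummerMap (chartToFunctionField (R := .of A) i) n a)) ≫ h =
        (kummerGeneric n (chartToFunctionField i a)).toNormalization := by
  have hφ : Function.Injective (chartToFunctionField (R := .of A) i) :=
    chartToFunctionField_injective (R := .of A) i
  have hcomp : (kummerMap (chartToFunctionField (R := .of A) i) n a).comp
      (algebraMap A (KummerRing n a)) = (AdjoinRoot.of _).comp (chartToFunctionField i) := by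
    ext x
    simp
  refine exists_isPullback_normalization i _ _ (KummerRing.isIntegral_of hn₀)
    (kummerMap_injective _ hn₀ hφ) (fun z hz ↦ ?_) _ ?_
  · refine mem_range_kummerMap_of_isIntegralElem _ hφ
      (fun _ ↦ mem_range_chartToFunctionField_of_isIntegralElem (R := .of A) i) hn hn₀ ha hζ ?_
    rw [← hcomp]
    exact hz
  · rw [kummerGeneric, ← SpecMap_chartToFunctionField (R := .of A) i, ← Spec.map_comp_assoc,
      ← Spec.map_comp_assoc, ← CommRingCat.ofHom_comp, ← CommRingCat.ofHom_comp, hcomp]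

theorem SpecMap_kummerRot_comp (hn₀ : n ≠ 0)
    {h : Spec (.of (KummerRing n a)) ⟶ kummerCover n (chartToFunctionField i a)}
    (sq : IsPullback h (Spec.map (CommRingCat.ofHom (algebraMap A (KummerRing n a))))
      (kummerCover.π n (chartToFunctionField i a)) i)
    (hh : Spec.map (CommRingCat.ofHom (kummerMap (chartToFunctionField (R := .of A) i) n a)) ≫ h =
      (kummerGeneric n (chartToFunctionField i a)).toNormalization)
    {ξ : A} (hξ : ξ ^ n = 1) (hη : chartToFunctionField i ξ ^ n = 1) :
    Spec.map (CommRingCat.ofHom (kummerRot n a ξ hξ).toRingHom) ≫ h =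
      h ≫ kummerCover.rot n (chartToFunctionField i a) (chartToFunctionField i ξ) hη := by
  have : IsOpenImmersion h := MorphismProperty.of_isPullback sq.flip inferInstance
  obtain ⟨q, hq⟩ : ∃ q, q ≫ h =
      h ≫ kummerCover.rot n (chartToFunctionField i a) (chartToFunctionField i ξ) hη :=
    ⟨sq.lift _ (Spec.map (CommRingCat.ofHom (algebraMap A (KummerRing n a))))
      (by rw [Category.assoc, kummerCover.rot_π, sq.w]), sq.lift_fst _ _ _⟩
  obtain ⟨ψ, rfl⟩ := Spec.map_surjective q
  let χ := CommRingCat.ofHom (kummerMap (chartToFunctionField (R := .of A) i) n a)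
  have hψ : ψ ≫ χ = χ ≫ CommRingCat.ofHom (kummerAlgebraRot n _ _ hη) := by
    rw [← Spec.map_inj, Spec.map_comp, Spec.map_comp, ← cancel_mono h, Category.assoc, hq,
      Category.assoc, reassoc_of% hh, hh, kummerCover.rot,
      Scheme.Hom.toNormalization_normalizationDesc]
  rw [← hq]
  congr 2
  refine CommRingCat.hom_ext (RingHom.ext fun z ↦ ?_)
  refine kummerMap_injective _ hn₀ (chartToFunctionField_injective (R := .of A) i) ?_
  exact (kummerMap_kummerRot _ hξ hη z).trans congr($hψ z).symm

end KummerCover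

section QuotientChart

/-- Sections over the image of an open immersion `h : Spec M ⟶ Z` are elements of `M`. The image
is a variable `U`, because it will be known only up to propositional equality. -/
def sectionsIso {Z : Scheme.{u}} {M : CommRingCat.{u}} (h : Spec M ⟶ Z) [IsOpenImmersion h]
    {U : Z.Opens} (hU : h.opensRange = U) : Γ(Z, U) ≅ M :=
  haveI := h.isIso_app U hU.ge
  asIso (h.app U) ≪≫
    (Spec M).presheaf.mapIso (eqToIso (by rw [← hU, h.preimage_opensRange])).op ≪≫
    Scheme.ΓSpecIso M

theorem sectionsIso_hom {Z : Scheme.{u}} {M : CommRingCat.{u}} (h : Spec M ⟶ Z)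
    [IsOpenImmersion h] {U : Z.Opens} (hU : h.opensRange = U) :
    (sectionsIso h hU).hom =
      h.appLE U ⊤ (by rw [← hU, h.preimage_opensRange]) ≫ (Scheme.ΓSpecIso M).hom := by
  simp only [sectionsIso, Scheme.Hom.appLE, Iso.trans_hom, asIso_hom, Functor.mapIso_hom,
    Category.assoc]
  rfl

theorem SpecMap_sectionsIso_hom_fromSpec {Z : Scheme.{u}} {M : CommRingCat.{u}} (h : Spec M ⟶ Z)
    [IsOpenImmersion h] {U : Z.Opens} (hU : h.opensRange = U) (hU' : IsAffineOpen U) :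
    Spec.map (sectionsIso h hU).hom ≫ hU'.fromSpec = h := by
  rw [sectionsIso_hom, Spec.map_comp, Category.assoc,
    hU'.SpecMap_appLE_fromSpec h (isAffineOpen_top (Spec M)), IsAffineOpen.fromSpec_top,
    Scheme.isoSpec_Spec_inv, ← Spec.map_comp_assoc]
  simp

variable {Z B : Scheme.{0}} (p : Z ⟶ B) (g : Z ⟶ Z) (hg : g ≫ p = p)

theorem invariantAction_comp_sectionsIso_hom (V : B.Opens) {M : CommRingCat.{0}} (h : Spec M ⟶ Z)
    [IsOpenImmersion h] (hV : h.opensRange = p ⁻¹ᵁ V) {τ : M ⟶ M}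
    (hτ : Spec.map τ ≫ h = h ≫ g) :
    CommRingCat.ofHom (invariantAction p g hg V) ≫ (sectionsIso h hV).hom =
      (sectionsIso h hV).hom ≫ τ := by
  have hle : ⊤ ≤ h ⁻¹ᵁ p ⁻¹ᵁ V := by rw [← hV, h.preimage_opensRange]
  have hg' : CommRingCat.ofHom (invariantAction p g hg V) ≫ h.appLE (p ⁻¹ᵁ V) ⊤ hle =
      (h ≫ g).appLE _ _ _ := Scheme.Hom.appLE_comp_appLE ..
  have hτ' : h.appLE (p ⁻¹ᵁ V) ⊤ hle ≫ (Spec.map τ).appTop = (Spec.map τ ≫ h).appLE _ ⊤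
      (by rw [Scheme.Hom.comp_preimage]; exact Scheme.Hom.preimage_mono _ hle) := by
    rw [show (Spec.map τ).appTop = (Spec.map τ).appLE ⊤ ⊤ le_rfl from Scheme.Hom.app_eq_appLE _]
    exact Scheme.Hom.appLE_comp_appLE ..
  simp only [sectionsIso_hom]
  rw [reassoc_of% hg', Category.assoc, ← Scheme.ΓSpecIso_naturality τ, reassoc_of% hτ']
  simp only [hτ]

theorem mem_invariantSections_iff_sectionsIso (V : B.Opens) {M : CommRingCat.{0}} (h : Spec M ⟶ Z)
    [IsOpenImmersion h] (hV : h.opensRange = p ⁻¹ᵁ V) {τ : M ⟶ M} (hτ : Spec.map τ ≫ h = h ≫ g)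
    (x : Γ(Z, p ⁻¹ᵁ V)) :
    x ∈ invariantSections p g hg V ↔
      τ ((sectionsIso h hV).hom x) = (sectionsIso h hV).hom x := by
  rw [← CommRingCat.comp_apply, ← invariantAction_comp_sectionsIso_hom p g hg V h hV hτ]
  exact (sectionsIso h hV).commRingCatIsoToRingEquiv.injective.eq_iff.symm

theorem exists_iso_invariantSections (V : B.Opens) {M R : CommRingCat.{0}} (h : Spec M ⟶ Z)
    [IsOpenImmersion h] (hV : h.opensRange = p ⁻¹ᵁ V) {τ : M ⟶ M} (hτ : Spec.map τ ≫ h = h ≫ g)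
    {ρ : R ⟶ M} (hρ : Function.Injective ρ) (hinv : ∀ m, τ m = m ↔ m ∈ ρ.hom.range) :
    ∃ r : R ≅ .of (invariantSections p g hg V),
      r.hom ≫ CommRingCat.ofHom (invariantSections p g hg V).subtype ≫ (sectionsIso h hV).hom =
        ρ := by
  let e : Γ(Z, p ⁻¹ᵁ V) ≃+* M := (sectionsIso h hV).commRingCatIsoToRingEquiv
  have hmem (x) : x ∈ invariantSections p g hg V ↔ e x ∈ ρ.hom.range :=
    (mem_invariantSections_iff_sectionsIso p g hg V h hV hτ x).trans (hinv _)
  let r : R →+* invariantSections p g hg V :=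
    (e.symm.toRingHom.comp ρ.hom).codRestrict _ fun x ↦
      (hmem _).mpr ⟨x, (e.apply_symm_apply _).symm⟩
  have hr (x : R) : e (r x) = ρ x := e.apply_symm_apply _
  have hbij : Function.Bijective r := by
    refine ⟨fun x y hxy ↦ hρ ?_, fun ⟨x, hx⟩ ↦ ?_⟩
    · rw [← hr, ← hr, hxy]
    · obtain ⟨y, hy⟩ := (hmem x).mp hx
      exact ⟨y, Subtype.ext (e.injective ((hr y).trans hy))⟩
  exact ⟨(RingEquiv.ofBijective r hbij).toCommRingCatIso, CommRingCat.hom_ext (RingHom.ext hr)⟩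

variable [IsAffineHom p]

instance : ((quotientData p g hg).functor ⋙ Scheme.forget).IsLocallyDirected :=
  Scheme.Cover.RelativeGluingData.instIsLocallyDirectedI₀CompFunctorForgetOfIsThin ..

/-- The chart of the quotient over an affine open subset `V` of the base: the spectrum of the
invariant sections over the preimage of `V`. -/
def cyclicQuotient.chart (V : B.affineOpens) :
    Spec (.of (invariantSections p g hg V.1)) ⟶ cyclicQuotient p g hg :=
  (quotientData p g hg).cover.f V

instance (V : B.affineOpens) : IsOpenImmersion (cyclicQuotient.chart p g hg V) :=
  (quotientData p g hg).cover.map_prop V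

theorem cyclicQuotient.exists_chart (x : cyclicQuotient p g hg) :
    ∃ (V : B.affineOpens) (y : _), cyclicQuotient.chart p g hg V y = x :=
  (quotientData p g hg).cover.exists_eq x

theorem cyclicQuotient.opensRange_chart (V : B.affineOpens) :
    (cyclicQuotient.chart p g hg V).opensRange = cyclicQuotient.toBase p g hg ⁻¹ᵁ V.1 := by
  have hV : ((Scheme.AffineZariskiSite.directedCover B).f V).opensRange = V.1 :=
    Scheme.Opens.opensRange_ι V.1
  have := (quotientData p g hg).toBase_preimage_eq_opensRange_ι V
  rw [hV] at this
  exact this.symm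

theorem cyclicQuotient.chart_toBase (V : B.affineOpens) :
    cyclicQuotient.chart p g hg V ≫ cyclicQuotient.toBase p g hg =
      Spec.map (CommRingCat.ofHom ((p.app V.1).hom.codRestrict _ (invariant_app p g hg V.1))) ≫
        V.2.fromSpec :=
  colimit.ι_desc _ _

theorem cyclicQuotient.SpecMap_subtype_chart_toBase (V : B.affineOpens) :
    Spec.map (CommRingCat.ofHom (invariantSections p g hg V.1).subtype) ≫
      cyclicQuotient.chart p g hg V ≫ cyclicQuotient.toBase p g hg =
        (V.2.preimage p).fromSpec ≫ p := by
  rw [cyclicQuotient.chart_toBase, ← V.2.SpecMap_appLE_fromSpec p (V.2.preimage p) le_rfl,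
    ← p.app_eq_appLE, ← Spec.map_comp_assoc]
  rfl

theorem cyclicQuotient.dense_preimage {U : B.Opens} (hU : Dense ((p ⁻¹ᵁ U : Z.Opens) : Set Z)) :
    Dense ((cyclicQuotient.toBase p g hg ⁻¹ᵁ U : (cyclicQuotient p g hg).Opens) :
      Set (cyclicQuotient p g hg)) := by
  intro x
  obtain ⟨V, y, rfl⟩ := cyclicQuotient.exists_chart p g hg x
  let s := Spec.map (CommRingCat.ofHom (invariantSections p g hg V.1).subtype)
  have hs : DenseRange s := (PrimeSpectrum.denseRange_comap_iff_ker_le_nilRadical _).mpr (by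
    rw [(RingHom.injective_iff_ker_eq_bot _).mp Subtype.val_injective]
    exact bot_le)
  have hd : Dense ((V.2.preimage p).fromSpec ⁻¹' (p ⁻¹ᵁ U)) :=
    hU.preimage (V.2.preimage p).fromSpec.isOpenEmbedding.isOpenMap
  refine map_mem_closure (cyclicQuotient.chart p g hg V).continuous
    (hs.dense_image s.continuous hd y) ?_
  rintro _ ⟨z, hz, rfl⟩
  have hz' := congr($(cyclicQuotient.SpecMap_subtype_chart_toBase p g hg V) z)
  rw [Scheme.Hom.comp_apply, Scheme.Hom.comp_apply, Scheme.Hom.comp_apply] at hz'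
  change cyclicQuotient.toBase p g hg (cyclicQuotient.chart p g hg V (s z)) ∈ U
  rw [hz']
  exact hz

theorem cyclicQuotient.exists_isOpenImmersion (V : B.affineOpens) {M R : CommRingCat.{0}}
    (h : Spec M ⟶ Z) [IsOpenImmersion h] (hV : h.opensRange = p ⁻¹ᵁ V.1) {τ : M ⟶ M}
    (hτ : Spec.map τ ≫ h = h ≫ g) {ρ : R ⟶ M} (hρ : Function.Injective ρ)
    (hinv : ∀ m, τ m = m ↔ m ∈ ρ.hom.range) :
    ∃ q : Spec R ⟶ cyclicQuotient p g hg, IsOpenImmersion q ∧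
      Set.range q = (cyclicQuotient.toBase p g hg ⁻¹ᵁ V.1 : (cyclicQuotient p g hg).Opens) ∧
      Spec.map ρ ≫ q ≫ cyclicQuotient.toBase p g hg = h ≫ p := by
  obtain ⟨r, hr⟩ := exists_iso_invariantSections p g hg V.1 h hV hτ hρ hinv
  refine ⟨Spec.map r.inv ≫ cyclicQuotient.chart p g hg V, inferInstance, ?_, ?_⟩
  · rw [← cyclicQuotient.opensRange_chart, ← Scheme.Hom.coe_opensRange,
      Scheme.Hom.opensRange_comp_of_isIso]
  · rw [← hr, Spec.map_comp, Spec.map_comp]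
    simp only [Category.assoc]
    rw [← Spec.map_comp_assoc r.inv, r.inv_hom_id, Spec.map_id, Category.id_comp,
      cyclicQuotient.SpecMap_subtype_chart_toBase,
      reassoc_of% (SpecMap_sectionsIso_hom_fromSpec h hV (V.2.preimage p))]

end QuotientChart

section ProductChart

open TensorProduct

variable {k : Type u} [CommRing k]

/-- The chart `Spec (A₁ ⊗ A₂)` of a fibre product given by charts `Spec A₁` and `Spec A₂` of its
factors. -/
def prodChart {B₁ B₂ : Scheme.{u}} (s₁ : B₁ ⟶ Spec (.of k)) (s₂ : B₂ ⟶ Spec (.of k))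
    {A₁ A₂ : Type u} [CommRing A₁] [CommRing A₂] [Algebra k A₁] [Algebra k A₂]
    (i₁ : Spec (.of A₁) ⟶ B₁) (i₂ : Spec (.of A₂) ⟶ B₂)
    (h₁ : i₁ ≫ s₁ = Spec.map (CommRingCat.ofHom (algebraMap k A₁)))
    (h₂ : i₂ ≫ s₂ = Spec.map (CommRingCat.ofHom (algebraMap k A₂))) :
    Spec (.of (A₁ ⊗[k] A₂)) ⟶ pullback s₁ s₂ :=
  (pullbackSpecIso k A₁ A₂).inv ≫ pullback.map _ _ _ _ i₁ i₂ (𝟙 _) (by rw [h₁, Category.comp_id])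
    (by rw [h₂, Category.comp_id])

variable {B₁ B₂ : Scheme.{u}} {s₁ : B₁ ⟶ Spec (.of k)} {s₂ : B₂ ⟶ Spec (.of k)}
  {A₁ A₂ : Type u} [CommRing A₁] [CommRing A₂] [Algebra k A₁] [Algebra k A₂]
  {i₁ : Spec (.of A₁) ⟶ B₁} {i₂ : Spec (.of A₂) ⟶ B₂}
  (h₁ : i₁ ≫ s₁ = Spec.map (CommRingCat.ofHom (algebraMap k A₁)))
  (h₂ : i₂ ≫ s₂ = Spec.map (CommRingCat.ofHom (algebraMap k A₂)))

theorem prodChart_fst : prodChart s₁ s₂ i₁ i₂ h₁ h₂ ≫ pullback.fst _ _ =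
    Spec.map (CommRingCat.ofHom Algebra.TensorProduct.includeLeftRingHom) ≫ i₁ := by
  rw [prodChart, Category.assoc, pullback.map, pullback.lift_fst, pullbackSpecIso_inv_fst_assoc]

theorem prodChart_snd : prodChart s₁ s₂ i₁ i₂ h₁ h₂ ≫ pullback.snd _ _ =
    Spec.map (CommRingCat.ofHom Algebra.TensorProduct.includeRight.toRingHom) ≫ i₂ := by
  rw [prodChart, Category.assoc, pullback.map, pullback.lift_snd, pullbackSpecIso_inv_snd_assoc]
  rfl

instance [IsOpenImmersion i₁] [IsOpenImmersion i₂] :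
    IsOpenImmersion (prodChart s₁ s₂ i₁ i₂ h₁ h₂) := by
  unfold prodChart
  infer_instance

theorem range_prodChart : Set.range (prodChart s₁ s₂ i₁ i₂ h₁ h₂) =
    pullback.fst s₁ s₂ ⁻¹' Set.range i₁ ∩ pullback.snd s₁ s₂ ⁻¹' Set.range i₂ := by
  rw [prodChart, Scheme.Hom.comp_base, TopCat.coe_comp, Set.range_comp,
    Set.range_eq_univ.mpr (Scheme.Hom.surjective _), Set.image_univ]
  exact Scheme.Pullback.range_map ..

end ProductChart

section Product

open TensorProduct

theorem range_eq_of_isPullback {P X Y Z : Scheme.{u}} {a : P ⟶ X} {b : P ⟶ Y} {f : X ⟶ Z}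
    {g : Y ⟶ Z} (h : IsPullback a b f g) : Set.range a = f ⁻¹' Set.range g := by
  rw [← h.isoPullback_hom_fst, Scheme.Hom.comp_base, TopCat.coe_comp, Set.range_comp,
    Set.range_eq_univ.mpr (Scheme.Hom.surjective _), Set.image_univ]
  exact Scheme.Pullback.range_fst ..

variable {k : Type} [Field k] {Y₁ Y₂ B₁ B₂ : Scheme.{0}} (p₁ : Y₁ ⟶ B₁) (p₂ : Y₂ ⟶ B₂)
  (s₁ : B₁ ⟶ Spec (.of k)) (s₂ : B₂ ⟶ Spec (.of k))

theorem prodMap_fst : prodMap p₁ p₂ s₁ s₂ ≫ pullback.fst _ _ = pullback.fst _ _ ≫ p₁ :=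
  pullback.lift_fst _ _ _

theorem prodMap_snd : prodMap p₁ p₂ s₁ s₂ ≫ pullback.snd _ _ = pullback.snd _ _ ≫ p₂ :=
  pullback.lift_snd _ _ _

theorem prodMap_preimage (U₁ : Set B₁) (U₂ : Set B₂) :
    prodMap p₁ p₂ s₁ s₂ ⁻¹' (pullback.fst s₁ s₂ ⁻¹' U₁ ∩ pullback.snd s₁ s₂ ⁻¹' U₂) =
      pullback.fst (p₁ ≫ s₁) (p₂ ≫ s₂) ⁻¹' (p₁ ⁻¹' U₁) ∩
        pullback.snd (p₁ ≫ s₁) (p₂ ≫ s₂) ⁻¹' (p₂ ⁻¹' U₂) := by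
  ext x
  have e₁ := congr($(prodMap_fst p₁ p₂ s₁ s₂) x)
  have e₂ := congr($(prodMap_snd p₁ p₂ s₁ s₂) x)
  rw [Scheme.Hom.comp_apply, Scheme.Hom.comp_apply] at e₁ e₂
  simp only [Set.mem_preimage, Set.mem_inter_iff, e₁, e₂]

-- Both projections of the fibre product are open, being base changes of morphisms to a point.
theorem dense_prodMap_preimage {U₁ : Set B₁} {U₂ : Set B₂} (ho : IsOpen U₁)
    (h₁ : Dense (p₁ ⁻¹' U₁)) (h₂ : Dense (p₂ ⁻¹' U₂)) :
    Dense (prodMap p₁ p₂ s₁ s₂ ⁻¹' (pullback.fst s₁ s₂ ⁻¹' U₁ ∩ pullback.snd s₁ s₂ ⁻¹' U₂)) := by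
  rw [prodMap_preimage]
  have : Subsingleton (Spec (.of k)) := inferInstanceAs (Subsingleton (PrimeSpectrum k))
  exact (h₁.preimage (pullback.fst (p₁ ≫ s₁) (p₂ ≫ s₂)).isOpenMap).inter_of_isOpen_left
    (h₂.preimage (pullback.snd (p₁ ≫ s₁) (p₂ ≫ s₂)).isOpenMap)
    ((ho.preimage p₁.continuous).preimage (pullback.fst (p₁ ≫ s₁) (p₂ ≫ s₂)).continuous)

section Rotation

variable {s₁ s₂} {T₁ T₂ : Type} [CommRing T₁] [CommRing T₂] [Algebra k T₁] [Algebra k T₂]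
  {h₁ : Spec (.of T₁) ⟶ Y₁} {h₂ : Spec (.of T₂) ⟶ Y₂}
  (e₁ : h₁ ≫ p₁ ≫ s₁ = Spec.map (CommRingCat.ofHom (algebraMap k T₁)))
  (e₂ : h₂ ≫ p₂ ≫ s₂ = Spec.map (CommRingCat.ofHom (algebraMap k T₂)))
  {g₁ : Y₁ ⟶ Y₁} {g₂ : Y₂ ⟶ Y₂} (hg₁ : g₁ ≫ p₁ = p₁) (hg₂ : g₂ ≫ p₂ = p₂)
  {τ₁ : T₁ →ₐ[k] T₁} {τ₂ : T₂ →ₐ[k] T₂}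
  (hτ₁ : Spec.map (CommRingCat.ofHom τ₁.toRingHom) ≫ h₁ = h₁ ≫ g₁)
  (hτ₂ : Spec.map (CommRingCat.ofHom τ₂.toRingHom) ≫ h₂ = h₂ ≫ g₂)

include hτ₁ hτ₂ in
theorem SpecMap_tensorMap_prodChart :
    Spec.map (CommRingCat.ofHom (Algebra.TensorProduct.map τ₁ τ₂).toRingHom) ≫
        prodChart (p₁ ≫ s₁) (p₂ ≫ s₂) h₁ h₂ e₁ e₂ =
      prodChart (p₁ ≫ s₁) (p₂ ≫ s₂) h₁ h₂ e₁ e₂ ≫ prodRot p₁ p₂ s₁ s₂ g₁ g₂ hg₁ hg₂ := by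
  have hfst : prodRot p₁ p₂ s₁ s₂ g₁ g₂ hg₁ hg₂ ≫ pullback.fst _ _ = pullback.fst _ _ ≫ g₁ :=
    pullback.lift_fst _ _ _
  have hsnd : prodRot p₁ p₂ s₁ s₂ g₁ g₂ hg₁ hg₂ ≫ pullback.snd _ _ = pullback.snd _ _ ≫ g₂ :=
    pullback.lift_snd _ _ _
  refine pullback.hom_ext ?_ ?_
  · rw [Category.assoc, Category.assoc, hfst, prodChart_fst, reassoc_of% (prodChart_fst e₁ e₂),
      ← hτ₁, ← Spec.map_comp_assoc, ← Spec.map_comp_assoc]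
    congr 2
    ext x
    simp
  · rw [Category.assoc, Category.assoc, hsnd, prodChart_snd, reassoc_of% (prodChart_snd e₁ e₂),
      ← hτ₂, ← Spec.map_comp_assoc, ← Spec.map_comp_assoc]
    congr 2
    ext x
    simp

theorem SpecMap_comp_eq_of_injective {X : Scheme.{0}} {R M : Type} [CommRing R] [CommRing M]
    [Algebra k R] [Algebra k M] {ρ : R →ₐ[k] M} (hρ : Function.Injective ρ)
    {q : Spec (.of R) ⟶ X} {s : X ⟶ Spec (.of k)}
    (h : Spec.map (CommRingCat.ofHom ρ.toRingHom) ≫ q ≫ s =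
      Spec.map (CommRingCat.ofHom (algebraMap k M))) :
    q ≫ s = Spec.map (CommRingCat.ofHom (algebraMap k R)) := by
  obtain ⟨ψ, hψ⟩ := Spec.map_surjective (q ≫ s)
  rw [← hψ, ← Spec.map_comp, Spec.map_inj] at h
  rw [← hψ]
  congr 1
  refine CommRingCat.hom_ext (RingHom.ext fun x ↦ hρ ?_)
  exact (congr($h x) : ρ (ψ x) = _).trans (ρ.commutes x).symm

variable [IsAffineHom p₁] [IsAffineHom p₂]
  {A₁ A₂ : Type} [CommRing A₁] [CommRing A₂] [Algebra k A₁] [Algebra k A₂]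
  [Algebra A₁ T₁] [Algebra A₂ T₂] [IsScalarTower k A₁ T₁] [IsScalarTower k A₂ T₂]
  {i₁ : Spec (.of A₁) ⟶ B₁} {i₂ : Spec (.of A₂) ⟶ B₂} [IsOpenImmersion i₁] [IsOpenImmersion i₂]

include hτ₁ hτ₂ in
theorem exists_isOpenImmersion_prodQuotient
    (f₁ : i₁ ≫ s₁ = Spec.map (CommRingCat.ofHom (algebraMap k A₁)))
    (f₂ : i₂ ≫ s₂ = Spec.map (CommRingCat.ofHom (algebraMap k A₂)))
    (hd₁ : Dense (p₁ ⁻¹' Set.range i₁)) (hd₂ : Dense (p₂ ⁻¹' Set.range i₂))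
    (hp₁ : IsPullback h₁ (Spec.map (CommRingCat.ofHom (algebraMap A₁ T₁))) p₁ i₁)
    (hp₂ : IsPullback h₂ (Spec.map (CommRingCat.ofHom (algebraMap A₂ T₂))) p₂ i₂)
    {R : Type} [CommRing R] [Algebra k R] {ρ : R →ₐ[k] T₁ ⊗[k] T₂} (hρ : Function.Injective ρ)
    (hinv : ∀ m, Algebra.TensorProduct.map τ₁ τ₂ m = m ↔ m ∈ ρ.range) :
    ∃ q : Spec (.of R) ⟶ cyclicQuotient _ _ (prodRot_prodMap p₁ p₂ s₁ s₂ g₁ g₂ hg₁ hg₂),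
      IsOpenImmersion q ∧ DenseRange q ∧
      q ≫ cyclicQuotient.toBase _ _ (prodRot_prodMap p₁ p₂ s₁ s₂ g₁ g₂ hg₁ hg₂) ≫
        pullback.fst s₁ s₂ ≫ s₁ = Spec.map (CommRingCat.ofHom (algebraMap k R)) := by
  have e₁ : h₁ ≫ p₁ ≫ s₁ = Spec.map (CommRingCat.ofHom (algebraMap k T₁)) := by
    rw [reassoc_of% hp₁.w, f₁, ← Spec.map_comp, ← CommRingCat.ofHom_comp,
      IsScalarTower.algebraMap_eq k A₁ T₁]
  have e₂ : h₂ ≫ p₂ ≫ s₂ = Spec.map (CommRingCat.ofHom (algebraMap k T₂)) := by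
    rw [reassoc_of% hp₂.w, f₂, ← Spec.map_comp, ← CommRingCat.ofHom_comp,
      IsScalarTower.algebraMap_eq k A₂ T₂]
  have : IsOpenImmersion h₁ := MorphismProperty.of_isPullback hp₁.flip inferInstance
  have : IsOpenImmersion h₂ := MorphismProperty.of_isPullback hp₂.flip inferInstance
  let i := prodChart s₁ s₂ i₁ i₂ f₁ f₂
  let h := prodChart (p₁ ≫ s₁) (p₂ ≫ s₂) h₁ h₂ e₁ e₂
  have hrange : h.opensRange = prodMap p₁ p₂ s₁ s₂ ⁻¹ᵁ i.opensRange := by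
    refine TopologicalSpace.Opens.ext ?_
    change Set.range h = prodMap p₁ p₂ s₁ s₂ ⁻¹' Set.range i
    rw [range_prodChart, range_prodChart, prodMap_preimage, range_eq_of_isPullback hp₁,
      range_eq_of_isPullback hp₂]
  obtain ⟨q, hq, hqrange, hqbase⟩ := cyclicQuotient.exists_isOpenImmersion _ _
    (prodRot_prodMap p₁ p₂ s₁ s₂ g₁ g₂ hg₁ hg₂) ⟨i.opensRange, isAffineOpen_opensRange i⟩ h hrange
    (SpecMap_tensorMap_prodChart p₁ p₂ e₁ e₂ hg₁ hg₂ hτ₁ hτ₂)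
    (ρ := CommRingCat.ofHom ρ.toRingHom) hρ hinv
  refine ⟨q, hq, ?_, SpecMap_comp_eq_of_injective hρ ?_⟩
  · rw [DenseRange, hqrange]
    refine cyclicQuotient.dense_preimage _ _ _ ?_
    change Dense (prodMap p₁ p₂ s₁ s₂ ⁻¹' Set.range i)
    rw [range_prodChart]
    exact dense_prodMap_preimage p₁ p₂ s₁ s₂ i₁.isOpenEmbedding.isOpen_range hd₁ hd₂
  · rw [reassoc_of% hqbase, reassoc_of% (prodMap_fst p₁ p₂ s₁ s₂),
      reassoc_of% (prodChart_fst e₁ e₂), e₁, ← Spec.map_comp, ← CommRingCat.ofHom_comp]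

end Rotation

end Product

section KummerTensor

open Polynomial TensorProduct

section Lift

variable {k A T : Type*} [CommRing k] [CommRing A] [CommRing T] [Algebra k A] [Algebra k T]
  {n : ℕ} {a : A}

/-- The homomorphism `A[w] / (w ^ n - a) ⟶ T` given by an `n`-th root `x` of the image of `a`. -/
def kummerLift (i : A →ₐ[k] T) (x : T) (hx : x ^ n = i a) : KummerRing n a →ₐ[k] T :=
  AdjoinRoot.liftAlgHom _ i x (by simp [hx])

@[simp]
theorem kummerLift_of (i : A →ₐ[k] T) (x : T) (hx : x ^ n = i a) (b : A) :
    kummerLift i x hx (AdjoinRoot.of _ b) = i b := by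
  simp [kummerLift]

@[simp]
theorem kummerLift_root (i : A →ₐ[k] T) (x : T) (hx : x ^ n = i a) :
    kummerLift i x hx (AdjoinRoot.root _) = x := by
  simp [kummerLift]

end Lift

theorem KummerRing.of_root_mul_root_pow {A : Type*} [CommRing A] {n : ℕ} {a b : A} :
    (AdjoinRoot.of _ (AdjoinRoot.root _) * AdjoinRoot.root _ :
        KummerRing n (AdjoinRoot.of _ b : KummerRing n a)) ^ n =
      AdjoinRoot.of _ (AdjoinRoot.of _ (a * b)) := by
  rw [mul_pow, ← map_pow, root_pow, root_pow, ← map_mul, ← map_mul]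

section RootUnit

variable {A : Type*} [CommRing A] {n : ℕ}

theorem KummerRing.isUnit_root (hn : n ≠ 0) (a : Aˣ) :
    IsUnit (AdjoinRoot.root _ : KummerRing n (a : A)) := by
  rw [← isUnit_pow_iff hn, KummerRing.root_pow]
  exact a.isUnit.map _

/-- The root `w` of `w ^ n = a`, as a unit, for a unit `a`. -/
def KummerRing.rootUnit (hn : n ≠ 0) (a : Aˣ) : (KummerRing n (a : A))ˣ :=
  (KummerRing.isUnit_root hn a).unit

@[simp]
theorem KummerRing.val_rootUnit (hn : n ≠ 0) (a : Aˣ) :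
    (KummerRing.rootUnit hn a : KummerRing n (a : A)) = AdjoinRoot.root _ :=
  rfl

theorem KummerRing.val_inv_rootUnit_pow (hn : n ≠ 0) (a : Aˣ) :
    ((KummerRing.rootUnit hn a)⁻¹ : (KummerRing n (a : A))ˣ).val ^ n =
      AdjoinRoot.of _ (a⁻¹ : Aˣ).val := by
  have h : KummerRing.rootUnit hn a ^ n = Units.map (AdjoinRoot.of (X ^ n - C (a : A))) a :=
    Units.ext KummerRing.root_pow
  rw [← Units.val_pow_eq_pow_val, inv_pow, h, ← map_inv]
  rfl

end RootUnit

variable (k : Type*) {A₁ A₂ : Type*} [CommRing k] [CommRing A₁] [CommRing A₂] [Algebra k A₁]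
  [Algebra k A₂] (n : ℕ) (a₁ : A₁) (a₂ : A₂ˣ)

/-- The ring `(A₁ ⊗ A₂)[r] / (r ^ n - a₁ / a₂)`: the invariants of the diagonal action of the
`n`-th roots of unity on `A₁[y] / (y ^ n - a₁) ⊗ A₂[v] / (v ^ n - a₂)`, with `r = y / v`. -/
abbrev KummerQuotientRing : Type _ := KummerRing n (a₁ ⊗ₜ[k] (a₂⁻¹ : A₂ˣ).val)

/-- The Kummer extension `R[v] / (v ^ n - a₂)` of `R = (A₁ ⊗ A₂)[r] / (r ^ n - a₁ / a₂)`: a second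
description of `A₁[y] / (y ^ n - a₁) ⊗ A₂[v] / (v ^ n - a₂)`, in which the action of the roots of
unity concerns `v` only. -/
abbrev KummerTower : Type _ :=
  KummerRing n (AdjoinRoot.of _ ((1 : A₁) ⊗ₜ[k] (a₂ : A₂)) : KummerQuotientRing k n a₁ a₂)

/-- The inclusion of `A₁ ⊗ A₂` in `R[v] / (v ^ n - a₂)`. -/
def baseToKummerTower : A₁ ⊗[k] A₂ →ₐ[k] KummerTower k n a₁ a₂ :=
  (AdjoinRoot.ofAlgHom k _).comp (AdjoinRoot.ofAlgHom k _)

/-- The homomorphism `y ↦ r * v` from `A₁[y] / (y ^ n - a₁)` to `R[v] / (v ^ n - a₂)`. -/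
def leftToKummerTower : KummerRing n a₁ →ₐ[k] KummerTower k n a₁ a₂ :=
  kummerLift ((baseToKummerTower k n a₁ a₂).comp Algebra.TensorProduct.includeLeft)
    (AdjoinRoot.of _ (AdjoinRoot.root _) * AdjoinRoot.root _)
    (by
      rw [KummerRing.of_root_mul_root_pow, Algebra.TensorProduct.tmul_mul_tmul, mul_one,
        Units.inv_mul]
      rfl)

/-- The homomorphism `v ↦ v` from `A₂[v] / (v ^ n - a₂)` to `R[v] / (v ^ n - a₂)`. -/
def rightToKummerTower : KummerRing n (a₂ : A₂) →ₐ[k] KummerTower k n a₁ a₂ :=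
  kummerLift ((baseToKummerTower k n a₁ a₂).comp Algebra.TensorProduct.includeRight)
    (AdjoinRoot.root _) (by rw [KummerRing.root_pow]; rfl)

/-- The homomorphism from `A₁[y] / (y ^ n - a₁) ⊗ A₂[v] / (v ^ n - a₂)` to `R[v] / (v ^ n - a₂)`
with `y ↦ r * v` and `v ↦ v`. -/
def tensorToKummerTower :
    KummerRing n a₁ ⊗[k] KummerRing n (a₂ : A₂) →ₐ[k] KummerTower k n a₁ a₂ :=
  Algebra.TensorProduct.lift (leftToKummerTower k n a₁ a₂) (rightToKummerTower k n a₁ a₂)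
    fun _ _ ↦ Commute.all _ _

variable {n} (hn : n ≠ 0)

/-- The homomorphism `r ↦ y / v` from `(A₁ ⊗ A₂)[r] / (r ^ n - a₁ / a₂)` to
`A₁[y] / (y ^ n - a₁) ⊗ A₂[v] / (v ^ n - a₂)`. -/
def kummerQuotientToTensor :
    KummerQuotientRing k n a₁ a₂ →ₐ[k] KummerRing n a₁ ⊗[k] KummerRing n (a₂ : A₂) :=
  kummerLift (Algebra.TensorProduct.map (AdjoinRoot.ofAlgHom k _) (AdjoinRoot.ofAlgHom k _))
    (AdjoinRoot.root _ ⊗ₜ ((KummerRing.rootUnit hn a₂)⁻¹ : (KummerRing n (a₂ : A₂))ˣ).val) (by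
      rw [Algebra.TensorProduct.tmul_pow, KummerRing.root_pow, KummerRing.val_inv_rootUnit_pow]
      rfl)

@[simp]
theorem kummerQuotientToTensor_root :
    kummerQuotientToTensor k a₁ a₂ hn (AdjoinRoot.root _) =
      AdjoinRoot.root _ ⊗ₜ ((KummerRing.rootUnit hn a₂)⁻¹ : (KummerRing n (a₂ : A₂))ˣ).val := by
  rw [kummerQuotientToTensor, kummerLift_root]

@[simp]
theorem kummerQuotientToTensor_of_tmul (x : A₁) (y : A₂) :
    kummerQuotientToTensor k a₁ a₂ hn (AdjoinRoot.of _ (x ⊗ₜ y)) =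
      AdjoinRoot.of _ x ⊗ₜ AdjoinRoot.of _ y := by
  rw [kummerQuotientToTensor, kummerLift_of]
  rfl

/-- The homomorphism `v ↦ v`, `r ↦ y / v` from `R[v] / (v ^ n - a₂)` to
`A₁[y] / (y ^ n - a₁) ⊗ A₂[v] / (v ^ n - a₂)`. -/
def kummerTowerToTensor :
    KummerTower k n a₁ a₂ →ₐ[k] KummerRing n a₁ ⊗[k] KummerRing n (a₂ : A₂) :=
  kummerLift (kummerQuotientToTensor k a₁ a₂ hn) (1 ⊗ₜ AdjoinRoot.root _) (by
    rw [Algebra.TensorProduct.tmul_pow, KummerRing.root_pow, kummerQuotientToTensor_of_tmul]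
    simp)

@[simp]
theorem kummerTowerToTensor_root :
    kummerTowerToTensor k a₁ a₂ hn (AdjoinRoot.root _) = 1 ⊗ₜ AdjoinRoot.root _ := by
  rw [kummerTowerToTensor, kummerLift_root]

@[simp]
theorem kummerTowerToTensor_of (x : KummerQuotientRing k n a₁ a₂) :
    kummerTowerToTensor k a₁ a₂ hn (AdjoinRoot.of _ x) = kummerQuotientToTensor k a₁ a₂ hn x := by
  rw [kummerTowerToTensor, kummerLift_of]

theorem kummerTowerToTensor_comp_tensorToKummerTower :
    (kummerTowerToTensor k a₁ a₂ hn).comp (tensorToKummerTower k n a₁ a₂) = AlgHom.id k _ := by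
  have hv : ((KummerRing.rootUnit hn a₂)⁻¹ : (KummerRing n (a₂ : A₂))ˣ).val *
      AdjoinRoot.root _ = 1 := (KummerRing.rootUnit hn a₂).inv_mul
  refine Algebra.TensorProduct.ext (AdjoinRoot.algHom_ext' (AlgHom.ext fun x ↦ ?_) ?_)
    (AdjoinRoot.algHom_ext' (AlgHom.ext fun x ↦ ?_) ?_)
  · simp [tensorToKummerTower, leftToKummerTower, baseToKummerTower]
  · simp [tensorToKummerTower, leftToKummerTower, hv]
  · simp [tensorToKummerTower, rightToKummerTower, baseToKummerTower]
  · simp [tensorToKummerTower, rightToKummerTower]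

theorem tensorToKummerTower_comp_kummerTowerToTensor :
    (tensorToKummerTower k n a₁ a₂).comp (kummerTowerToTensor k a₁ a₂ hn) = AlgHom.id k _ := by
  have hv : AdjoinRoot.root _ * rightToKummerTower k n a₁ a₂
      ((KummerRing.rootUnit hn a₂)⁻¹ : (KummerRing n (a₂ : A₂))ˣ).val = 1 := by
    have h := congrArg (rightToKummerTower k n a₁ a₂) (KummerRing.rootUnit hn a₂).mul_inv
    rwa [map_mul, map_one, KummerRing.val_rootUnit, rightToKummerTower, kummerLift_root] at h
  refine AdjoinRoot.algHom_ext' (AdjoinRoot.algHom_ext' (Algebra.TensorProduct.ext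
    (AlgHom.ext fun x ↦ ?_) (AlgHom.ext fun x ↦ ?_)) ?_) ?_
  · simp [tensorToKummerTower, leftToKummerTower, baseToKummerTower]
  · simp [tensorToKummerTower, rightToKummerTower, baseToKummerTower]
  · simp [tensorToKummerTower, leftToKummerTower, mul_assoc, hv]
  · simp [tensorToKummerTower, rightToKummerTower]

/-- The isomorphism between the two descriptions of the product of two Kummer extensions. -/
def kummerTowerEquiv :
    KummerTower k n a₁ a₂ ≃ₐ[k] KummerRing n a₁ ⊗[k] KummerRing n (a₂ : A₂) :=
  AlgEquiv.ofAlgHom (kummerTowerToTensor k a₁ a₂ hn) (tensorToKummerTower k n a₁ a₂)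
    (kummerTowerToTensor_comp_tensorToKummerTower k a₁ a₂ hn)
    (tensorToKummerTower_comp_kummerTowerToTensor k a₁ a₂ hn)

@[simp]
theorem kummerTowerEquiv_of (x : KummerQuotientRing k n a₁ a₂) :
    kummerTowerEquiv k a₁ a₂ hn (AdjoinRoot.of _ x) = kummerQuotientToTensor k a₁ a₂ hn x :=
  kummerTowerToTensor_of k a₁ a₂ hn x

@[simp]
theorem kummerTowerEquiv_root :
    kummerTowerEquiv k a₁ a₂ hn (AdjoinRoot.root _) = 1 ⊗ₜ AdjoinRoot.root _ :=
  kummerTowerToTensor_root k a₁ a₂ hn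

theorem kummerQuotientToTensor_injective :
    Function.Injective (kummerQuotientToTensor k a₁ a₂ hn) := by
  have h : ⇑(kummerQuotientToTensor k a₁ a₂ hn) =
      kummerTowerEquiv k a₁ a₂ hn ∘ AdjoinRoot.of _ :=
    funext fun x ↦ (kummerTowerEquiv_of k a₁ a₂ hn x).symm
  rw [h]
  exact (kummerTowerEquiv k a₁ a₂ hn).injective.comp (KummerRing.of_injective hn)

section Invariants

variable {ζ : k} (hζ : ζ ^ n = 1)

/-- The automorphism `w ↦ ζ * w` of `A[w] / (w ^ n - a)` for a root of unity `ζ` in `k`, as a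
homomorphism of `k`-algebras. -/
def kummerRotOver {A : Type*} [CommRing A] [Algebra k A] (a : A) :
    KummerRing n a →ₐ[k] KummerRing n a :=
  (kummerRot n a (algebraMap k A ζ) (by rw [← map_pow, hζ, map_one])).restrictScalars k

@[simp]
theorem kummerRotOver_of {A : Type*} [CommRing A] [Algebra k A] (a x : A) :
    kummerRotOver k hζ a (AdjoinRoot.of _ x) = AdjoinRoot.of _ x :=
  (kummerRot n a (algebraMap k A ζ) (by rw [← map_pow, hζ, map_one])).commutes x

@[simp]
theorem kummerRotOver_root {A : Type*} [CommRing A] [Algebra k A] (a : A) :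
    kummerRotOver k hζ a (AdjoinRoot.root _) = ζ • AdjoinRoot.root _ := by
  change kummerRot n a (algebraMap k A ζ) (by rw [← map_pow, hζ, map_one]) _ = _
  rw [kummerRot_root, algebraMap_smul]

theorem smul_kummerRotOver_inv_rootUnit :
    ζ • kummerRotOver k hζ (a₂ : A₂)
        ((KummerRing.rootUnit hn a₂)⁻¹ : (KummerRing n (a₂ : A₂))ˣ).val =
      ((KummerRing.rootUnit hn a₂)⁻¹ : (KummerRing n (a₂ : A₂))ˣ).val := by
  have h := congrArg (kummerRotOver k hζ (a₂ : A₂)) (KummerRing.rootUnit hn a₂).inv_mul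
  rw [map_mul, map_one, KummerRing.val_rootUnit, kummerRotOver_root, mul_smul_comm,
    ← smul_mul_assoc] at h
  exact Units.eq_inv_of_mul_eq_one_left ((mul_comm _ _).trans h)

theorem tensorMap_kummerRotOver_comp_kummerQuotientToTensor :
    (Algebra.TensorProduct.map (kummerRotOver k hζ a₁) (kummerRotOver k hζ (a₂ : A₂))).comp
      (kummerQuotientToTensor k a₁ a₂ hn) = kummerQuotientToTensor k a₁ a₂ hn := by
  refine AdjoinRoot.algHom_ext' (Algebra.TensorProduct.ext
    (AlgHom.ext fun x ↦ ?_) (AlgHom.ext fun x ↦ ?_)) ?_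
  · simp
  · simp
  · rw [AlgHom.comp_apply, kummerQuotientToTensor_root, Algebra.TensorProduct.map_tmul,
      kummerRotOver_root, smul_tmul, smul_kummerRotOver_inv_rootUnit]

theorem tensorMap_kummerRotOver_kummerTowerEquiv (z : KummerTower k n a₁ a₂) :
    Algebra.TensorProduct.map (kummerRotOver k hζ a₁) (kummerRotOver k hζ (a₂ : A₂))
        (kummerTowerEquiv k a₁ a₂ hn z) =
      kummerTowerEquiv k a₁ a₂ hn (kummerRotOver k hζ _ z) := by
  have h : (Algebra.TensorProduct.map (kummerRotOver k hζ a₁) (kummerRotOver k hζ (a₂ : A₂))).comp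
      (kummerTowerEquiv k a₁ a₂ hn).toAlgHom =
        (kummerTowerEquiv k a₁ a₂ hn).toAlgHom.comp (kummerRotOver k hζ _) := by
    refine AdjoinRoot.algHom_ext' (AlgHom.ext fun x ↦ ?_) ?_
    · simpa using congr($(tensorMap_kummerRotOver_comp_kummerQuotientToTensor k a₁ a₂ hn hζ) x)
    · simp
  exact congr($h z)

variable {k}

theorem tensorMap_kummerRotOver_eq_self_iff (hu : ∀ j < n, j ≠ 0 → IsUnit (ζ ^ j - 1))
    (m : KummerRing n a₁ ⊗[k] KummerRing n (a₂ : A₂)) :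
    Algebra.TensorProduct.map (kummerRotOver k hζ a₁) (kummerRotOver k hζ (a₂ : A₂)) m = m ↔
      m ∈ (kummerQuotientToTensor k a₁ a₂ hn).range := by
  let e := kummerTowerEquiv k a₁ a₂ hn
  obtain ⟨z, rfl⟩ := e.surjective m
  have hfixed : kummerRotOver k hζ _ z = z ↔ z ∈ (AdjoinRoot.of _).range :=
    kummerRot_eq_self_iff hn (by rw [← map_pow, hζ, map_one]) (fun j hj hj₀ ↦ by
      rw [← map_pow, ← map_one (algebraMap k _), ← map_sub]
      exact (hu j hj hj₀).map _) z
  rw [tensorMap_kummerRotOver_kummerTowerEquiv, e.injective.eq_iff, hfixed]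
  refine exists_congr fun x ↦ ?_
  change _ ↔ kummerQuotientToTensor k a₁ a₂ hn x = e z
  rw [← kummerTowerEquiv_of, e.injective.eq_iff]

end Invariants

end KummerTensor

section Substitution

open Polynomial TensorProduct

section Away

variable {k A B T : Type*} [CommSemiring k] [CommSemiring A] [CommSemiring B] [CommSemiring T]
  [Algebra k A] [Algebra k B] [Algebra k T] [Algebra A B] [IsScalarTower k A B]

theorem exists_algHom_of_isLocalizationAway (s : A) [IsLocalization.Away s B] (f : A →ₐ[k] T)
    (hs : IsUnit (f s)) : ∃ g : B →ₐ[k] T, ∀ x, g (algebraMap A B x) = f x := by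
  have h (y : Submonoid.powers s) : IsUnit (f y) := by
    obtain ⟨_, n, rfl⟩ := y
    simpa only [map_pow] using hs.pow n
  exact ⟨IsLocalization.liftAlgHom (M := Submonoid.powers s) h, fun _ ↦ by simp⟩

theorem algHom_ext_of_isLocalizationAway (s : A) [IsLocalization.Away s B] {f g : B →ₐ[k] T}
    (h : f.comp (IsScalarTower.toAlgHom k A B) = g.comp (IsScalarTower.toAlgHom k A B)) : f = g :=
  IsLocalization.algHom_ext (Submonoid.powers s) h

end Away

section Points

variable {R T : Type*} [CommRing R] [CommRing T] [Algebra R T] {s : R[X]} {x t u r w v z c : T}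

/-- A point `(x, u, r)` of `r ^ 4 * u * (u - 1) ^ 2 = s(x)` with `s(x)`, `u`, `u - 1` and `u + 1`
invertible: a point of the quotient of the product of the curves `y ^ 4 = s(x)` and
`v ^ 4 = u * (u - 1) ^ 2` by the diagonal action of the roots of unity, with `r = y / v`. -/
structure IsQuotientPoint (s : R[X]) (x u r : T) : Prop where
  isUnit_aeval : IsUnit (aeval x s)
  isUnit_mul : IsUnit (u * (u - 1) * (u + 1))
  pow_mul_eq : r ^ 4 * (u * (u - 1) ^ 2) = aeval x s

/-- A point `(x, t, w)` of the double covering `w ^ 2 = (t ^ 4 + s(x)) / t ^ 4` with `t`, `s(x)` and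
`t ^ 4 + s(x)` invertible. -/
structure IsCoverPoint (s : R[X]) (x t w : T) : Prop where
  isUnit_mul : IsUnit (t * aeval x s * (t ^ 4 + aeval x s))
  sq_mul_eq : w ^ 2 * t ^ 4 = t ^ 4 + aeval x s

namespace IsCoverPoint

variable (h : IsCoverPoint s x t w)
include h

theorem isUnit_aeval : IsUnit (aeval x s) :=
  isUnit_of_mul_isUnit_right (isUnit_of_mul_isUnit_left h.isUnit_mul)

theorem isUnit_pow_mul : IsUnit (t ^ 4 * (w - 1) * (w + 1)) := by
  convert! h.isUnit_aeval using 1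
  linear_combination h.sq_mul_eq

theorem isUnit_sub_one : IsUnit (w - 1) :=
  isUnit_of_mul_isUnit_right (isUnit_of_mul_isUnit_left h.isUnit_pow_mul)

theorem isUnit_add_one : IsUnit (w + 1) :=
  isUnit_of_mul_isUnit_right h.isUnit_pow_mul

theorem isUnit : IsUnit w := by
  have hw : IsUnit (w ^ 2 * t ^ 4) := h.sq_mul_eq ▸ isUnit_of_mul_isUnit_right h.isUnit_mul
  exact (isUnit_pow_iff two_ne_zero).mp (isUnit_of_mul_isUnit_left hw)

/-- For `u = (w - 1) / (w + 1)` one has `u * (u - 1) ^ 2 = 4 * (w ^ 2 - 1) / (w + 1) ^ 4`, which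
turns `w ^ 2 - 1 = s(x) / t ^ 4` into an equation for the fourth power of `t * (w + 1)`. -/
theorem isQuotientPoint (hc : c ^ 2 * 2 = 1) (hv : (w + 1) * v = 1) :
    IsQuotientPoint s x ((w - 1) * v) (c * t * (w + 1)) := by
  have hu₁ : (w - 1) * v - 1 = -2 * v := by linear_combination hv
  have hu₂ : (w - 1) * v + 1 = 2 * w * v := by linear_combination -hv
  refine ⟨h.isUnit_aeval, ?_, ?_⟩
  · have h_v : IsUnit v := .of_mul_eq_one_right _ hv
    have h_two : IsUnit (2 : T) := .of_mul_eq_one_right _ hc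
    rw [hu₁, hu₂]
    exact ((h.isUnit_sub_one.mul h_v).mul (h_two.neg.mul h_v)).mul ((h_two.mul h.isUnit).mul h_v)
  · have hc₄ : c ^ 4 * 4 = 1 := by linear_combination (c ^ 2 * 2 + 1) * hc
    rw [hu₁]
    calc
      _ = c ^ 4 * 4 * t ^ 4 * ((w + 1) * v) ^ 3 * (w ^ 2 - 1) := by ring
      _ = aeval x s := by rw [hc₄, hv]; linear_combination h.sq_mul_eq

end IsCoverPoint

namespace IsQuotientPoint

variable (h : IsQuotientPoint s x u r)
include h

theorem isUnit_one_sub : IsUnit (1 - u) := by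
  rw [← neg_sub]
  exact (isUnit_of_mul_isUnit_right (isUnit_of_mul_isUnit_left h.isUnit_mul)).neg

theorem isUnit_one_add : IsUnit (1 + u) :=
  add_comm u 1 ▸ isUnit_of_mul_isUnit_right h.isUnit_mul

theorem isUnit : IsUnit r :=
  (isUnit_pow_iff four_ne_zero).mp (isUnit_of_mul_isUnit_left (h.pow_mul_eq ▸ h.isUnit_aeval))

theorem isCoverPoint (hc : c ^ 2 * 2 = 1) (hv : (1 - u) * v = 1) :
    IsCoverPoint s x (c * r * (1 - u)) ((1 + u) * v) := by
  have hc₄ : c ^ 4 * 4 = 1 := by linear_combination (c ^ 2 * 2 + 1) * hc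
  have hadd : (c * r * (1 - u)) ^ 4 + aeval x s =
      c ^ 4 * r ^ 4 * (1 - u) ^ 2 * (1 + u) ^ 2 := by
    rw [← h.pow_mul_eq]
    linear_combination -r ^ 4 * u * (1 - u) ^ 2 * hc₄
  refine ⟨?_, ?_⟩
  · have h_c : IsUnit c := .of_mul_eq_one (c * 2) (by rw [← hc]; ring)
    rw [hadd]
    exact (((h_c.mul h.isUnit).mul h.isUnit_one_sub).mul h.isUnit_aeval).mul
      ((((h_c.pow 4).mul (h.isUnit.pow 4)).mul (h.isUnit_one_sub.pow 2)).mul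
        (h.isUnit_one_add.pow 2))
  · rw [hadd]
    calc
      _ = c ^ 4 * r ^ 4 * (1 - u) ^ 2 * (1 + u) ^ 2 * ((1 - u) * v) ^ 2 := by ring
      _ = _ := by rw [hv, one_pow, mul_one]

end IsQuotientPoint

theorem mul_mul_one_sub_eq_self (hc : c ^ 2 * 2 = 1) (hv : (w + 1) * v = 1) :
    c * (c * t * (w + 1)) * (1 - (w - 1) * v) = t := by
  linear_combination t * hc + (2 - (w + 1)) * c ^ 2 * t * hv

theorem one_add_mul_eq_self (hv : (w + 1) * v = 1) (hz : (1 - (w - 1) * v) * z = 1) :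
    (1 + (w - 1) * v) * z = w := by
  linear_combination (w - 1) * z * hv + w * hz

theorem sub_one_mul_eq_self (hz : (1 - u) * z = 1) (hv : ((1 + u) * z + 1) * v = 1) :
    ((1 + u) * z - 1) * v = u := by
  linear_combination u * hv + (u + 1) * v * hz

theorem mul_mul_add_one_eq_self (hc : c ^ 2 * 2 = 1) (hz : (1 - u) * z = 1) :
    c * (c * r * (1 - u)) * ((1 + u) * z + 1) = r := by
  linear_combination r * hc + (1 + u) * c ^ 2 * r * hz

end Points

section Universal

variable {k A₁ A₂ A₃ T : Type*} [CommRing k] {s : k[X]}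
  [CommRing A₁] [Algebra k A₁] [Algebra k[X] A₁] [IsScalarTower k k[X] A₁]
  [CommRing A₂] [Algebra k A₂] [Algebra k[X] A₂] [IsScalarTower k k[X] A₂]
  [CommRing A₃] [Algebra k A₃] [Algebra k[X][X] A₃] [IsScalarTower k k[X][X] A₃]
  [CommRing T] [Algebra k T]

theorem map_eq_aeval_map_X (j : k[X] →ₐ[k] T) (p : k[X]) : j p = aeval (j X) p := by
  rw [aeval_algHom_apply, aeval_X_left_apply]

section Quotient

variable (A₁) [IsLocalization.Away s A₁] [IsLocalization.Away (X * (X - 1) * (X + 1) : k[X]) A₂]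
  {a₂ : A₂ˣ}

omit [IsScalarTower k k[X] A₂] in
theorem isQuotientPoint_kummerQuotientRing
    (ha₂ : (a₂ : A₂) = algebraMap k[X] A₂ (X * (X - 1) ^ 2)) :
    IsQuotientPoint (T := KummerQuotientRing k 4 (algebraMap k[X] A₁ s) a₂) s
      (AdjoinRoot.of _ (algebraMap k[X] A₁ X ⊗ₜ 1)) (AdjoinRoot.of _ (1 ⊗ₜ algebraMap k[X] A₂ X))
      (AdjoinRoot.root _) := by
  let i₁ : A₁ →ₐ[k] KummerQuotientRing k 4 (algebraMap k[X] A₁ s) a₂ :=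
    (AdjoinRoot.ofAlgHom k _).comp Algebra.TensorProduct.includeLeft
  let i₂ : A₂ →ₐ[k] KummerQuotientRing k 4 (algebraMap k[X] A₁ s) a₂ :=
    (AdjoinRoot.ofAlgHom k _).comp Algebra.TensorProduct.includeRight
  let u := i₂ (algebraMap k[X] A₂ X)
  have hs : aeval (i₁ (algebraMap k[X] A₁ X)) s = i₁ (algebraMap k[X] A₁ s) :=
    (map_eq_aeval_map_X (i₁.comp (IsScalarTower.toAlgHom k k[X] A₁)) s).symm
  have hu : u * (u - 1) * (u + 1) = i₂ (algebraMap k[X] A₂ (X * (X - 1) * (X + 1))) := by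
    simp only [u, map_mul, map_sub, map_add, map_one]
  have hu₂ : u * (u - 1) ^ 2 = i₂ a₂ := by
    simp only [u, ha₂, map_mul, map_sub, map_pow, map_one]
  refine ⟨?_, ?_, ?_⟩
  · exact hs ▸ (IsLocalization.Away.algebraMap_isUnit s).map i₁
  · exact hu ▸ (IsLocalization.Away.algebraMap_isUnit (S := A₂) _).map i₂
  · refine (congrArg₂ (· * ·) KummerRing.root_pow hu₂).trans (.trans ?_ hs.symm)
    change AdjoinRoot.of _ _ * AdjoinRoot.of _ (1 ⊗ₜ (a₂ : A₂)) =
      AdjoinRoot.of _ (algebraMap k[X] A₁ s ⊗ₜ 1)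
    rw [← map_mul, Algebra.TensorProduct.tmul_mul_tmul, mul_one, Units.inv_mul]

theorem IsQuotientPoint.exists_algHom {x u r : T} (h : IsQuotientPoint s x u r)
    (ha₂ : (a₂ : A₂) = algebraMap k[X] A₂ (X * (X - 1) ^ 2)) :
    ∃ φ : KummerQuotientRing k 4 (algebraMap k[X] A₁ s) a₂ →ₐ[k] T,
      φ (AdjoinRoot.of _ (algebraMap k[X] A₁ X ⊗ₜ 1)) = x ∧
      φ (AdjoinRoot.of _ (1 ⊗ₜ algebraMap k[X] A₂ X)) = u ∧ φ (AdjoinRoot.root _) = r := by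
  obtain ⟨φ₁, h₁⟩ := exists_algHom_of_isLocalizationAway (B := A₁) s (aeval (R := k) x)
    h.isUnit_aeval
  obtain ⟨φ₂, h₂⟩ := exists_algHom_of_isLocalizationAway (B := A₂) (X * (X - 1) * (X + 1))
    (aeval (R := k) u) (by simpa using h.isUnit_mul)
  have hinv : φ₂ (a₂⁻¹ : A₂ˣ) * (u * (u - 1) ^ 2) = 1 := by
    have hmul : φ₂ ((a₂⁻¹ : A₂ˣ) * (a₂ : A₂)) = 1 := by rw [Units.inv_mul, map_one]
    simpa [ha₂, h₂] using hmul
  refine ⟨kummerLift (Algebra.TensorProduct.lift φ₁ φ₂ fun _ _ ↦ Commute.all _ _) r ?_,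
    ?_, ?_, ?_⟩
  · rw [Algebra.TensorProduct.lift_tmul, h₁, ← h.pow_mul_eq, mul_assoc,
      mul_comm (u * (u - 1) ^ 2), hinv, mul_one]
  · simp [h₁]
  · simp [h₂]
  · simp

variable {A₁} in
theorem algHom_ext_kummerQuotientRing
    {f g : KummerQuotientRing k 4 (algebraMap k[X] A₁ s) a₂ →ₐ[k] T}
    (hx : f (AdjoinRoot.of _ (algebraMap k[X] A₁ X ⊗ₜ 1)) =
      g (AdjoinRoot.of _ (algebraMap k[X] A₁ X ⊗ₜ 1)))
    (hu : f (AdjoinRoot.of _ (1 ⊗ₜ algebraMap k[X] A₂ X)) =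
      g (AdjoinRoot.of _ (1 ⊗ₜ algebraMap k[X] A₂ X)))
    (hr : f (AdjoinRoot.root _) = g (AdjoinRoot.root _)) : f = g :=
  AdjoinRoot.algHom_ext' (Algebra.TensorProduct.ext
    (algHom_ext_of_isLocalizationAway s (Polynomial.algHom_ext hx))
    (algHom_ext_of_isLocalizationAway (X * (X - 1) * (X + 1) : k[X])
      (Polynomial.algHom_ext hu))) hr

end Quotient

section Cover

variable [IsLocalization.Away (X * C s * (X ^ 4 + C s) : k[X][X]) A₃] {a₃ : A₃}

theorem isCoverPoint_kummerRing
    (ha₃ : a₃ * algebraMap k[X][X] A₃ (X ^ 4) = algebraMap k[X][X] A₃ (X ^ 4 + C s)) :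
    IsCoverPoint (T := KummerRing 2 a₃) s (AdjoinRoot.of _ (algebraMap k[X][X] A₃ (C X)))
      (AdjoinRoot.of _ (algebraMap k[X][X] A₃ X)) (AdjoinRoot.root _) := by
  let i : k[X][X] →ₐ[k] KummerRing 2 a₃ :=
    (AdjoinRoot.ofAlgHom k _).comp (IsScalarTower.toAlgHom k k[X][X] A₃)
  have hs : aeval (i (C X)) s = i (C s) := (map_eq_aeval_map_X (i.comp CAlgHom) s).symm
  have hadd : i X ^ 4 + aeval (i (C X)) s = i (X ^ 4 + C s) := by rw [hs, map_add, map_pow]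
  refine ⟨?_, ?_⟩
  · have hmul : i X * aeval (i (C X)) s * (i X ^ 4 + aeval (i (C X)) s) =
        i (X * C s * (X ^ 4 + C s)) := by rw [hadd, hs, map_mul, map_mul]
    exact hmul ▸ (IsLocalization.Away.algebraMap_isUnit (S := A₃) _).map (AdjoinRoot.of _)
  · refine .trans ?_ hadd.symm
    change _ = AdjoinRoot.of _ (algebraMap k[X][X] A₃ (X ^ 4 + C s))
    rw [KummerRing.root_pow, ← ha₃, map_mul, map_pow, map_pow]

theorem IsCoverPoint.exists_algHom {x t w : T} (h : IsCoverPoint s x t w)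
    (ha₃ : a₃ * algebraMap k[X][X] A₃ (X ^ 4) = algebraMap k[X][X] A₃ (X ^ 4 + C s)) :
    ∃ φ : KummerRing 2 a₃ →ₐ[k] T,
      φ (AdjoinRoot.of _ (algebraMap k[X][X] A₃ (C X))) = x ∧
      φ (AdjoinRoot.of _ (algebraMap k[X][X] A₃ X)) = t ∧ φ (AdjoinRoot.root _) = w := by
  let ψ : k[X][X] →ₐ[k] T := aevalAeval x t
  have hC (p : k[X]) : ψ (C p) = aeval x p := by simp [ψ]
  have hX : ψ X = t := by simp [ψ]
  obtain ⟨φ, hφ⟩ := exists_algHom_of_isLocalizationAway (B := A₃) (X * C s * (X ^ 4 + C s)) ψ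
    (by simpa only [map_mul, map_add, map_pow, hC, hX] using h.isUnit_mul)
  have ht : IsUnit (t ^ 4) :=
    (isUnit_of_mul_isUnit_left (isUnit_of_mul_isUnit_left h.isUnit_mul)).pow 4
  have hw : φ a₃ * t ^ 4 = w ^ 2 * t ^ 4 := by
    have hmul := congrArg φ ha₃
    rwa [map_mul, hφ, hφ, map_add, map_pow, hX, hC, ← h.sq_mul_eq] at hmul
  refine ⟨kummerLift φ w (ht.mul_right_cancel hw).symm, ?_, ?_, kummerLift_root ..⟩
  · rw [kummerLift_of, hφ, hC, aeval_X]
  · rw [kummerLift_of, hφ, hX]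

end Cover

theorem algHom_ext_kummerRing (s : k[X])
    [IsLocalization.Away (X * C s * (X ^ 4 + C s) : k[X][X]) A₃] {a₃ : A₃}
    {f g : KummerRing 2 a₃ →ₐ[k] T}
    (hx : f (AdjoinRoot.of _ (algebraMap k[X][X] A₃ (C X))) =
      g (AdjoinRoot.of _ (algebraMap k[X][X] A₃ (C X))))
    (ht : f (AdjoinRoot.of _ (algebraMap k[X][X] A₃ X)) =
      g (AdjoinRoot.of _ (algebraMap k[X][X] A₃ X)))
    (hw : f (AdjoinRoot.root _) = g (AdjoinRoot.root _)) : f = g :=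
  AdjoinRoot.algHom_ext' (algHom_ext_of_isLocalizationAway (X * C s * (X ^ 4 + C s) : k[X][X])
    (Polynomial.algHom_ext' (Polynomial.algHom_ext hx) ht)) hw

theorem nonempty_algEquiv_kummerRing [IsLocalization.Away s A₁]
    [IsLocalization.Away (X * (X - 1) * (X + 1) : k[X]) A₂]
    [IsLocalization.Away (X * C s * (X ^ 4 + C s) : k[X][X]) A₃] {a₂ : A₂ˣ} {a₃ : A₃}
    (ha₂ : (a₂ : A₂) = algebraMap k[X] A₂ (X * (X - 1) ^ 2))
    (ha₃ : a₃ * algebraMap k[X][X] A₃ (X ^ 4) = algebraMap k[X][X] A₃ (X ^ 4 + C s))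
    {c : k} (hc : c ^ 2 * 2 = 1) :
    Nonempty (KummerQuotientRing k 4 (algebraMap k[X] A₁ s) a₂ ≃ₐ[k] KummerRing 2 a₃) := by
  have hR := isQuotientPoint_kummerQuotientRing A₁ (s := s) ha₂
  have hB := isCoverPoint_kummerRing ha₃
  have hcR := congrArg (algebraMap k (KummerQuotientRing k 4 (algebraMap k[X] A₁ s) a₂)) hc
  have hcB := congrArg (algebraMap k (KummerRing 2 a₃)) hc
  rw [map_mul, map_pow, map_ofNat, map_one] at hcR hcB
  obtain ⟨v, hv⟩ := hB.isUnit_add_one.exists_right_inv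
  obtain ⟨z, hz⟩ := hR.isUnit_one_sub.exists_right_inv
  obtain ⟨φ, hφx, hφu, hφr⟩ := (hB.isQuotientPoint hcB hv).exists_algHom A₁ ha₂
  obtain ⟨ψ, hψx, hψt, hψw⟩ := (hR.isCoverPoint hcR hz).exists_algHom ha₃
  have hφz := congrArg φ hz
  have hψv := congrArg ψ hv
  rw [map_mul, map_sub, map_one, hφu] at hφz
  rw [map_mul, map_add, map_one, hψw] at hψv
  refine ⟨AlgEquiv.ofAlgHom φ ψ (algHom_ext_kummerRing s ?_ ?_ ?_)
    (algHom_ext_kummerQuotientRing ?_ ?_ ?_)⟩ <;> rw [AlgHom.comp_apply, AlgHom.id_apply]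
  · rw [hψx, hφx]
  · rw [hψt, map_mul, map_mul, map_sub, map_one, φ.commutes, hφr, hφu,
      mul_mul_one_sub_eq_self hcB hv]
  · rw [hψw, map_mul, map_add, map_one, hφu, one_add_mul_eq_self hv hφz]
  · rw [hφx, hψx]
  · rw [hφu, map_mul, map_sub, map_one, hψw, sub_one_mul_eq_self hz hψv]
  · rw [hφr, map_mul, map_mul, map_add, map_one, ψ.commutes, hψt, hψw,
      mul_mul_add_one_eq_self hcR hz]

end Universal

end Substitution

section Birational

open Polynomial TensorProduct

theorem exists_kummerChart_of_isLocalizationAway {k P A : Type} [Field k] [CommRing P]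
    [IsDomain P] [IsIntegrallyClosed P] [Algebra k P] [CommRing A] [Algebra k A] [Algebra P A]
    [IsScalarTower k P A] {Y : Scheme.{0}} [IsIntegral Y] {str : Y ⟶ Spec (.of k)}
    (i₀ : Spec (.of P) ⟶ Y) [IsOpenImmersion i₀]
    (hstr : i₀ ≫ str = Spec.map (CommRingCat.ofHom (algebraMap k P)))
    {s : P} (hs : s ≠ 0) [IsLocalization.Away s A] {n : ℕ} (hn : (n : k) ≠ 0)
    {ζ : k} (hζ : IsPrimitiveRoot ζ n) {a : A} (ha : IsUnit a) {p q : P} (hq : q ≠ 0)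
    (hpq : a * algebraMap P A q = algebraMap P A p) {f : Y.functionField}
    (hf : f = chartToFunctionField i₀ p / chartToFunctionField i₀ q) :
    ∃ (i : Spec (.of A) ⟶ Y) (h : Spec (.of (KummerRing n a)) ⟶ kummerCover n f),
      IsOpenImmersion i ∧ i ≫ str = Spec.map (CommRingCat.ofHom (algebraMap k A)) ∧
      Dense (kummerCover.π n f ⁻¹' Set.range i) ∧
      IsPullback h (Spec.map (CommRingCat.ofHom (algebraMap A (KummerRing n a))))
        (kummerCover.π n f) i ∧
      ∀ (ξ : k) (hξ : ξ ^ n = 1)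
        (hη : chartToFunctionField i₀ (algebraMap k P ξ) ^ n = 1),
        Spec.map (CommRingCat.ofHom (kummerRotOver k hξ a).toRingHom) ≫ h =
          h ≫ kummerCover.rot n f (chartToFunctionField i₀ (algebraMap k P ξ)) hη := by
  have hM : Submonoid.powers s ≤ nonZeroDivisors P := powers_le_nonZeroDivisors_of_noZeroDivisors hs
  have : IsDomain A := IsLocalization.isDomain_of_le_nonZeroDivisors A hM
  have : IsIntegrallyClosed A := isIntegrallyClosed_of_isLocalization A _ hM
  have : IsOpenImmersion (Spec.map (CommRingCat.ofHom (algebraMap P A))) :=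
    IsOpenImmersion.of_isLocalization s
  let i : Spec (.of A) ⟶ Y := Spec.map (CommRingCat.ofHom (algebraMap P A)) ≫ i₀
  have hi (b : P) : chartToFunctionField i₀ b = chartToFunctionField i (algebraMap P A b) :=
    congr($(chartToFunctionField_SpecMap_comp i₀ (CommRingCat.ofHom (algebraMap P A))) b).symm
  obtain rfl : f = chartToFunctionField i a := by
    rw [hf, div_eq_iff ((map_ne_zero_iff _ (chartToFunctionField_injective i₀)).mpr hq), hi, hi,
      ← map_mul, hpq]
  have hn₀ : n ≠ 0 := fun h ↦ hn (by rw [h, Nat.cast_zero])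
  have hnA : IsUnit (n : A) := map_natCast (algebraMap k A) n ▸ hn.isUnit.map (algebraMap k A)
  obtain ⟨h, hh, hgen⟩ := exists_isPullback_kummerCover i hnA hn₀ ha
    (hζ.map_of_injective (algebraMap k A).injective)
  refine ⟨i, h, inferInstance, ?_, ?_, hh, fun ξ hξ hη ↦ ?_⟩
  · rw [Category.assoc, hstr, ← Spec.map_comp, ← CommRingCat.ofHom_comp,
      IsScalarTower.algebraMap_eq k P A]
  · obtain ⟨x⟩ : Nonempty (Spec (.of A)) := inferInstance
    exact dense_preimage_kummerCover n _ (U := i.opensRange) ⟨i x, x, rfl⟩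
  · have hξi : chartToFunctionField i₀ (algebraMap k P ξ) =
        chartToFunctionField i (algebraMap k A ξ) := by
      rw [hi, ← IsScalarTower.algebraMap_apply k P A]
    simp only [hξi]
    exact SpecMap_kummerRot_comp i hn₀ hh hgen (by rw [← map_pow, hξ, map_one]) (hξi ▸ hη)

theorem Hirz.j₀_proj (n : ℕ) : Hirz.j₀ n ≫ Hirz.proj n = P1.str ℂ[X] ≫ P1.ι₀ ℂ :=
  pushout.inl_desc _ _ _

theorem Hirz.ι₀_j₀_str (n : ℕ) : P1.ι₀ ℂ[X] ≫ Hirz.j₀ n ≫ Hirz.str n =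
    Spec.map (CommRingCat.ofHom (algebraMap ℂ ℂ[X][X])) := by
  rw [Hirz.str, reassoc_of% (Hirz.j₀_proj n), P1.ι₀_str, reassoc_of% (P1.ι₀_str), ← Spec.map_comp,
    ← CommRingCat.ofHom_comp]

variable (σ : MvPolynomial (Fin 2) ℂ)

theorem surfaceY.exists_isOpenImmersion (hσ : Hirz.dehom₀ σ ≠ 0) {A₃ : Type} [CommRing A₃]
    [Algebra ℂ A₃] [Algebra ℂ[X][X] A₃] [IsScalarTower ℂ ℂ[X][X] A₃]
    [IsLocalization.Away (X * C (Hirz.dehom₀ σ) * (X ^ 4 + C (Hirz.dehom₀ σ)) : ℂ[X][X]) A₃]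
    {a₃ : A₃} (ha₃ : a₃ * algebraMap ℂ[X][X] A₃ (X ^ 4) =
      algebraMap ℂ[X][X] A₃ (X ^ 4 + C (Hirz.dehom₀ σ))) :
    ∃ h : Spec (.of (KummerRing 2 a₃)) ⟶ surfaceY σ, IsOpenImmersion h ∧ IsDominant h ∧
      h ≫ surfaceY.str σ = Spec.map (CommRingCat.ofHom (algebraMap ℂ (KummerRing 2 a₃))) := by
  have hd : (X * C (Hirz.dehom₀ σ) * (X ^ 4 + C (Hirz.dehom₀ σ)) : ℂ[X][X]) ≠ 0 :=
    mul_ne_zero (mul_ne_zero X_ne_zero (C_ne_zero.mpr hσ)) (X_pow_add_C_ne_zero four_pos _)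
  have hunit : IsUnit (algebraMap ℂ[X][X] A₃
      (X * C (Hirz.dehom₀ σ) * (X ^ 4 + C (Hirz.dehom₀ σ)))) :=
    IsLocalization.Away.algebraMap_isUnit _
  rw [map_mul, ← ha₃] at hunit
  obtain ⟨i, h, _, hi, hdense, hp, -⟩ := exists_kummerChart_of_isLocalizationAway (A := A₃)
    (P1.ι₀ ℂ[X] ≫ Hirz.j₀ 2) ((Category.assoc _ _ _).trans (Hirz.ι₀_j₀_str 2)) hd
    (Nat.cast_ne_zero.mpr two_ne_zero) (IsPrimitiveRoot.neg_one 0 two_ne_zero.symm)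
    (isUnit_of_mul_isUnit_left (isUnit_of_mul_isUnit_right hunit)) (pow_ne_zero 4 X_ne_zero) ha₃
    (f := branchFunction σ) rfl
  refine ⟨h, MorphismProperty.of_isPullback hp.flip inferInstance,
    ⟨by rwa [DenseRange, range_eq_of_isPullback hp]⟩, ?_⟩
  rw [surfaceY.str, reassoc_of% hp.w, hi, ← Spec.map_comp, ← CommRingCat.ofHom_comp,
    IsScalarTower.algebraMap_eq ℂ A₃ (KummerRing 2 a₃)]

theorem exists_lineChart {g : ℂ[X]} (hg : g ≠ 0) {A : Type} [CommRing A] [Algebra ℂ A]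
    [Algebra ℂ[X] A] [IsScalarTower ℂ ℂ[X] A] [IsLocalization.Away g A] {p : ℂ[X]}
    {a : A} (ha : IsUnit a) (hap : a = algebraMap ℂ[X] A p) {ζ : ℂ} (hζ : IsPrimitiveRoot ζ 4) :
    ∃ (i : Spec (.of A) ⟶ P1 ℂ)
      (h : Spec (.of (KummerRing 4 a)) ⟶ kummerCover 4 (lineFunction p)),
      IsOpenImmersion i ∧ i ≫ P1.str ℂ = Spec.map (CommRingCat.ofHom (algebraMap ℂ A)) ∧
      Dense (kummerCover.π 4 (lineFunction p) ⁻¹' Set.range i) ∧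
      IsPullback h (Spec.map (CommRingCat.ofHom (algebraMap A (KummerRing 4 a))))
        (kummerCover.π 4 (lineFunction p)) i ∧
      Spec.map (CommRingCat.ofHom (kummerRotOver ℂ hζ.pow_eq_one a).toRingHom) ≫ h =
        h ≫ kummerCover.rot 4 (lineFunction p) (lineFunction (C ζ))
          (lineFunction_root hζ.pow_eq_one) := by
  obtain ⟨i, h, hi, hstr, hd, hpb, hrot⟩ := exists_kummerChart_of_isLocalizationAway (A := A)
    (P1.ι₀ ℂ) (P1.ι₀_str ℂ) hg (Nat.cast_ne_zero.mpr four_ne_zero) hζ ha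
    (p := p) (q := 1) one_ne_zero (by rw [map_one, mul_one, hap]) (f := lineFunction p)
    (by rw [map_one, div_one]; rfl)
  exact ⟨i, h, hi, hstr, hd, hpb, hrot ζ _ _⟩

theorem quotientCE.exists_isOpenImmersion (hσ : Hirz.dehom₀ σ ≠ 0) {ζ : ℂ}
    (hζ : IsPrimitiveRoot ζ 4) (A₁ : Type) [CommRing A₁] [Algebra ℂ A₁] [Algebra ℂ[X] A₁]
    [IsScalarTower ℂ ℂ[X] A₁] [IsLocalization.Away (Hirz.dehom₀ σ) A₁] {A₂ : Type} [CommRing A₂]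
    [Algebra ℂ A₂] [Algebra ℂ[X] A₂] [IsScalarTower ℂ ℂ[X] A₂]
    [IsLocalization.Away (X * (X - 1) * (X + 1) : ℂ[X]) A₂] {a₂ : A₂ˣ}
    (ha₂ : (a₂ : A₂) = algebraMap ℂ[X] A₂ (X * (X - 1) ^ 2)) :
    ∃ q : Spec (.of (KummerQuotientRing ℂ 4 (algebraMap ℂ[X] A₁ (Hirz.dehom₀ σ)) a₂)) ⟶
        quotientCE σ ζ hζ.pow_eq_one, IsOpenImmersion q ∧ IsDominant q ∧
      q ≫ quotientCE.str σ ζ hζ.pow_eq_one = Spec.map (CommRingCat.ofHom (algebraMap ℂ _)) := by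
  have he : (X * (X - 1) * (X + 1) : ℂ[X]) ≠ 0 :=
    mul_ne_zero (mul_ne_zero X_ne_zero (X_sub_C_ne_zero 1)) (X_add_C_ne_zero 1)
  have hζ_sub (j : ℕ) (hj : j < 4) (hj₀ : j ≠ 0) : IsUnit (ζ ^ j - 1) :=
    isUnit_iff_ne_zero.mpr (sub_ne_zero.mpr (hζ.pow_ne_one_of_pos_of_lt hj₀ hj))
  have ha₁ : IsUnit (algebraMap ℂ[X] A₁ (Hirz.dehom₀ σ)) :=
    IsLocalization.Away.algebraMap_isUnit _
  obtain ⟨i₁, h₁, _, hs₁, hd₁, hp₁, hr₁⟩ := exists_lineChart hσ ha₁ rfl hζ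
  obtain ⟨i₂, h₂, _, hs₂, hd₂, hp₂, hr₂⟩ := exists_lineChart he a₂.isUnit ha₂ hζ
  obtain ⟨q, hq, hqd, hqs⟩ := exists_isOpenImmersion_prodQuotient
    (kummerCover.π 4 (lineFunction (Hirz.dehom₀ σ)))
    (kummerCover.π 4 (lineFunction (X * (X - 1) ^ 2)))
    (kummerCover.rot_π ..) (kummerCover.rot_π ..) hr₁ hr₂ hs₁ hs₂ hd₁ hd₂ hp₁ hp₂
    (kummerQuotientToTensor_injective ℂ _ a₂ four_ne_zero)
    (tensorMap_kummerRotOver_eq_self_iff _ a₂ four_ne_zero hζ.pow_eq_one hζ_sub)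
  exact ⟨q, hq, ⟨hqd⟩, hqs⟩

theorem birationalOver_surfaceY_quotientCE (hσ : Hirz.dehom₀ σ ≠ 0) {ζ : ℂ}
    (hζ : IsPrimitiveRoot ζ 4) :
    Scheme.BirationalOver (surfaceY.str σ) (quotientCE.str σ ζ hζ.pow_eq_one) := by
  let s := Hirz.dehom₀ σ
  let A₁ := Localization.Away s
  let A₂ := Localization.Away (X * (X - 1) * (X + 1) : ℂ[X])
  let A₃ := Localization.Away (X * C s * (X ^ 4 + C s) : ℂ[X][X])
  obtain ⟨a₂, ha₂⟩ : IsUnit (algebraMap ℂ[X] A₂ (X * (X - 1) ^ 2)) := by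
    have h : IsUnit (algebraMap ℂ[X] A₂ (X * (X - 1) * (X + 1))) :=
      IsLocalization.Away.algebraMap_isUnit _
    rw [map_mul, map_mul] at h
    rw [map_mul, map_pow]
    have hmul := isUnit_of_mul_isUnit_left h
    exact (isUnit_of_mul_isUnit_left hmul).mul ((isUnit_of_mul_isUnit_right hmul).pow 2)
  obtain ⟨a₃, ha₃⟩ : algebraMap ℂ[X][X] A₃ (X ^ 4) ∣ algebraMap ℂ[X][X] A₃ (X ^ 4 + C s) := by
    have h : IsUnit (algebraMap ℂ[X][X] A₃ (X * C s * (X ^ 4 + C s))) :=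
      IsLocalization.Away.algebraMap_isUnit _
    rw [map_mul, map_mul] at h
    rw [map_pow]
    exact ((isUnit_of_mul_isUnit_left (isUnit_of_mul_isUnit_left h)).pow 4).dvd
  replace ha₃ := (mul_comm _ _).trans ha₃.symm
  obtain ⟨h, _, _, hh⟩ := surfaceY.exists_isOpenImmersion σ hσ ha₃
  obtain ⟨q, _, _, hq⟩ := quotientCE.exists_isOpenImmersion σ hσ hζ A₁ ha₂
  obtain ⟨c, hc⟩ := IsAlgClosed.exists_pow_nat_eq (2⁻¹ : ℂ) two_pos
  obtain ⟨ε⟩ := nonempty_algEquiv_kummerRing (A₁ := A₁) ha₂ ha₃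
    (hc ▸ inv_mul_cancel₀ two_ne_zero)
  let e := Spec.map ε.toRingEquiv.toCommRingCatIso.hom
  have : IsDominant (e ≫ q) := inferInstance
  have heq : (e ≫ q) ≫ quotientCE.str σ ζ hζ.pow_eq_one =
      Spec.map (CommRingCat.ofHom (algebraMap ℂ (KummerRing 2 a₃))) := by
    rw [Category.assoc, hq, ← Spec.map_comp]
    congr 1
    exact CommRingCat.hom_ext (RingHom.ext fun x ↦ ε.commutes x)
  exact (h.birationalOver _ _ hh).symm.trans ((e ≫ q).birationalOver _ _ heq)

end Birational

section Ideals

open Scheme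

variable {X Y Z : Scheme.{u}}

theorem ideal_top_comap [IsAffine X] [IsAffine Y] (I : Y.IdealSheafData) (f : X ⟶ Y) :
    (I.comap f).ideal ⟨⊤, isAffineOpen_top X⟩ =
      (I.ideal ⟨⊤, isAffineOpen_top Y⟩).map f.appTop.hom := by
  have le_iff (J : X.IdealSheafData) : (I.comap f).ideal ⟨⊤, isAffineOpen_top X⟩ ≤
      J.ideal ⟨⊤, isAffineOpen_top X⟩ ↔ (I.ideal ⟨⊤, isAffineOpen_top Y⟩).map f.appTop.hom ≤
        J.ideal ⟨⊤, isAffineOpen_top X⟩ := by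
    have hJ : (J.map f).ideal ⟨⊤, isAffineOpen_top Y⟩ =
        (J.ideal ⟨⊤, isAffineOpen_top X⟩).comap f.appTop.hom :=
      IdealSheafData.ideal_map_of_isAffineHom J f ⟨⊤, isAffineOpen_top Y⟩
    rw [Ideal.map_le_iff_le_comap, ← hJ]
    exact ⟨fun h ↦ IdealSheafData.le_map_iff_comap_le.mpr (IdealSheafData.le_of_isAffine h) _,
      fun h ↦ IdealSheafData.le_map_iff_comap_le.mp (IdealSheafData.le_of_isAffine h) _⟩
  refine le_antisymm ?_ ((le_iff _).mp le_rfl)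
  have := le_iff (IdealSheafData.ofIdealTop ((I.ideal ⟨⊤, isAffineOpen_top Y⟩).map f.appTop.hom))
  simpa [IdealSheafData.ofIdealTop_ideal] using this

/-- The restriction of the ideal sheaf `I` along `i : Spec P ⟶ Y`, as an ideal of `P`. -/
def chartIdeal (I : Y.IdealSheafData) {P : CommRingCat.{u}} (i : Spec P ⟶ Y) : Ideal P :=
  ((I.comap i).ideal ⟨⊤, isAffineOpen_top _⟩).comap (Scheme.ΓSpecIso P).inv.hom

theorem chartIdeal_comap (I : Y.IdealSheafData) {P : CommRingCat.{u}} (f : X ⟶ Y)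
    (i : Spec P ⟶ X) : chartIdeal (I.comap f) i = chartIdeal I (i ≫ f) := by
  rw [chartIdeal, chartIdeal, IdealSheafData.comap_comp]

theorem chartIdeal_SpecMap_comp (I : Y.IdealSheafData) {P Q : CommRingCat.{u}} (i : Spec P ⟶ Y)
    (φ : P ⟶ Q) : chartIdeal I (Spec.map φ ≫ i) = (chartIdeal I i).map φ.hom := by
  have comap_eq_map {P : CommRingCat.{u}} (K : Ideal Γ(Spec P, ⊤)) :
      K.comap (Scheme.ΓSpecIso P).inv.hom = K.map (Scheme.ΓSpecIso P).hom.hom :=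
    (Ideal.map_comap_of_equiv (Scheme.ΓSpecIso P).commRingCatIsoToRingEquiv).symm
  rw [chartIdeal, chartIdeal, IdealSheafData.comap_comp, ideal_top_comap, comap_eq_map,
    comap_eq_map, Ideal.map_map, Ideal.map_map, ← CommRingCat.hom_comp, ← CommRingCat.hom_comp,
    Scheme.ΓSpecIso_naturality]

theorem chartIdeal_ker (f : Z ⟶ Y) [QuasiCompact f] {P Q : CommRingCat.{u}} (i : Spec P ⟶ Y)
    [IsOpenImmersion i] (φ : P ⟶ Q) (j : Spec Q ⟶ Z) (h : IsPullback (Spec.map φ) j i f) :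
    chartIdeal f.ker i = RingHom.ker φ.hom := by
  rw [chartIdeal, IdealSheafData.ideal_comap_of_isOpenImmersion,
    ← ker_ideal_of_isPullback_of_isOpenImmersion f (Spec.map φ) j i h, Scheme.Hom.ker_apply]
  ext x
  have hx : (Spec.map φ).appTop.hom ((Scheme.ΓSpecIso P).inv.hom x) =
      (Scheme.ΓSpecIso Q).inv.hom (φ.hom x) := congr($((Scheme.ΓSpecIso_inv_naturality φ).symm) x)
  change (Spec.map φ).appTop.hom ((Scheme.ΓSpecIso P).inv.hom x) = 0 ↔ φ.hom x = 0
  rw [hx]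
  exact map_eq_zero_iff _ (Scheme.ΓSpecIso Q).symm.commRingCatIsoToRingEquiv.injective

end Ideals

section HasDivisor

variable {Y : Scheme.{0}} [IsIntegral Y]

theorem germToFunctionField_image_ideal (I : Y.IdealSheafData) {P : CommRingCat.{0}}
    [Nonempty (Spec P)] (i : Spec P ⟶ Y) [IsOpenImmersion i] [Nonempty (i ''ᵁ ⊤ : Y.Opens)] :
    (Y.germToFunctionField (i ''ᵁ ⊤)).hom ''
      (I.ideal ⟨i ''ᵁ ⊤, (isAffineOpen_top _).image_of_isOpenImmersion i⟩ : Set Γ(Y, i ''ᵁ ⊤)) =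
    chartToFunctionField i '' (chartIdeal I i : Set P) := by
  rw [chartIdeal, Scheme.IdealSheafData.ideal_comap_of_isOpenImmersion]
  let e : P ≃+* Γ(Y, i ''ᵁ ⊤) :=
    ((Scheme.ΓSpecIso P).symm ≪≫ (i.appIso ⊤).symm).commRingCatIsoToRingEquiv
  have he : ⇑(chartToFunctionField i) = (Y.germToFunctionField (i ''ᵁ ⊤)).hom ∘ e := rfl
  rw [he, Set.image_comp]
  congr 1
  exact (Set.image_preimage_eq _ e.surjective).symm

/-- On the affine chart `i`, the ideal sheaves `I` and `J` are generated by single functions, and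
`f` is the quotient of a generator of `I` by a generator of `J`; used to verify `HasDivisor` on
explicit charts. -/
def HasDivisorOnChart (f : Y.functionField) (I J : Y.IdealSheafData) {P : CommRingCat.{0}}
    [Nonempty (Spec P)] (i : Spec P ⟶ Y) [IsOpenImmersion i] : Prop :=
  ∃ p q : P, chartIdeal I i = Ideal.span {p} ∧ chartIdeal J i = Ideal.span {q} ∧
    f * chartToFunctionField i q = chartToFunctionField i p

theorem HasDivisorOnChart.image_mul_eq {f : Y.functionField} {I J : Y.IdealSheafData}
    {P : CommRingCat.{0}} [Nonempty (Spec P)] {i : Spec P ⟶ Y} [IsOpenImmersion i]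
    (h : HasDivisorOnChart f I J i) :
    (fun a ↦ f * chartToFunctionField i a) '' (chartIdeal J i : Set P) =
      chartToFunctionField i '' (chartIdeal I i : Set P) := by
  obtain ⟨p, q, hI, hJ, hf⟩ := h
  have hmul (b : P) : f * chartToFunctionField i (b * q) = chartToFunctionField i (b * p) := by
    rw [map_mul, map_mul, ← hf, mul_left_comm]
  ext z
  simp only [hI, hJ, Set.mem_image, SetLike.mem_coe, Ideal.mem_span_singleton',
    exists_exists_eq_and, hmul]

theorem hasDivisor_of_forall_exists_chart {f : Y.functionField} {I J : Y.IdealSheafData}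
    (h : ∀ y : Y, ∃ (P : CommRingCat.{0}) (_ : Nonempty (Spec P)) (i : Spec P ⟶ Y)
      (_ : IsOpenImmersion i), y ∈ Set.range i ∧ HasDivisorOnChart f I J i) :
    HasDivisor f I J := by
  intro y
  obtain ⟨P, _, i, _, ⟨x, rfl⟩, hi⟩ := h y
  have : Nonempty (i ''ᵁ ⊤ : Y.Opens) := ⟨⟨i x, x, trivial, rfl⟩⟩
  refine ⟨⟨i ''ᵁ ⊤, (isAffineOpen_top _).image_of_isOpenImmersion i⟩, ⟨x, trivial, rfl⟩, ?_⟩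
  have hJ := congrArg (Set.image (f * ·)) (germToFunctionField_image_ideal J i)
  rw [Set.image_image, Set.image_image] at hJ
  rw [germToFunctionField_image_ideal I i, ← hi.image_mul_eq]
  exact hJ

end HasDivisor

section ProjectiveLine

open Polynomial LaurentPolynomial

variable (R : Type) [CommRing R]

theorem range_gm₁ :
    Set.range (gm₁ R) = {p : Spec (.of R[X]) | (X : R[X]) ∉ p.asIdeal} := by
  let e : CommRingCat.of R[T;T⁻¹] ≅ CommRingCat.of R[T;T⁻¹] :=
    (invert (R := R)).toRingEquiv.toCommRingCatIso
  have he : gm₁ R = Spec.map e.hom ≫ gm₀ R := by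
    simp only [gm₁, gm₀, ← Spec.map_comp]
    congr 1
    ext x <;> simp [e]
  rw [he, ← range_gm₀, Scheme.Hom.comp_base, TopCat.coe_comp, Set.range_comp,
    (Spec.map e.hom).surjective.range_eq, Set.image_univ]

namespace P1

instance [IsNoetherianRing R] : TopologicalSpace.NoetherianSpace (P1 R) := by
  have hcover : ⋃ b : Bool, cond b (Set.range (ι₀ R)) (Set.range (ι₁ R)) = Set.univ := by
    rw [← Set.union_eq_iUnion]
    exact Set.eq_univ_of_forall exists_chart
  have (b : Bool) :
      TopologicalSpace.NoetherianSpace ↥(cond b (Set.range (ι₀ R)) (Set.range (ι₁ R))) := by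
    cases b
    · exact TopologicalSpace.NoetherianSpace.range (ι₁ R) (ι₁ R).continuous
    · exact TopologicalSpace.NoetherianSpace.range (ι₀ R) (ι₀ R).continuous
  rw [← TopologicalSpace.noetherian_univ_iff, ← hcover]
  exact TopologicalSpace.NoetherianSpace.iUnion _

variable {R}

theorem mem_range_ι₀_or_mem_range_localizationAway_ι₁ (A : Type) [CommRing A] [Algebra R[X] A]
    {d : R[X]} [IsLocalization.Away d A] (hd : X ∣ d - 1) (y : P1 R) :
    y ∈ Set.range (ι₀ R) ∨
      y ∈ Set.range (Spec.map (CommRingCat.ofHom (algebraMap R[X] A)) ≫ ι₁ R) := by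
  obtain ha | ⟨a, rfl⟩ := exists_chart y
  · exact .inl ha
  by_cases ha : (X : R[X]) ∈ a.asIdeal
  · have hda : d ∉ a.asIdeal := fun h ↦ a.isPrime.ne_top ((Ideal.eq_top_iff_one _).mpr
      (by simpa using a.asIdeal.sub_mem h (Ideal.mem_of_dvd _ hd ha)))
    obtain ⟨b, rfl⟩ := (PrimeSpectrum.localization_away_comap_range A d).ge hda
    exact .inr ⟨b, rfl⟩
  · obtain ⟨b, rfl⟩ := (range_gm₁ R).ge ha
    exact .inl ⟨gm₀ R b, congr($(P1.glue R) b)⟩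

end P1

theorem eval₂_T_neg_one_one_add (τ : R) (k : ℕ) :
    eval₂RingHom LaurentPolynomial.C (T (-1)) (1 + Polynomial.C τ * X ^ k : R[X]) *
      toLaurent (X ^ k) = toLaurent (X ^ k + Polynomial.C τ) := by
  simp only [map_add, map_mul, map_one, map_pow, coe_eval₂RingHom, Polynomial.eval₂_X,
    Polynomial.eval₂_C, toLaurent_X, toLaurent_C, T_pow, add_mul, one_mul, mul_assoc, ← T_add]
  simp

end ProjectiveLine

section FunctionField

open Polynomial LaurentPolynomial

variable {Y : Scheme.{0}} [IsIntegral Y]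

theorem exists_chartToFunctionField_eq {P Q S : CommRingCat.{0}} [Nonempty (Spec P)]
    [Nonempty (Spec Q)] [Nonempty (Spec S)] (i : Spec P ⟶ Y) (j : Spec Q ⟶ Y) [IsOpenImmersion i]
    [IsOpenImmersion j] (φ : P ⟶ S) (ψ : Q ⟶ S) [IsOpenImmersion (Spec.map φ)]
    [IsOpenImmersion (Spec.map ψ)] (h : Spec.map φ ≫ i = Spec.map ψ ≫ j) :
    ∃ κ : S →+* Y.functionField, (∀ p, chartToFunctionField i p = κ (φ p)) ∧
      ∀ q, chartToFunctionField j q = κ (ψ q) := by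
  refine ⟨chartToFunctionField (Spec.map φ ≫ i),
    fun p ↦ congr($(chartToFunctionField_SpecMap_comp i φ) p).symm, fun q ↦ ?_⟩
  simp only [h]
  exact congr($(chartToFunctionField_SpecMap_comp j ψ) q).symm

theorem chartToFunctionField_ι₁_mul_ι₀ {R : Type} [CommRing R] [IsDomain R] (j : P1 R ⟶ Y)
    [IsOpenImmersion j] (τ : R) (k : ℕ) :
    chartToFunctionField (R := .of R[X]) (P1.ι₁ R ≫ j) (1 + Polynomial.C τ * X ^ k) *
      chartToFunctionField (R := .of R[X]) (P1.ι₀ R ≫ j) (X ^ k) =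
        chartToFunctionField (R := .of R[X]) (P1.ι₀ R ≫ j) (X ^ k + Polynomial.C τ) := by
  have : IsOpenImmersion (Spec.map (CommRingCat.ofHom (toLaurent : R[X] →+* R[T;T⁻¹]))) :=
    inferInstanceAs (IsOpenImmersion (gm₀ R))
  have : IsOpenImmersion (Spec.map (CommRingCat.ofHom
      (eval₂RingHom (LaurentPolynomial.C (R := R)) (T (-1))))) :=
    inferInstanceAs (IsOpenImmersion (gm₁ R))
  obtain ⟨κ, hκ₀, hκ₁⟩ := exists_chartToFunctionField_eq (P1.ι₀ R ≫ j) (P1.ι₁ R ≫ j)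
    (CommRingCat.ofHom (toLaurent : R[X] →+* R[T;T⁻¹]))
    (CommRingCat.ofHom (eval₂RingHom (LaurentPolynomial.C (R := R)) (T (-1))))
    (congr($(P1.glue R) ≫ j))
  rw [hκ₀, hκ₀, hκ₁, ← map_mul]
  exact congrArg κ (eval₂_T_neg_one_one_add R τ k)

end FunctionField

namespace Hirz

open Polynomial LaurentPolynomial

section Charts

variable {n : ℕ}

theorem j₁_proj (n : ℕ) : j₁ n ≫ proj n = P1.str ℂ[X] ≫ P1.ι₁ ℂ := pushout.inr_desc _ _ _

theorem ι₀_sectionE (σ : MvPolynomial (Fin 2) ℂ) (hσ : σ.IsHomogeneous n) :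
    P1.ι₀ ℂ ≫ sectionE σ hσ =
      Spec.map (CommRingCat.ofHom (evalRingHom (-dehom₀ σ))) ≫ P1.ι₀ ℂ[X] ≫ j₀ n :=
  pushout.inl_desc _ _ _

theorem ι₁_sectionE (σ : MvPolynomial (Fin 2) ℂ) (hσ : σ.IsHomogeneous n) :
    P1.ι₁ ℂ ≫ sectionE σ hσ =
      Spec.map (CommRingCat.ofHom (evalRingHom (-dehom₁ σ))) ≫ P1.ι₀ ℂ[X] ≫ j₁ n :=
  pushout.inr_desc _ _ _

theorem sectionE_proj (σ : MvPolynomial (Fin 2) ℂ) (hσ : σ.IsHomogeneous n) :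
    sectionE σ hσ ≫ proj n = 𝟙 _ := by
  have evalRingHom_C (p : ℂ[X]) : Spec.map (CommRingCat.ofHom (evalRingHom p)) ≫
      Spec.map (CommRingCat.ofHom (Polynomial.C : ℂ[X] →+* ℂ[X][X])) = 𝟙 _ := by
    rw [← Spec.map_comp, ← CommRingCat.ofHom_comp, ← Spec.map_id]
    congr 1
    ext <;> simp
  refine P1.hom_ext ?_ ?_
  · rw [reassoc_of% (ι₀_sectionE σ hσ), j₀_proj, reassoc_of% (P1.ι₀_str),
      reassoc_of% (evalRingHom_C), Category.comp_id]
  · rw [reassoc_of% (ι₁_sectionE σ hσ), j₁_proj, reassoc_of% (P1.ι₀_str),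
      reassoc_of% (evalRingHom_C), Category.comp_id]

theorem j₀_mu (n k : ℕ) : j₀ n ≫ mu n k = P1.map (RingHom.id _) 1 k ≫ j₀ (k * n) :=
  pushout.inl_desc _ _ _

theorem j₁_mu (n k : ℕ) : j₁ n ≫ mu n k = P1.map (RingHom.id _) 1 k ≫ j₁ (k * n) :=
  pushout.inr_desc _ _ _

end Charts

section SectionChart

/-- The chart `j` of `ℙ(𝒪 ⊕ 𝒪(n))` lies over the chart `c` of the projective line, and the section
`E_σ` is `t = -τ` in it. This covers `j₀` and `j₁` at once, with `τ` the corresponding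
dehomogenization of `σ`. -/
structure IsSectionChart {n : ℕ} (σ : MvPolynomial (Fin 2) ℂ) (hσ : σ.IsHomogeneous n)
    (c : Spec (.of ℂ[X]) ⟶ P1 ℂ) (j : P1 ℂ[X] ⟶ Hirz n) (τ : ℂ[X]) : Prop where
  proj_eq : j ≫ proj n = P1.str ℂ[X] ≫ c
  sectionE_eq : c ≫ sectionE σ hσ =
    Spec.map (CommRingCat.ofHom (evalRingHom (-τ))) ≫ P1.ι₀ ℂ[X] ≫ j

variable {n : ℕ} {σ : MvPolynomial (Fin 2) ℂ} {hσ : σ.IsHomogeneous n}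

theorem isSectionChart_j₀ : IsSectionChart σ hσ (P1.ι₀ ℂ) (j₀ n) (dehom₀ σ) :=
  ⟨j₀_proj n, ι₀_sectionE σ hσ⟩

theorem isSectionChart_j₁ : IsSectionChart σ hσ (P1.ι₁ ℂ) (j₁ n) (dehom₁ σ) :=
  ⟨j₁_proj n, ι₁_sectionE σ hσ⟩

variable {c : Spec (.of ℂ[X]) ⟶ P1 ℂ} {j : P1 ℂ[X] ⟶ Hirz n} {τ : ℂ[X]}

namespace IsSectionChart

theorem mem_range_of_sectionE_mem_range (hj : IsSectionChart σ hσ c j τ) {z : P1 ℂ}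
    (hz : sectionE σ hσ z ∈ Set.range j) : z ∈ Set.range c := by
  obtain ⟨x, hx⟩ := hz
  have hproj : proj n (sectionE σ hσ z) = z := congr($(sectionE_proj σ hσ) z)
  have hc : proj n (j x) = c (P1.str ℂ[X] x) := congr($hj.proj_eq x)
  exact ⟨P1.str ℂ[X] x, by rw [← hc, hx, hproj]⟩

theorem chartIdeal_ker_sectionE (hj : IsSectionChart σ hσ c j τ) [IsOpenImmersion c]
    [IsOpenImmersion j] :
    chartIdeal (sectionE σ hσ).ker (P1.ι₀ ℂ[X] ≫ j) =
      Ideal.span {(X + Polynomial.C τ : ℂ[X][X])} := by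
  have hker : RingHom.ker (evalRingHom (-τ)) = Ideal.span {(X + Polynomial.C τ : ℂ[X][X])} := by
    rw [Polynomial.ker_evalRingHom, C_neg, sub_neg_eq_add]
  rw [← hker]
  refine chartIdeal_ker (sectionE σ hσ) (P1.ι₀ ℂ[X] ≫ j) (CommRingCat.ofHom (evalRingHom (-τ))) c
    (IsOpenImmersion.isPullback _ _ _ _ hj.sectionE_eq
      (TopologicalSpace.Opens.ext (Set.ext fun z ↦ ⟨?_, ?_⟩)))
  · rintro ⟨x, hx⟩
    exact hj.mem_range_of_sectionE_mem_range ⟨P1.ι₀ ℂ[X] x, hx⟩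
  · rintro ⟨x, rfl⟩
    exact ⟨_, congr($hj.sectionE_eq.symm x)⟩

theorem one_add_mem_of_sectionE_eq (hj : IsSectionChart σ hσ c j τ) [IsOpenImmersion j] {z : P1 ℂ}
    {a : Spec (.of ℂ[X][X])} (h : sectionE σ hσ z = (P1.ι₁ ℂ[X] ≫ j) a) :
    (1 + Polynomial.C τ * X : ℂ[X][X]) ∈ a.asIdeal := by
  obtain ⟨x, rfl⟩ := hj.mem_range_of_sectionE_mem_range ⟨P1.ι₁ ℂ[X] a, h.symm⟩
  have hx : sectionE σ hσ (c x) =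
      j (P1.ι₀ ℂ[X] (Spec.map (CommRingCat.ofHom (evalRingHom (-τ))) x)) :=
    congr($hj.sectionE_eq x)
  obtain ⟨b, hb₀, rfl⟩ := P1.ι₀_eq_ι₁ (j.isOpenEmbedding.injective (hx.symm.trans h))
  have hmem₀ : (X + Polynomial.C τ : ℂ[X][X]) ∈ (gm₀ ℂ[X] b).asIdeal := by
    rw [hb₀]
    change evalRingHom (-τ) (X + Polynomial.C τ) ∈ x.asIdeal
    simp
  change toLaurent (X + Polynomial.C τ : ℂ[X][X]) ∈ b.asIdeal at hmem₀
  have hmul := eval₂_T_neg_one_one_add ℂ[X] τ 1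
  rw [pow_one, toLaurent_X] at hmul
  rw [← hmul] at hmem₀
  exact (Ideal.mul_unit_mem_iff_mem b.asIdeal (isUnit_T 1)).mp hmem₀

theorem one_add_mem_of_mem_support_ker_sectionE (hj : IsSectionChart σ hσ c j τ)
    [IsOpenImmersion j] {a : Spec (.of ℂ[X][X])}
    (ha : (P1.ι₁ ℂ[X] ≫ j) a ∈ (sectionE σ hσ).ker.support) :
    (1 + Polynomial.C τ * X : ℂ[X][X]) ∈ a.asIdeal := by
  by_contra hnot
  rw [← SetLike.mem_coe, Scheme.Hom.support_ker] at ha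
  have hopen : IsOpen ((P1.ι₁ ℂ[X] ≫ j) ''
      {b | (1 + Polynomial.C τ * X : ℂ[X][X]) ∉ b.asIdeal}) :=
    (P1.ι₁ ℂ[X] ≫ j).isOpenEmbedding.isOpenMap _
      (PrimeSpectrum.basicOpen (1 + Polynomial.C τ * X : ℂ[X][X])).isOpen
  obtain ⟨_, ⟨b, hb, hz⟩, z, rfl⟩ := mem_closure_iff.mp ha _ hopen ⟨a, hnot, rfl⟩
  exact hb (hj.one_add_mem_of_sectionE_eq hz.symm)

variable {Y : Scheme.{0}} {m : Y ⟶ Hirz n} {i : P1 ℂ[X] ⟶ Y} {k : ℕ}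

theorem chartIdeal_comap (hj : IsSectionChart σ hσ c j τ) [IsOpenImmersion c] [IsOpenImmersion j]
    (hm : i ≫ m = P1.map (RingHom.id _) 1 k ≫ j) :
    chartIdeal ((sectionE σ hσ).ker.comap m) (P1.ι₀ ℂ[X] ≫ i) =
      Ideal.span {(X ^ k + Polynomial.C τ : ℂ[X][X])} := by
  rw [KummerK3.chartIdeal_comap, Category.assoc, hm, reassoc_of% (P1.ι₀_map),
    chartIdeal_SpecMap_comp, hj.chartIdeal_ker_sectionE]
  refine (Ideal.map_span _ _).trans ?_
  simp [P1.coordMap]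

theorem chartIdeal_comap_eq_top (hj : IsSectionChart σ hσ c j τ) [IsOpenImmersion j]
    (hm : i ≫ m = P1.map (RingHom.id _) 1 k ≫ j) {A : Type} [CommRing A] {φ : ℂ[X][X] →+* A}
    (hφ : IsUnit (φ (1 + Polynomial.C τ * X ^ k))) :
    chartIdeal ((sectionE σ hσ).ker.comap m)
      (Spec.map (CommRingCat.ofHom φ) ≫ P1.ι₁ ℂ[X] ≫ i) = ⊤ := by
  suffices h : ((sectionE σ hσ).ker.comap m).comap
      (Spec.map (CommRingCat.ofHom φ) ≫ P1.ι₁ ℂ[X] ≫ i) = ⊤ by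
    rw [chartIdeal, h]
    rfl
  have hchart : (Spec.map (CommRingCat.ofHom φ) ≫ P1.ι₁ ℂ[X] ≫ i) ≫ m =
      Spec.map (CommRingCat.ofHom φ) ≫ Spec.map (CommRingCat.ofHom
        (P1.coordMap (RingHom.id ℂ[X]) 1⁻¹ k)) ≫ P1.ι₁ ℂ[X] ≫ j := by
    rw [Category.assoc, Category.assoc, hm, reassoc_of% (P1.ι₁_map)]
  have hcoord : P1.coordMap (RingHom.id ℂ[X]) 1⁻¹ k (1 + Polynomial.C τ * X) =
      1 + Polynomial.C τ * X ^ k := by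
    simp [P1.coordMap]
  rw [← Scheme.IdealSheafData.support_eq_bot_iff, ← Scheme.IdealSheafData.comap_comp, hchart,
    Scheme.IdealSheafData.support_comap]
  refine TopologicalSpace.Closeds.ext (Set.eq_empty_of_forall_notMem fun x hx ↦ ?_)
  have hmem : φ (P1.coordMap (RingHom.id ℂ[X]) 1⁻¹ k (1 + Polynomial.C τ * X)) ∈ x.asIdeal :=
    hj.one_add_mem_of_mem_support_ker_sectionE hx
  rw [hcoord] at hmem
  exact x.isPrime.ne_top (Ideal.eq_top_of_isUnit_mem _ hmem hφ)

end IsSectionChart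

end SectionChart

end Hirz

section Divisor

open Polynomial LaurentPolynomial

namespace Hirz

variable {n : ℕ} {σ σ' : MvPolynomial (Fin 2) ℂ} {hσ : σ.IsHomogeneous n}
  {hσ' : σ'.IsHomogeneous n} {c : Spec (.of ℂ[X]) ⟶ P1 ℂ} {j : P1 ℂ[X] ⟶ Hirz n} {τ τ' : ℂ[X]}
  {Y : Scheme.{0}} [IsIntegral Y] {m : Y ⟶ Hirz n} {i : P1 ℂ[X] ⟶ Y} [IsOpenImmersion i] {k : ℕ}
  {f : Y.functionField}

theorem hasDivisorOnChart_ι₀ [IsOpenImmersion c] [IsOpenImmersion j]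
    (hj : IsSectionChart σ hσ c j τ) (hj' : IsSectionChart σ' hσ' c j τ')
    (hm : i ≫ m = P1.map (RingHom.id _) 1 k ≫ j)
    (hf : f * chartToFunctionField (R := .of ℂ[X][X]) (P1.ι₀ ℂ[X] ≫ i) (X ^ k + Polynomial.C τ') =
      chartToFunctionField (R := .of ℂ[X][X]) (P1.ι₀ ℂ[X] ≫ i) (X ^ k + Polynomial.C τ)) :
    HasDivisorOnChart f ((sectionE σ hσ).ker.comap m) ((sectionE σ' hσ').ker.comap m)
      (P1.ι₀ ℂ[X] ≫ i) :=
  ⟨_, _, hj.chartIdeal_comap hm, hj'.chartIdeal_comap hm, hf⟩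

theorem hasDivisorOnChart_localization_ι₁ [IsOpenImmersion j]
    (hj : IsSectionChart σ hσ c j τ) (hj' : IsSectionChart σ' hσ' c j τ')
    (hm : i ≫ m = P1.map (RingHom.id _) 1 k ≫ j)
    (hf : f * chartToFunctionField (R := .of ℂ[X][X]) (P1.ι₀ ℂ[X] ≫ i) (X ^ k + Polynomial.C τ') =
      chartToFunctionField (R := .of ℂ[X][X]) (P1.ι₀ ℂ[X] ≫ i) (X ^ k + Polynomial.C τ))
    {A : Type} [CommRing A] [Nontrivial A] {φ : ℂ[X][X] →+* A}
    [IsOpenImmersion (Spec.map (CommRingCat.ofHom φ))]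
    (hu : IsUnit (φ (1 + Polynomial.C τ * X ^ k)))
    (hu' : IsUnit (φ (1 + Polynomial.C τ' * X ^ k))) :
    HasDivisorOnChart f ((sectionE σ hσ).ker.comap m) ((sectionE σ' hσ').ker.comap m)
      (Spec.map (CommRingCat.ofHom φ) ≫ P1.ι₁ ℂ[X] ≫ i) := by
  have hX : chartToFunctionField (R := .of ℂ[X][X]) (P1.ι₀ ℂ[X] ≫ i) (X ^ k) ≠ 0 :=
    (map_ne_zero_iff _ (chartToFunctionField_injective _)).mpr (pow_ne_zero k X_ne_zero)
  have hφ (p : ℂ[X][X]) :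
      chartToFunctionField (Spec.map (CommRingCat.ofHom φ) ≫ P1.ι₁ ℂ[X] ≫ i) (φ p) =
        chartToFunctionField (R := .of ℂ[X][X]) (P1.ι₁ ℂ[X] ≫ i) p :=
    congr($(chartToFunctionField_SpecMap_comp (P1.ι₁ ℂ[X] ≫ i) (CommRingCat.ofHom φ)) p)
  refine ⟨φ (1 + Polynomial.C τ * X ^ k), φ (1 + Polynomial.C τ' * X ^ k), ?_, ?_, ?_⟩
  · rw [hj.chartIdeal_comap_eq_top hm hu, Ideal.span_singleton_eq_top.mpr hu]
  · rw [hj'.chartIdeal_comap_eq_top hm hu', Ideal.span_singleton_eq_top.mpr hu']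
  · refine mul_right_cancel₀ hX ?_
    rw [hφ, hφ, mul_assoc, chartToFunctionField_ι₁_mul_ι₀, chartToFunctionField_ι₁_mul_ι₀, hf]

/-- A neighbourhood of the part `s = 0` of the `s = t⁻¹`-chart misses the divisors
`1 + τ s ^ k = 0` and `1 + τ' s ^ k = 0`, and the rest is covered by the `t`-chart. -/
theorem exists_chart_hasDivisorOnChart [IsOpenImmersion c] [IsOpenImmersion j]
    (hj : IsSectionChart σ hσ c j τ) (hj' : IsSectionChart σ' hσ' c j τ') (hk : k ≠ 0)
    (hm : i ≫ m = P1.map (RingHom.id _) 1 k ≫ j)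
    (hf : f * chartToFunctionField (R := .of ℂ[X][X]) (P1.ι₀ ℂ[X] ≫ i) (X ^ k + Polynomial.C τ') =
      chartToFunctionField (R := .of ℂ[X][X]) (P1.ι₀ ℂ[X] ≫ i) (X ^ k + Polynomial.C τ))
    (y : P1 ℂ[X]) :
    ∃ (P : CommRingCat.{0}) (_ : Nonempty (Spec P)) (e : Spec P ⟶ Y) (_ : IsOpenImmersion e),
      i y ∈ Set.range e ∧ HasDivisorOnChart f ((sectionE σ hσ).ker.comap m)
        ((sectionE σ' hσ').ker.comap m) e := by
  let d : ℂ[X][X] := (1 + Polynomial.C τ * X ^ k) * (1 + Polynomial.C τ' * X ^ k)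
  let A := Localization.Away d
  have hXd : (X : ℂ[X][X]) ∣ d - 1 := by
    simp [d, X_dvd_iff, mul_coeff_zero, coeff_X_pow, hk.symm]
  obtain ⟨a, rfl⟩ | ⟨b, rfl⟩ := P1.mem_range_ι₀_or_mem_range_localizationAway_ι₁ A hXd y
  · exact ⟨_, inferInstance, P1.ι₀ ℂ[X] ≫ i, inferInstance, ⟨a, rfl⟩,
      hasDivisorOnChart_ι₀ hj hj' hm hf⟩
  · have : IsOpenImmersion (Spec.map (CommRingCat.ofHom (algebraMap ℂ[X][X] A))) :=
      IsOpenImmersion.of_isLocalization d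
    have hd : IsUnit (algebraMap ℂ[X][X] A d) := IsLocalization.Away.algebraMap_isUnit d
    rw [map_mul, IsUnit.mul_iff] at hd
    have : Nontrivial A := PrimeSpectrum.nonempty_iff_nontrivial.mp ⟨b⟩
    exact ⟨.of A, ⟨b⟩, Spec.map (CommRingCat.ofHom (algebraMap ℂ[X][X] A)) ≫ P1.ι₁ ℂ[X] ≫ i,
      inferInstance, ⟨b, rfl⟩, hasDivisorOnChart_localization_ι₁ hj hj' hm hf hd.1 hd.2⟩

theorem coordMap_invX_X_pow_add_C (n k : ℕ) (hσ : σ.IsHomogeneous (k * n)) :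
    P1.coordMap invX (tUnit ℂ (-n)) 1 (X ^ k + Polynomial.C (dehom₁ σ)) =
      Polynomial.C (T (-(k * n : ℕ))) *
        P1.coordMap (toLaurent : ℂ[X] →+* ℂ[T;T⁻¹]) 1 1 (X ^ k + Polynomial.C (dehom₀ σ)) := by
  simpa [P1.coordMap, tUnit, invX_dehom₁ hσ, mul_pow, mul_add, ← map_pow, T_pow] using
    mul_comm (Polynomial.C (toLaurent (dehom₀ σ))) (Polynomial.C (T (-(k * n))))

theorem exists_chartToFunctionField_j₁_eq_mul (n k : ℕ) :
    ∃ u : (Hirz n).functionField, ∀ σ : MvPolynomial (Fin 2) ℂ, σ.IsHomogeneous (k * n) →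
      chartToFunctionField (R := .of ℂ[X][X]) (P1.ι₀ ℂ[X] ≫ j₁ n)
        (X ^ k + Polynomial.C (dehom₁ σ)) =
      u * ruledFunction n (X ^ k + Polynomial.C (dehom₀ σ)) := by
  have : IsOpenImmersion (Spec.map (CommRingCat.ofHom (toLaurent : ℂ[X] →+* ℂ[T;T⁻¹]))) :=
    inferInstanceAs (IsOpenImmersion (gm₀ ℂ))
  have : IsOpenImmersion (Spec.map (CommRingCat.ofHom invX)) :=
    inferInstanceAs (IsOpenImmersion (gm₁ ℂ))
  have := P1.isOpenImmersion_coordMap (toLaurent : ℂ[X] →+* ℂ[T;T⁻¹]) 1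
  have := P1.isOpenImmersion_coordMap invX (tUnit ℂ (-n))
  obtain ⟨κ, hκ₀, hκ₁⟩ := exists_chartToFunctionField_eq (P1.ι₀ ℂ[X] ≫ j₀ n) (P1.ι₀ ℂ[X] ≫ j₁ n)
    (CommRingCat.ofHom (P1.coordMap (toLaurent : ℂ[X] →+* ℂ[T;T⁻¹]) 1 1))
    (CommRingCat.ofHom (P1.coordMap invX (tUnit ℂ (-n)) 1)) (by
      rw [← reassoc_of% (P1.ι₀_map), ← reassoc_of% (P1.ι₀_map)]
      exact congr(_ ≫ $(glue n)))
  refine ⟨κ (Polynomial.C (T (-(k * n : ℕ)))), fun σ hσ ↦ ?_⟩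
  rw [ruledFunction, hκ₀, hκ₁]
  exact (congrArg κ (coordMap_invX_X_pow_add_C n k hσ)).trans (map_mul κ _ _)

theorem hasDivisor_ruledFunction_div {n k : ℕ} (hk : k ≠ 0) (hσ : σ.IsHomogeneous (k * n))
    (hσ' : σ'.IsHomogeneous (k * n)) :
    HasDivisor (ruledFunction n (X ^ k + Polynomial.C (dehom₀ σ)) /
        ruledFunction n (X ^ k + Polynomial.C (dehom₀ σ')))
      ((sectionE σ hσ).ker.comap (mu n k)) ((sectionE σ' hσ').ker.comap (mu n k)) := by
  have hne : ruledFunction n (X ^ k + Polynomial.C (dehom₀ σ')) ≠ 0 :=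
    (map_ne_zero_iff _ (chartToFunctionField_injective _)).mpr
      (X_pow_add_C_ne_zero hk.pos _)
  obtain ⟨u, hu⟩ := exists_chartToFunctionField_j₁_eq_mul n k
  refine hasDivisor_of_forall_exists_chart fun y ↦ ?_
  obtain ⟨y, rfl⟩ | ⟨y, rfl⟩ := exists_chart y
  · exact exists_chart_hasDivisorOnChart isSectionChart_j₀ isSectionChart_j₀ hk (j₀_mu n k)
      (div_mul_cancel₀ _ hne) y
  · refine exists_chart_hasDivisorOnChart isSectionChart_j₁ isSectionChart_j₁ hk (j₁_mu n k) ?_ y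
    rw [hu σ hσ, hu σ' hσ', mul_left_comm, div_mul_cancel₀ _ hne]

end Hirz

theorem hasDivisor_branchFunction {σ : MvPolynomial (Fin 2) ℂ} (hσ : σ.IsHomogeneous 8) :
    HasDivisor (branchFunction σ) (muPullbackE σ hσ)
      (muPullbackE 0 (MvPolynomial.isHomogeneous_zero _ _ _)) := by
  have h := Hirz.hasDivisor_ruledFunction_div (n := 2) four_ne_zero hσ
    (MvPolynomial.isHomogeneous_zero _ _ _)
  rwa [Hirz.dehom₀, Hirz.dehom₀, map_zero, C_0, add_zero] at h

end Divisor

section Dehomogenization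

open Polynomial LaurentPolynomial

theorem invX_injective : Function.Injective invX := by
  have h : invX = (invert (R := ℂ)).toRingEquiv.toRingHom.comp (toLaurent : ℂ[X] →+* ℂ[T;T⁻¹]) := by
    ext <;> simp [invX]
  rw [h]
  exact invert.injective.comp toLaurent_injective

theorem Hirz.dehom₀_ne_zero {n : ℕ} {σ : MvPolynomial (Fin 2) ℂ} (hσ : σ.IsHomogeneous n)
    (h0 : σ ≠ 0) : Hirz.dehom₀ σ ≠ 0 := by
  intro h
  have h₁ : Hirz.dehom₁ σ = 0 := by
    rw [← map_eq_zero_iff _ invX_injective, Hirz.invX_dehom₁ hσ, h, map_zero, mul_zero]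
  exact h0 (by rw [← homogenize_eq_of_isHomogeneous hσ h₁, homogenize_zero])

end Dehomogenization

section Zeros

instance infinite_projectivization {K : Type*} [Field K] [Infinite K] :
    Infinite (Projectivization K (Fin 2 → K)) := by
  classical exact .of_injective _ (OnePoint.equivProjectivization K).injective

theorem ne_zero_of_ncard_zeros_ne_zero {K : Type*} [Field K] [Infinite K]
    {p : MvPolynomial (Fin 2) K}
    (h : {P : Projectivization K (Fin 2 → K) | MvPolynomial.eval P.rep p = 0}.ncard ≠ 0) :
    p ≠ 0 := by
  rintro rfl
  simp only [map_zero, Set.ofPred_true, Set.infinite_univ.ncard, ne_eq, not_true_eq_false] at h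

end Zeros

end KummerK3

end

theorem mainTheorem3_general (σ : MvPolynomial (Fin 2) ℂ) (hσ : σ.IsHomogeneous 8) (hσ₀ : σ ≠ 0)
    (ζ : ℂ) (hζ : IsPrimitiveRoot ζ 4) :
    KummerK3.HasDivisor (KummerK3.branchFunction σ) (KummerK3.muPullbackE σ hσ)
        (KummerK3.muPullbackE 0 (MvPolynomial.isHomogeneous_zero _ _ _)) ∧
      AlgebraicGeometry.Scheme.BirationalOver (KummerK3.surfaceY.str σ)
        (KummerK3.quotientCE.str σ ζ hζ.pow_eq_one) :=
  ⟨KummerK3.hasDivisor_branchFunction hσ, KummerK3.birationalOver_surfaceY_quotientCE σ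
    (KummerK3.Hirz.dehom₀_ne_zero hσ hσ₀) hζ⟩

theorem mainTheorem3 (σ : MvPolynomial (Fin 2) ℂ) (hσ : σ.IsHomogeneous 8)
    (hzeros : {P : Projectivization ℂ (Fin 2 → ℂ) | MvPolynomial.eval P.rep σ = 0}.ncard = 8)
    (ζ : ℂ) (hζ : IsPrimitiveRoot ζ 4) :
    KummerK3.HasDivisor (KummerK3.branchFunction σ) (KummerK3.muPullbackE σ hσ)
        (KummerK3.muPullbackE 0 (MvPolynomial.isHomogeneous_zero _ _ _)) ∧
      AlgebraicGeometry.Scheme.BirationalOver (KummerK3.surfaceY.str σ)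
        (KummerK3.quotientCE.str σ ζ hζ.pow_eq_one) :=
  mainTheorem3_general σ hσ (KummerK3.ne_zero_of_ncard_zeros_ne_zero (by simp [hzeros])) ζ hζ
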